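/- **Theorem 2.3 (limiting spectral density of the discrete $q$-deformed GUE and its finite-size correction).** Notation: for $0<q<1$ write $(a;q)_n=\prod_{l=0}^{n-1}(1-aq^l)$, $(a;q)_\infty=\prod_{l\ge0}(1-aq^l)$, $(a_1,\dots,a_k;q)_\infty=\prod_i(a_i;q)_\infty$; the Jackson integral is $\int_0^a g\,d_qx=(1-q)\sum_{k\ge0}aq^k g(aq^k)$, $\int_a^b=\int_0^b-\int_0^a$. Let $$\omega(x)=\frac{(qx,-qx;q)_\infty}{(q,-1,-q;q)_\infty},\qquad H_n(x;q)=\sum_{k=0}^{\lfloor n/2\rfloor}(-1)^k\frac{(q^{-n};q^2)_k(q^{-n+1};q^2)_k\,q^{k(2n-k)}}{(q^2;q^2)_k}\,x^{n-2k},$$ $$\rho_N(x)=\frac1{1-q}\sum_{j=0}^{N-1}\frac{H_j(x;q)^2}{(q;q)_j\,q^{j(j-1)/2}}\,\omega(x),\qquad \widetilde\rho_N(x)=\frac1{\sqrt q}\,\rho_N\Big(\frac{x}{\sqrt q}\Big),$$ the discrete $q$-Hermite weight and polynomials, the eigenvalue density (with respect to $d_qx$ on $[-1,1]$) of the discrete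 $q$-deformed GUE, and its rescaling, which is a density with respect to $d_qx$ on $[-\sqrt q,\sqrt q]$. Fix $\lambda>0$, let $q=e^{-\lambda/N}$ and $b(\lambda)=2\sqrt{(1-e^{-\lambda})e^{-\lambda}}$. Then, in the sense of integration against smooth functions, $$\frac1N\widetilde\rho_N(x)=\widetilde\rho_{(0)}(x)+\frac{\widetilde\rho_{(1)}(x)}{N^2}+O(N^{-4}),\qquad N\to\infty;$$ that is, for every $C^\infty$ function $f:\mathbb R\to\mathbb R$, $$\frac1N\int_{-\sqrt q}^{\sqrt q}f(x)\,\widetilde\rho_N(x)\,d_qx=\int_{\mathbb R}f(x)\,\widetilde\rho_{(0)}(x)\,dx+\frac1{N^2}\Big\langle\widetilde\rho_{(1)},f\Big\rangle+O(N^{-4}),\qquad N\to\infty,$$ where the implied constant may depend on $\lambda$ and $f$, the Jackson sums and the integral against $\widetilde\rho_{(0)}$ converge absolutely, and $$\begin{aligned}\widetilde\rho_{(0)}(x)&=\frac1{\pi\lambda x}\arg\!\left(\frac{2e^{-\lambda}-x+i\sqrt{4(1-e^{-\lambda})e^{-\lambda}-x^2}}{2e^{-\lambda}+x+i\sqrt{4(1-e^{-\lambda})e^{-\lambda}-x^2}}\right)\mathbf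 1_{(-b(\lambda),b(\lambda))}(x)\\&\quad+\begin{cases}0,&\lambda\le\log2,\\ \dfrac1{\lambda|x|}\Big(\mathbf 1_{(-1,1)}(x)-\mathbf 1_{(-b(\lambda),b(\lambda))}(x)\Big),&\lambda>\log2,\end{cases}\end{aligned}$$ with the principal argument, and, for $|x|<1$, $$\begin{aligned}\widetilde\rho_{(1)}(x)&=-\frac{\lambda}{\pi}\,\frac{e^{-\lambda}(1-e^{-\lambda})}{2}\,(x^2-2e^{-\lambda})\,(b(\lambda)^2-x^2)^{-5/2}\,\mathbf 1_{(-b(\lambda),b(\lambda))}(x)\\&\quad-\frac{\lambda}{3\pi}\int_{\frac12-x^*}^{\min\{1-e^{-\lambda},\,\frac12+x^*\}}t\,\big(x^2+2t(1-t)\big)\,\big(4t(1-t)-x^2\big)^{-5/2}\,dt,\qquad x^*=\tfrac12\sqrt{1-x^2},\end{aligned}$$ the integral being $0$ when its upper limit does not exceed its lower limit. The pairing $\langle\widetilde\rho_{(1)},f\rangle$ is understood in Hadamard-regularised form: replace both exponents $-5/2$ by a complex number $s$, giving $\widetilde\rho_{(1)}(s;x)$. For $\operatorname{Re}s>0$ all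 integrals in $\int_{-1}^1f(x)\,\widetilde\rho_{(1)}(s;x)\,dx$ converge absolutely; this function of $s$ has a meromorphic continuation to an open half-plane $\operatorname{Re}s>c$ with $c<-\tfrac52$, the continuation is regular at $s=-\tfrac52$, and $\langle\widetilde\rho_{(1)},f\rangle$ is its (real) value there. -/

import Mathlib

open scoped ContDiff

noncomputable section

namespace DiscreteQGUE

/-- The finite `q`-Pochhammer symbol `(a; q)_n = (1 - a) (1 - a q) ⋯ (1 - a q ^ (n - 1))`. -/
def qPoch (a q : ℝ) (n : ℕ) : ℝ := ∏ l ∈ Finset.range n, (1 - a * q ^ l)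

/-- The infinite `q`-Pochhammer symbol `(a; q)_∞`. -/
def qPochInf (a q : ℝ) : ℝ := ∏' l : ℕ, (1 - a * q ^ l)

/-- The discrete `q`-Hermite weight `(q x, -q x; q)_∞ / (q, -1, -q; q)_∞`. -/
def weight (q x : ℝ) : ℝ :=
  (qPochInf (q * x) q * qPochInf (-(q * x)) q) /
    (qPochInf q q * qPochInf (-1) q * qPochInf (-q) q)

/-- The discrete `q`-Hermite polynomial `H_n(x; q)`. -/
def qHermite (n : ℕ) (x q : ℝ) : ℝ :=
  ∑ k ∈ Finset.range (n / 2 + 1),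
    (-1) ^ k *
      (qPoch (q ^ (-(n : ℤ))) (q ^ 2) k * qPoch (q ^ (-(n : ℤ) + 1)) (q ^ 2) k
          * q ^ (k * (2 * n - k)) /
        qPoch (q ^ 2) (q ^ 2) k) *
      x ^ (n - 2 * k)

/-- The eigenvalue density `ρ_N` of the discrete `q`-deformed GUE
(a density with respect to the Jackson integral on `[-1, 1]`). -/
def density (q : ℝ) (N : ℕ) (x : ℝ) : ℝ :=
  1 / (1 - q) *
    ∑ j ∈ Finset.range N,
      qHermite j x q ^ 2 / (qPoch q q j * q ^ (j * (j - 1) / 2)) * weight q x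

/-- The rescaled density `q^{-1/2} ρ_N(q^{-1/2} x)`, the density of the points `√q x_j`.
It lives on the lattice `± q ^ (k + 1/2)`, and its `2p`-th moment is `q ^ p` times
that of `ρ_N`. -/
def scaledDensity (q : ℝ) (N : ℕ) (x : ℝ) : ℝ :=
  1 / √q * density q N (x / √q)

/-- Convergence of the series defining the Jackson integral of `g` from `0` to `a`. -/
def JacksonSummable (q a : ℝ) (g : ℝ → ℝ) : Prop :=
  Summable fun k : ℕ => a * q ^ k * g (a * q ^ k)

/-- The Jackson integral `∫_0^a g(x) d_q x`. -/
def jackson (q a : ℝ) (g : ℝ → ℝ) : ℝ :=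
  (1 - q) * ∑' k : ℕ, a * q ^ k * g (a * q ^ k)

/-- The Jackson integral `∫_a^b g(x) d_q x`. -/
def jacksonInterval (q a b : ℝ) (g : ℝ → ℝ) : ℝ := jackson q b g - jackson q a g

/-- The scaling `q = e^{-lam / N}`. -/
def qScaled (lam : ℝ) (N : ℕ) : ℝ := Real.exp (-lam / N)

/-- `b(lam) = 2 √((1 - e^{-lam}) e^{-lam})`. -/
def edge (lam : ℝ) : ℝ := 2 * √((1 - Real.exp (-lam)) * Real.exp (-lam))

/-- The indicator function of the interval `(-c, c)`. -/
def symIndicator (c x : ℝ) : ℝ := (Set.Ioo (-c) c).indicator (fun _ => (1 : ℝ)) x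

/-- The leading term of the density. -/
def rhoZero (lam x : ℝ) : ℝ :=
  1 / (Real.pi * lam * x) *
      Complex.arg
        (((2 * Real.exp (-lam) - x : ℝ) +
            Complex.I * (√(4 * (1 - Real.exp (-lam)) * Real.exp (-lam) - x ^ 2) : ℝ)) /
          ((2 * Real.exp (-lam) + x : ℝ) +
            Complex.I * (√(4 * (1 - Real.exp (-lam)) * Real.exp (-lam) - x ^ 2) : ℝ))) *
      symIndicator (edge lam) x +
    if lam ≤ Real.log 2 then 0
    else 1 / (lam * |x|) * (symIndicator 1 x - symIndicator (edge lam) x)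

/-- `x^* = √(1 - x²) / 2`. -/
def xStar (x : ℝ) : ℝ := 1 / 2 * √(1 - x ^ 2)

/-- The range of integration `(1/2 - x^*, min {1 - e^{-lam}, 1/2 + x^*})`, empty if the upper end
does not exceed the lower one. For `|x| < 1` it is the set of `t` in `(0, 1 - e^{-lam})` with
`4 t (1 - t) > x²`. -/
def tRange (lam x : ℝ) : Set ℝ :=
  Set.Ioo (1 / 2 - xStar x) (min (1 - Real.exp (-lam)) (1 / 2 + xStar x))

/-- The integrand of the integral over `t` in the correction, with a general exponent `s`. -/
def innerIntegrand (s : ℂ) (x t : ℝ) : ℂ :=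
  ((t * (x ^ 2 + 2 * t * (1 - t)) : ℝ) : ℂ) * ((4 * t * (1 - t) - x ^ 2 : ℝ) : ℂ) ^ s

/-- The expression for the correction to the density, with a general exponent `s` in place
of `-5/2`. -/
def rhoOne (lam : ℝ) (s : ℂ) (x : ℝ) : ℂ :=
  -((1 / Real.pi * lam * (Real.exp (-lam) * (1 - Real.exp (-lam)) / 2)
        * (x ^ 2 - 2 * Real.exp (-lam)) : ℝ) : ℂ) *
      ((edge lam ^ 2 - x ^ 2 : ℝ) : ℂ) ^ s * (symIndicator (edge lam) x : ℂ) -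
    ((1 / Real.pi * (lam / 3) : ℝ) : ℂ) * ∫ t in tRange lam x, innerIntegrand s x t

/-- The integral of `f` against the correction with exponent `s`, for `s` where it converges. -/
def rhoOnePairing (lam : ℝ) (f : ℝ → ℝ) (s : ℂ) : ℂ :=
  ∫ x in Set.Ioo (-1 : ℝ) 1, (f x : ℂ) * rhoOne lam s x

/-- Convergence of all integrals that enter `rhoOnePairing lam f s`. -/
def RhoOnePairingConverges (lam : ℝ) (f : ℝ → ℝ) (s : ℂ) : Prop :=
  (∀ x ∈ Set.Ioo (-1 : ℝ) 1,
      MeasureTheory.IntegrableOn (innerIntegrand s x) (tRange lam x)) ∧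
    MeasureTheory.IntegrableOn (fun x => (f x : ℂ) * rhoOne lam s x) (Set.Ioo (-1 : ℝ) 1)

/-- `v` is the value at `s₀` of the meromorphic continuation of `F`, given for `Re s > 0`, to an
open half-plane that contains `s₀`, and `s₀` is not a pole (Hadamard regularisation). Such a `v`
is unique by the identity theorem. -/
def IsRegularisedValue (F : ℂ → ℂ) (s₀ v : ℂ) : Prop :=
  ∃ c : ℝ, c < s₀.re ∧ ∃ A : ℂ → ℂ,
    MeromorphicOn A {s : ℂ | c < s.re} ∧
    (∀ s : ℂ, 0 < s.re → c < s.re → A s = F s) ∧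
    AnalyticAt ℂ A s₀ ∧ A s₀ = v

end DiscreteQGUE

end

/-! ### Discrete `q`-Hermite polynomials: shift relations and the `q`-difference equation. -/

namespace DiscreteQGUE

/-! Put ε = λ/N and q = e^{-ε}, and let E_j[F] be the mean of F(q x²) over the positive lattice
points x = q^k, taken against the normalised H_j² ω. By parity the Jackson integral of f against the
rescaled density is the sum over j < N of E_j applied to the even part of f. So E_j[F] has to be
expanded up to an error ε⁴, uniformly in j, and then summed.

For a polynomial F this rests on an exact relation. The second order q-difference equation
(`qHermite_qDiff`) and summation by parts on the lattice (`latticeSum_shift`) give a three-term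
recurrence for the moments (`hermiteMoment_recurrence`). In terms of y = e^{-ε(j+1/2)} its
coefficients are combinations of sinh(aε) with a affine in the index of the moment; that is, E_j
annihilates `relOp` built from sinh (`hermiteExp_relOp`). Expanding sinh gives E_j[LF] + ε² E_j[KF]
= O(ε⁴), where L and K are `relOp` for a and a³/6. Here L is conjugate to multiplication by s - v
with v = 4y(1-y), so it can be inverted up to the arcsine mean on [0, v] (`relOp_solveOp`). Using
the relation twice yields E_j[F] = arcsine mean + ε² correction + O(ε⁴) (`hermiteExp_expansion`).
All errors are bounded by finitely many derivatives of F on a fixed interval, because the multiplier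
e^{cnσ} on coefficients is a dilation of the argument.

The values y are the samples of e^{-λτ} at the midpoints τ = (j+1/2)/N, so the sum over j is a
midpoint rule with an endpoint correction of order N⁻² (`sum_hermiteExp_expansion`).

It remains to recognise the two coefficients. With t = 1 - e^{-λτ} the leading one is a
superposition of arcsine laws of half-width 2√(t(1-t)), and its integral over t is elementary and
equals `rhoZero` (`rhoZero_eq_integral`). In the pairing with the correction, scaling produces
integrals of f(ar) against (1-r²)^s; three integrations by parts raise the exponent by three
(`gegenbauer_raise`). This continues the pairing to Re s > -3 with possible poles only at -1 and -2,
and leaves the harmless exponent 1/2 at s = -5/2 (`isRegularisedValue_regValue`). The value found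
there agrees with the coefficient of N⁻² on monomials (`regValue_pow_even`,
`limitCorrection_monomial`).

Finally a smooth f is replaced by a polynomial depending on N that is N⁻⁴-close in C²⁴; every
functional involved is bounded in some C^k norm, so this costs only O(N⁻⁴)
(`abs_jackson_expansion_le`). -/

theorem qPoch_zero (a q : ℝ) : qPoch a q 0 = 1 := by simp [qPoch]

theorem qPoch_succ (a q : ℝ) (n : ℕ) : qPoch a q (n + 1) = qPoch a q n * (1 - a * q ^ n) := by
  simp [qPoch, Finset.prod_range_succ]

theorem qPoch_self_pos {q : ℝ} (h0 : 0 < q) (h1 : q < 1) (n : ℕ) : 0 < qPoch q q n := by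
  refine Finset.prod_pos fun l _ => ?_
  have : q * q ^ l < 1 := by
    rw [← pow_succ']; exact pow_lt_one₀ h0.le h1 (by simp)
  linarith

/-- The coefficient of `x ^ (n - 2 k)` in the discrete `q`-Hermite polynomial. -/
noncomputable def hermiteCoeff (q : ℝ) (n k : ℕ) : ℝ :=
  if 2 * k ≤ n then
    (-1) ^ k * q ^ (k * (k - 1)) * qPoch q q n / (qPoch (q ^ 2) (q ^ 2) k * qPoch q q (n - 2 * k))
  else 0

theorem hermiteCoeff_of_lt (q : ℝ) {n k : ℕ} (h : n < 2 * k) : hermiteCoeff q n k = 0 := by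
  simp [hermiteCoeff, not_le.2 h]

theorem hermiteCoeff_add (q : ℝ) (m k : ℕ) : hermiteCoeff q (m + 2 * k) k =
    (-1) ^ k * q ^ (k * (k - 1)) * qPoch q q (m + 2 * k) /
      (qPoch (q ^ 2) (q ^ 2) k * qPoch q q m) := by
  simp [hermiteCoeff]

/-- Each factor is 1 - q^{-r} = -q^{-r}(1 - q^r). The signs cancel in pairs, and q^{k(2n-k)} clears
the negative powers up to q^{k(k-1)}. The factor (q;q)_m with m = n - 2k completes the 2k
consecutive factors to (q;q)_n. -/
theorem qPoch_neg_mul {q : ℝ} (h0 : 0 < q) (n k m : ℕ) (h : n = m + 2 * k) :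
    qPoch (q ^ (-(n : ℤ))) (q ^ 2) k * qPoch (q ^ (-(n : ℤ) + 1)) (q ^ 2) k
      * q ^ (k * (2 * n - k)) * qPoch q q m = q ^ (k * (k - 1)) * qPoch q q n := by
  induction k generalizing m with
  | zero => simp [qPoch_zero, h]
  | succ k ih =>
    have ih' := ih (m + 2) (by omega)
    rw [qPoch_succ, qPoch_succ] at ih'
    rw [qPoch_succ, qPoch_succ]
    have e1 : (k + 1) * (2 * n - (k + 1)) = k * (2 * n - k) + (2 * k + (m + 2) + (m + 1)) := by
      subst h
      have a1 : 2 * (m + 2 * (k + 1)) - (k + 1) = 2 * m + 3 * k + 3 := by omega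
      have a2 : 2 * (m + 2 * (k + 1)) - k = 2 * m + 3 * k + 4 := by omega
      rw [a1, a2]; ring
    have e2 : (k + 1) * (k + 1 - 1) = k * (k - 1) + 2 * k := by
      rcases k with _ | k
      · simp
      · simp only [Nat.add_sub_cancel]; ring
    have e3 : q ^ (-(n : ℤ)) * (q ^ 2) ^ k * q ^ (m + 2) = 1 := by
      rw [← pow_mul, ← zpow_natCast, ← zpow_natCast, ← zpow_add₀ h0.ne', ← zpow_add₀ h0.ne']
      rw [show -(n : ℤ) + ((2 * k : ℕ) : ℤ) + ((m + 2 : ℕ) : ℤ) = 0 by push_cast [h]; ring]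
      simp
    have e4 : q ^ (-(n : ℤ) + 1) * (q ^ 2) ^ k * q ^ (m + 1) = 1 := by
      rw [← pow_mul, ← zpow_natCast, ← zpow_natCast, ← zpow_add₀ h0.ne', ← zpow_add₀ h0.ne']
      rw [show -(n : ℤ) + 1 + ((2 * k : ℕ) : ℤ) + ((m + 1 : ℕ) : ℤ) = 0 by push_cast [h]; ring]
      simp
    rw [e1, e2, pow_add, pow_add, pow_add, pow_add q (k * (k - 1))]
    generalize q ^ (-(n : ℤ)) * (q ^ 2) ^ k = u at *
    generalize q ^ (-(n : ℤ) + 1) * (q ^ 2) ^ k = v at *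
    have e7 : q ^ (k * (k - 1)) * q ^ (2 * k) * qPoch q q n =
        q ^ (2 * k) * (q ^ (k * (k - 1)) * qPoch q q n) := by ring
    rw [e7, ← ih']
    have e5 : (1 - u) * q ^ (m + 2) = q ^ (m + 2) - 1 := by linear_combination -e3
    have e6 : (1 - v) * q ^ (m + 1) = q ^ (m + 1) - 1 := by linear_combination -e4
    calc _ = qPoch (q ^ (-(n : ℤ))) (q ^ 2) k * qPoch (q ^ (-(n : ℤ) + 1)) (q ^ 2) k *
          q ^ (k * (2 * n - k)) * q ^ (2 * k) * qPoch q q m * ((1 - u) * q ^ (m + 2)) *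
            ((1 - v) * q ^ (m + 1)) := by ring
      _ = _ := by rw [e5, e6]; ring

/-- The length `M` is free, the excess terms being zero, so that polynomials of neighbouring degrees
can be compared over a common range. -/
theorem qHermite_eq_sum {q : ℝ} (h0 : 0 < q) (h1 : q < 1) (n : ℕ) (x : ℝ) {M : ℕ}
    (hM : n / 2 + 1 ≤ M) :
    qHermite n x q = ∑ k ∈ Finset.range M, hermiteCoeff q n k * x ^ (n - 2 * k) := by
  rw [← Finset.sum_subset (Finset.range_mono hM)]
  · refine Finset.sum_congr rfl fun k hk => ?_
    have hk' : 2 * k ≤ n := by have := Finset.mem_range.1 hk; omega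
    have key := qPoch_neg_mul h0 n k (n - 2 * k) (by omega)
    have p1 := (qPoch_self_pos h0 h1 (n - 2 * k)).ne'
    have p2 := (qPoch_self_pos (q := q ^ 2) (by positivity) (pow_lt_one₀ h0.le h1 (by simp)) k).ne'
    rw [hermiteCoeff, if_pos hk']
    congr 1
    rw [mul_assoc ((-1 : ℝ) ^ k), ← key]
    field_simp
  · intro k _ hk
    rw [hermiteCoeff_of_lt, zero_mul]
    have := Finset.mem_range.not.1 hk; omega

theorem qHermite_zero (x q : ℝ) : qHermite 0 x q = 1 := by simp [qHermite, qPoch_zero]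

/-- Replacing x by qx multiplies the term of degree n + 1 - 2k by q^{n+1-2k}, and 1 - q^{n+1-2k} is
the ratio of (q;q)_{n+1-2k} to (q;q)_{n-2k}. -/
theorem qHermite_lowering {q : ℝ} (h0 : 0 < q) (h1 : q < 1) (n : ℕ) (x : ℝ) :
    qHermite (n + 1) x q - qHermite (n + 1) (q * x) q = (1 - q ^ (n + 1)) * x * qHermite n x q := by
  rw [qHermite_eq_sum h0 h1 (n + 1) x (M := n + 2) (by omega),
    qHermite_eq_sum h0 h1 (n + 1) (q * x) (M := n + 2) (by omega),
    qHermite_eq_sum h0 h1 n x (M := n + 2) (by omega), ← Finset.sum_sub_distrib, Finset.mul_sum]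
  refine Finset.sum_congr rfl fun k _ => ?_
  rcases lt_trichotomy n (2 * k - 1) with h | h | h
  · rw [hermiteCoeff_of_lt q (by omega), hermiteCoeff_of_lt q (by omega)]; simp
  -- The subtraction is truncated: n = 2k - 1 means either k = n = 0, or that the term of H_{n+1} is
  -- constant in x and cancels in the difference.
  · rcases Nat.eq_zero_or_pos k with rfl | hk
    · simp only [mul_zero, zero_tsub] at h
      subst h
      simp [hermiteCoeff, qPoch]
      have : 1 - q ≠ 0 := by linarith
      field_simp
    · rw [show n + 1 - 2 * k = 0 by omega, hermiteCoeff_of_lt q (n := n) (by omega)]; simp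
  · obtain ⟨m, rfl⟩ : ∃ m, n = m + 2 * k := ⟨n - 2 * k, by omega⟩
    rw [show m + 2 * k + 1 = (m + 1) + 2 * k by ring, hermiteCoeff_add, hermiteCoeff_add,
      Nat.add_sub_cancel, Nat.add_sub_cancel, show (m + 1) + 2 * k = (m + 2 * k) + 1 by ring,
      qPoch_succ, qPoch_succ]
    have p1 := (qPoch_self_pos h0 h1 (m + 1)).ne'
    rw [qPoch_succ] at p1
    have p3 := left_ne_zero_of_mul p1
    have p4 := right_ne_zero_of_mul p1
    have p2 := (qPoch_self_pos (q := q ^ 2) (by positivity) (pow_lt_one₀ h0.le h1 (by simp)) k).ne'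
    rw [mul_pow]
    field_simp
    ring

/-- The raising relation, coefficient by coefficient. The cases n ≤ 2k, n = 2k + 1 and n ≥ 2k + 2
differ in which coefficients vanish. -/
theorem hermiteCoeff_succ_succ {q : ℝ} (h0 : 0 < q) (h1 : q < 1) (n k : ℕ) :
    hermiteCoeff q (n + 1) (k + 1) * q ^ (n - 2 * k) - q ^ (n + 2) * hermiteCoeff q n (k + 1) =
      q ^ n * hermiteCoeff q n k * (q ^ (n - 2 * k) - 1) := by
  have p2 := (qPoch_self_pos (q := q ^ 2) (by positivity) (pow_lt_one₀ h0.le h1 (by simp))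
    (k + 1)).ne'
  rw [qPoch_succ] at p2
  have p5 := left_ne_zero_of_mul p2
  have p6 := right_ne_zero_of_mul p2
  have e2 : (k + 1) * (k + 1 - 1) = k * (k - 1) + 2 * k := by
    rcases k with _ | k
    · simp
    · simp only [Nat.add_sub_cancel]; ring
  rcases Nat.lt_or_ge n (2 * k + 1) with h | h
  · rw [hermiteCoeff_of_lt q (n := n + 1) (by omega), hermiteCoeff_of_lt q (n := n) (k := k + 1)
      (by omega), show n - 2 * k = 0 by omega]
    simp
  rcases h.eq_or_lt with h | h
  · subst h
    rw [hermiteCoeff_of_lt q (n := 2 * k + 1) (k := k + 1) (by omega),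
      show 2 * k + 1 + 1 = 0 + 2 * (k + 1) by ring, hermiteCoeff_add,
      show 2 * k + 1 = 1 + 2 * k by ring, hermiteCoeff_add, Nat.add_sub_cancel,
      show (k + 1) * k = k * (k - 1) + 2 * k from e2,
      show 0 + 2 * (k + 1) = (1 + 2 * k) + 1 by ring, qPoch_succ q q (1 + 2 * k), qPoch_succ, qPoch_zero,
      qPoch_succ, qPoch_zero, show 1 + 2 * k - 2 * k = 1 by omega]
    have : 1 - q ≠ 0 := by linarith
    field_simp
    simp only [pow_succ, pow_add, pow_mul]
    ring
  · obtain ⟨m, rfl⟩ : ∃ m, n = m + 2 + 2 * k := ⟨n - 2 * k - 2, by omega⟩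
    rw [hermiteCoeff_add, show m + 2 + 2 * k + 1 = (m + 1) + 2 * (k + 1) by ring, hermiteCoeff_add,
      show m + 2 + 2 * k = m + 2 * (k + 1) by ring, hermiteCoeff_add, e2,
      show (m + 1) + 2 * (k + 1) = (m + 2 * (k + 1)) + 1 by ring, qPoch_succ q q (m + 2 * (k + 1)),
      show m + 2 * (k + 1) - 2 * k = m + 2 by omega,
      qPoch_succ (q ^ 2), qPoch_succ q q (m + 1), qPoch_succ q q m]
    have p1 := (qPoch_self_pos h0 h1 (m + 2)).ne'
    rw [qPoch_succ, qPoch_succ] at p1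
    have p4 := right_ne_zero_of_mul p1
    have p3 := left_ne_zero_of_mul p1
    have p8 := right_ne_zero_of_mul p3
    have p9 := left_ne_zero_of_mul p3
    field_simp
    simp only [pow_succ, pow_add, pow_mul]
    ring

/-- The adjoint of the lowering relation with respect to the weight. The terms of degree n + 2 are
split off on both sides, so that all remaining sums run over the same powers x^{n-2k}. -/
theorem qHermite_raising {q : ℝ} (h0 : 0 < q) (h1 : q < 1) (n : ℕ) (x : ℝ) :
    q ^ n * (qHermite n (q * x) q - (1 - (q * x) ^ 2) * qHermite n x q) =
      q * x * qHermite (n + 1) (q * x) q := by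
  rw [qHermite_eq_sum h0 h1 n (q * x) (M := n + 2) (by omega),
    qHermite_eq_sum h0 h1 n x (M := n + 2) (by omega),
    qHermite_eq_sum h0 h1 (n + 1) (q * x) (M := n + 2 + 1) (by omega)]
  have hb : ∑ k ∈ Finset.range (n + 2), hermiteCoeff q n k * x ^ (n - 2 * k) =
      ∑ k ∈ Finset.range (n + 2), hermiteCoeff q n (k + 1) * x ^ (n - 2 * (k + 1)) + x ^ n := by
    have e := Finset.sum_range_succ' (fun k => hermiteCoeff q n k * x ^ (n - 2 * k)) (n + 2)
    rw [Finset.sum_range_succ, hermiteCoeff_of_lt q (n := n) (k := n + 2) (by omega)] at e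
    simp only [zero_mul, add_zero] at e
    rw [e]
    simp [hermiteCoeff, qPoch_zero, (qPoch_self_pos h0 h1 n).ne']
  have hb2 : (q * x) ^ 2 * ∑ k ∈ Finset.range (n + 2), hermiteCoeff q n k * x ^ (n - 2 * k) =
      ∑ k ∈ Finset.range (n + 2), hermiteCoeff q n (k + 1) * q ^ 2 * x ^ (n - 2 * k) +
        q ^ 2 * x ^ (n + 2) := by
    rw [hb, mul_add, Finset.mul_sum]
    congr 1
    · refine Finset.sum_congr rfl fun k _ => ?_
      rcases Nat.lt_or_ge n (2 * (k + 1)) with h | h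
      · rw [hermiteCoeff_of_lt q h]; simp
      · rw [show n - 2 * k = n - 2 * (k + 1) + 2 by omega, pow_add]; ring
    · ring
  have hc : q * x * ∑ k ∈ Finset.range (n + 2 + 1),
      hermiteCoeff q (n + 1) k * (q * x) ^ (n + 1 - 2 * k) =
      ∑ k ∈ Finset.range (n + 2), hermiteCoeff q (n + 1) (k + 1) * (q * x) ^ (n - 2 * k) +
        (q * x) ^ (n + 2) := by
    rw [Finset.sum_range_succ', mul_add, Finset.mul_sum]
    congr 1
    · refine Finset.sum_congr rfl fun k _ => ?_
      rcases Nat.lt_or_ge n (2 * k + 1) with h | h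
      · rw [hermiteCoeff_of_lt q (n := n + 1) (by omega)]; simp
      · rw [show n - 2 * k = n + 1 - 2 * (k + 1) + 1 by omega, pow_succ]; ring
    · simp [hermiteCoeff, qPoch_zero, (qPoch_self_pos h0 h1 (n + 1)).ne']
      ring
  rw [hc, sub_mul, one_mul, hb2]
  have : ∀ k, q ^ n * (hermiteCoeff q n k * (q * x) ^ (n - 2 * k) -
      hermiteCoeff q n k * x ^ (n - 2 * k) + hermiteCoeff q n (k + 1) * q ^ 2 * x ^ (n - 2 * k)) =
      hermiteCoeff q (n + 1) (k + 1) * (q * x) ^ (n - 2 * k) := by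
    intro k
    have := hermiteCoeff_succ_succ h0 h1 n k
    rw [mul_pow]
    linear_combination (-x ^ (n - 2 * k)) * this
  rw [← Finset.sum_congr rfl fun k _ => this k]
  simp only [Finset.mul_sum, mul_add, mul_sub, Finset.sum_add_distrib, Finset.sum_sub_distrib]
  ring

/-- The second order `q`-difference equation of the discrete `q`-Hermite polynomials. -/
theorem qHermite_qDiff {q : ℝ} (h0 : 0 < q) (h1 : q < 1) (n : ℕ) (x : ℝ) :
    q ^ n * qHermite n (q * (q * x)) q = (q ^ n * (1 + q) - q * (q * x) ^ 2) * qHermite n (q * x) q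
      - q ^ n * q * (1 - (q * x) ^ 2) * qHermite n x q := by
  rcases n with _ | n
  · simp [qHermite_zero]; ring
  -- Lowering at x and at qx expresses H_n(x) and H_n(qx) through values of H_{n+1}; substituting
  -- both into the raising relation leaves an equation for H_{n+1} alone.
  · have l1 := qHermite_lowering h0 h1 n (q * x)
    have l2 := qHermite_lowering h0 h1 n x
    have r := qHermite_raising h0 h1 n x
    generalize qHermite (n + 1) (q * (q * x)) q = a2 at *
    generalize qHermite (n + 1) (q * x) q = a1 at *
    generalize qHermite (n + 1) x q = a0 at *
    generalize qHermite n (q * x) q = b1 at *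
    generalize qHermite n x q = b0 at *
    rw [pow_succ] at *
    linear_combination (-q ^ n * q) * l1 + (q ^ n * q * q * (1 - (q * x) ^ 2)) * l2 -
      (1 - q ^ n * q) * q * q * x * r

end DiscreteQGUE

/-! ### The weight on the lattice and its total mass. -/

namespace DiscreteQGUE

open Filter Topology

theorem multipliable_qPochInf {q : ℝ} (h0 : 0 < q) (h1 : q < 1) (a : ℝ) :
    Multipliable fun l : ℕ => 1 - a * q ^ l := by
  have hs : Summable fun l : ℕ => -(a * q ^ l) :=
    ((summable_geometric_of_lt_one h0.le h1).mul_left a).neg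
  simpa [sub_eq_add_neg] using Real.multipliable_one_add_of_summable hs

theorem tendsto_qPoch {q : ℝ} (h0 : 0 < q) (h1 : q < 1) (a : ℝ) :
    Tendsto (fun n => qPoch a q n) atTop (𝓝 (qPochInf a q)) :=
  (multipliable_qPochInf h0 h1 a).tendsto_prod_tprod_nat

theorem qPochInf_eq_mul {q : ℝ} (h0 : 0 < q) (h1 : q < 1) (a : ℝ) :
    qPochInf a q = (1 - a) * qPochInf (a * q) q := by
  have t1 := (tendsto_qPoch h0 h1 a).comp (tendsto_add_atTop_nat 1)
  have t2 := (tendsto_qPoch h0 h1 (a * q)).const_mul (1 - a)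
  refine tendsto_nhds_unique t1 (t2.congr fun n => ?_)
  simp only [Function.comp, qPoch, Finset.prod_range_succ']
  rw [mul_comm, pow_zero, mul_one]
  congr 1
  refine Finset.prod_congr rfl fun k _ => by ring

theorem qPochInf_ne_zero {q : ℝ} (h0 : 0 < q) (h1 : q < 1) {a : ℝ}
    (ha : ∀ l : ℕ, 1 - a * q ^ l ≠ 0) : qPochInf a q ≠ 0 := by
  have hs : Summable fun l : ℕ => ‖-(a * q ^ l)‖ :=
    (((summable_geometric_of_lt_one h0.le h1).mul_left a).neg).norm
  have := tprod_one_add_ne_zero_of_summable (f := fun l : ℕ => -(a * q ^ l))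
    (fun l => by simpa [sub_eq_add_neg] using ha l) hs
  simpa [qPochInf, sub_eq_add_neg] using this

theorem qPochInf_self_pos {q : ℝ} (h0 : 0 < q) (h1 : q < 1) : 0 < qPochInf q q := by
  refine lt_of_le_of_ne (ge_of_tendsto' (tendsto_qPoch h0 h1 q)
    fun n => (qPoch_self_pos h0 h1 n).le) (qPochInf_ne_zero h0 h1 fun l => ?_).symm
  have : q * q ^ l < 1 := by rw [← pow_succ']; exact pow_lt_one₀ h0.le h1 (by simp)
  linarith

theorem qPochInf_neg_pos {q : ℝ} (h0 : 0 < q) (h1 : q < 1) : 0 < qPochInf (-q) q := by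
  refine lt_of_le_of_ne (ge_of_tendsto' (tendsto_qPoch h0 h1 (-q)) fun n =>
    Finset.prod_nonneg fun l _ => ?_) (qPochInf_ne_zero h0 h1 fun l => ?_).symm
  all_goals
    have : 0 < q * q ^ l := by positivity
    linarith

theorem qPoch_self_antitone {q : ℝ} (h0 : 0 < q) (h1 : q < 1) : Antitone (qPoch q q) := by
  refine antitone_nat_of_succ_le fun n => ?_
  rw [qPoch_succ]
  have := qPoch_self_pos h0 h1 n
  have : 0 < q * q ^ n := by positivity
  nlinarith

theorem qPochInf_le_qPoch {q : ℝ} (h0 : 0 < q) (h1 : q < 1) (n : ℕ) :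
    qPochInf q q ≤ qPoch q q n :=
  (qPoch_self_antitone h0 h1).le_of_tendsto (tendsto_qPoch h0 h1 q) n

/-- The values of the weight on the lattice. -/
noncomputable def latticeWeight (q : ℝ) (k : ℕ) : ℝ := weight q (q ^ k)

theorem latticeWeight_zero {q : ℝ} (h0 : 0 < q) (h1 : q < 1) :
    latticeWeight q 0 = 1 / (2 * qPochInf (-q) q) := by
  have e := qPochInf_eq_mul h0 h1 (-1)
  have p1 := (qPochInf_self_pos h0 h1).ne'
  have p2 := (qPochInf_neg_pos h0 h1).ne'
  rw [show (-1 : ℝ) * q = -q by ring] at e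
  simp only [latticeWeight, weight, pow_zero, mul_one, e]
  field_simp
  norm_num

/-- The Pearson relation of the weight. Its factor is 1 - x² at x = q^{k+1}, and 1 - x² vanishes at
the end point x = 1; this is why summation by parts has no boundary term. -/
theorem latticeWeight_succ {q : ℝ} (h0 : 0 < q) (h1 : q < 1) (k : ℕ) :
    latticeWeight q k = (1 - q ^ (2 * (k + 1))) * latticeWeight q (k + 1) := by
  have e1 := qPochInf_eq_mul h0 h1 (q * q ^ k)
  have e2 := qPochInf_eq_mul h0 h1 (-(q * q ^ k))
  simp only [latticeWeight, weight, e1, e2]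
  rw [show q * q ^ (k + 1) = q * q ^ k * q by ring,
    show -(q * q ^ k) * q = -(q * q ^ k * q) by ring]
  ring

theorem latticeWeight_eq {q : ℝ} (h0 : 0 < q) (h1 : q < 1) (k : ℕ) :
    latticeWeight q k = 1 / (2 * qPochInf (-q) q) * (1 / qPoch (q ^ 2) (q ^ 2) k) := by
  have hQ : ∀ k, 0 < qPoch (q ^ 2) (q ^ 2) k :=
    qPoch_self_pos (by positivity) (pow_lt_one₀ h0.le h1 (by simp))
  induction k with
  | zero => rw [latticeWeight_zero h0 h1, qPoch_zero]; simp
  | succ k ih =>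
    rw [latticeWeight_succ h0 h1] at ih
    have p := (hQ (k + 1)).ne'
    have e := qPoch_succ (q ^ 2) (q ^ 2) k
    have e3 : (q ^ 2) * (q ^ 2) ^ k = q ^ (2 * (k + 1)) := by ring
    rw [e3] at e
    rw [e] at p
    have p1 := left_ne_zero_of_mul p
    have p2 := right_ne_zero_of_mul p
    rw [e]
    have p3 := (qPochInf_neg_pos h0 h1).ne'
    field_simp
    field_simp at ih
    linear_combination ih

theorem latticeWeight_pos {q : ℝ} (h0 : 0 < q) (h1 : q < 1) (k : ℕ) : 0 < latticeWeight q k := by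
  rw [latticeWeight_eq h0 h1]
  have := qPochInf_neg_pos h0 h1
  have := qPoch_self_pos (q := q ^ 2) (by positivity) (pow_lt_one₀ h0.le h1 (by simp)) k
  positivity

theorem latticeWeight_le {q : ℝ} (h0 : 0 < q) (h1 : q < 1) (k : ℕ) :
    latticeWeight q k ≤ 1 / (2 * qPochInf (-q) q) * (1 / qPochInf (q ^ 2) (q ^ 2)) := by
  have hq1 : q ^ 2 < 1 := pow_lt_one₀ h0.le h1 (by simp)
  rw [latticeWeight_eq h0 h1]
  have := qPochInf_neg_pos h0 h1
  have := qPochInf_self_pos (q := q ^ 2) (by positivity) hq1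
  have := qPochInf_le_qPoch (q := q ^ 2) (by positivity) hq1 k
  gcongr

/-- The product (-q;q)_m (q;q)_m = (q²;q²)_m supplies the even factors of (q;q)_{2m}, and (q;q²)_m
the odd ones. -/
theorem prod_odd_mul_prod (q : ℝ) (m : ℕ) :
    qPoch q (q ^ 2) m * qPoch (-q) q m * qPoch q q m = qPoch q q (2 * m) := by
  induction m with
  | zero => simp [qPoch_zero]
  | succ m ih =>
    rw [show 2 * (m + 1) = 2 * m + 1 + 1 by ring, qPoch_succ q q (2 * m + 1),
      qPoch_succ q q (2 * m), ← ih]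
    simp only [qPoch_succ]
    ring

/-- The Euler sum `∑ z ^ k / (q²; q²)_k`. -/
noncomputable def eulerSum (q z : ℝ) : ℝ := ∑' k : ℕ, z ^ k / qPoch (q ^ 2) (q ^ 2) k

theorem summable_eulerSum {q : ℝ} (h0 : 0 < q) (h1 : q < 1) {z : ℝ} (hz0 : 0 ≤ z) (hz : z ≤ q) :
    Summable fun k : ℕ => z ^ k / qPoch (q ^ 2) (q ^ 2) k := by
  have hq1 : q ^ 2 < 1 := pow_lt_one₀ h0.le h1 (by simp)
  have p0 := qPochInf_self_pos (q := q ^ 2) (by positivity) hq1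
  refine Summable.of_nonneg_of_le (fun k => ?_) (fun k => ?_)
    ((summable_geometric_of_lt_one h0.le h1).mul_left (1 / qPochInf (q ^ 2) (q ^ 2)))
  · have := qPoch_self_pos (q := q ^ 2) (by positivity) hq1 k
    positivity
  · have := qPochInf_le_qPoch (q := q ^ 2) (by positivity) hq1 k
    rw [one_div_mul_eq_div]
    gcongr

/-- In the difference of the two sums the factor 1 - q^{2k} cancels the last factor of (q²;q²)_k,
which shifts the index by one. -/
theorem eulerSum_sub {q : ℝ} (h0 : 0 < q) (h1 : q < 1) {z : ℝ} (hz0 : 0 ≤ z) (hz : z ≤ q) :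
    eulerSum q (q ^ 2 * z) = (1 - z) * eulerSum q z := by
  have hq1 : q ^ 2 < 1 := pow_lt_one₀ h0.le h1 (by simp)
  have s1 := summable_eulerSum h0 h1 hz0 hz
  have s2 := summable_eulerSum h0 h1 (z := q ^ 2 * z) (by positivity)
    ((mul_le_of_le_one_left hz0 hq1.le).trans hz)
  have : eulerSum q z - eulerSum q (q ^ 2 * z) = z * eulerSum q z := by
    unfold eulerSum
    rw [← s1.tsum_sub s2, (s1.sub s2).tsum_eq_zero_add, ← tsum_mul_left]
    simp only [pow_zero, sub_self, zero_add]
    congr 1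
    ext k
    have p := (qPoch_self_pos (q := q ^ 2) (by positivity) hq1 (k + 1)).ne'
    rw [qPoch_succ] at p ⊢
    have p1 := left_ne_zero_of_mul p
    have p2 := right_ne_zero_of_mul p
    rw [mul_pow]
    field_simp
    ring
  linarith

theorem eulerSum_mul_qPoch {q : ℝ} (h0 : 0 < q) (h1 : q < 1) (m : ℕ) :
    eulerSum q q * qPoch q (q ^ 2) m = eulerSum q (q * (q ^ 2) ^ m) := by
  induction m with
  | zero => simp [qPoch_zero]
  | succ m ih =>
    have hle : q * (q ^ 2) ^ m ≤ q :=
      mul_le_of_le_one_right h0.le (pow_le_one₀ (by positivity) (pow_le_one₀ h0.le h1.le))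
    rw [qPoch_succ, ← mul_assoc, ih, mul_comm, ← eulerSum_sub h0 h1 (by positivity) hle]
    congr 1; ring

/-- Continuity of the sum at z = 0: for 0 ≤ z ≤ q the part without the constant term is at most z/q
times its value at q. -/
theorem tendsto_eulerSum {q : ℝ} (h0 : 0 < q) (h1 : q < 1) :
    Tendsto (fun m : ℕ => eulerSum q (q * (q ^ 2) ^ m)) atTop (𝓝 1) := by
  have hq1 : q ^ 2 < 1 := pow_lt_one₀ h0.le h1 (by simp)
  have key : ∀ z, 0 ≤ z → z ≤ q → 1 ≤ eulerSum q z ∧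
      eulerSum q z ≤ 1 + z / q * (eulerSum q q - 1) := by
    intro z hz0 hz
    have s1 := summable_eulerSum h0 h1 hz0 hz
    have s2 := summable_eulerSum h0 h1 h0.le le_rfl
    have pos : ∀ k, 0 < qPoch (q ^ 2) (q ^ 2) k := qPoch_self_pos (by positivity) hq1
    have e1 : eulerSum q z = 1 + ∑' k : ℕ, z ^ (k + 1) / qPoch (q ^ 2) (q ^ 2) (k + 1) := by
      rw [eulerSum, s1.tsum_eq_zero_add]; simp [qPoch_zero]
    have e2 : eulerSum q q = 1 + ∑' k : ℕ, q ^ (k + 1) / qPoch (q ^ 2) (q ^ 2) (k + 1) := by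
      rw [eulerSum, s2.tsum_eq_zero_add]; simp [qPoch_zero]
    have s1' := (summable_nat_add_iff 1).2 s1
    have s2' := (summable_nat_add_iff 1).2 s2
    constructor
    · rw [e1]
      have : 0 ≤ ∑' k : ℕ, z ^ (k + 1) / qPoch (q ^ 2) (q ^ 2) (k + 1) :=
        tsum_nonneg fun k => by have := pos (k + 1); positivity
      linarith
    · rw [e1, e2, add_sub_cancel_left, ← tsum_mul_left]
      refine add_le_add_right (s1'.tsum_le_tsum (fun k => ?_) (s2'.mul_left _)) _
      have := pos (k + 1)
      rw [mul_div_assoc', show z / q * q ^ (k + 1) = z * q ^ k by rw [pow_succ']; field_simp, pow_succ']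
      gcongr
  have hle : ∀ m : ℕ, q * (q ^ 2) ^ m ≤ q := fun m =>
    mul_le_of_le_one_right h0.le (pow_le_one₀ (by positivity) (pow_le_one₀ h0.le h1.le))
  have t : Tendsto (fun m : ℕ => 1 + q * (q ^ 2) ^ m / q * (eulerSum q q - 1)) atTop (𝓝 1) := by
    have t1 := tendsto_pow_atTop_nhds_zero_of_lt_one (r := q ^ 2) (by positivity) hq1
    have t2 := (((t1.const_mul q).div_const q).mul_const (eulerSum q q - 1)).const_add 1
    simpa using t2
  exact tendsto_of_tendsto_of_tendsto_of_le_of_le tendsto_const_nhds t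
    (fun m => (key _ (by positivity) (hle m)).1) (fun m => (key _ (by positivity) (hle m)).2)

/-- Euler's identity 1/(q;q²)_∞ = (-q;q)_∞. The iterated functional equation is multiplied by
(-q;q)_m (q;q)_m, which turns one side into a multiple of (q;q)_{2m}, and then m → ∞. -/
theorem eulerSum_self {q : ℝ} (h0 : 0 < q) (h1 : q < 1) : eulerSum q q = qPochInf (-q) q := by
  have p := (qPochInf_self_pos h0 h1).ne'
  have t1 := ((tendsto_eulerSum h0 h1).mul (tendsto_qPoch h0 h1 (-q))).mul (tendsto_qPoch h0 h1 q)
  have t2 : Tendsto (fun m : ℕ => qPoch q q (2 * m)) atTop (𝓝 (qPochInf q q)) :=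
    (tendsto_qPoch h0 h1 q).comp (tendsto_id.const_mul_atTop' (by norm_num))
  have t3 := t2.const_mul (eulerSum q q)
  have := tendsto_nhds_unique t1 (t3.congr fun m => by
    rw [← eulerSum_mul_qPoch h0 h1, ← prod_odd_mul_prod q m]; ring)
  rw [one_mul] at this
  exact (mul_right_cancel₀ p this).symm

/-- Half of the unit mass of the weight, without the factor 1 - q; the other half lies on the
negative lattice points. -/
theorem tsum_latticeWeight {q : ℝ} (h0 : 0 < q) (h1 : q < 1) :
    ∑' k : ℕ, q ^ k * latticeWeight q k = 1 / 2 := by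
  have p := (qPochInf_neg_pos h0 h1).ne'
  have : ∀ k : ℕ, q ^ k * latticeWeight q k =
      1 / (2 * qPochInf (-q) q) * (q ^ k / qPoch (q ^ 2) (q ^ 2) k) := by
    intro k; rw [latticeWeight_eq h0 h1]; ring
  simp_rw [this]
  rw [tsum_mul_left]
  change _ * eulerSum q q = _
  rw [eulerSum_self h0 h1]
  field_simp

end DiscreteQGUE

/-! ### Moments of the squared polynomials: norms, second moment, three-term recurrence. -/

namespace DiscreteQGUE

open Filter Topology

/-- Boundedness of a real sequence. -/
def SeqBdd (a : ℕ → ℝ) : Prop := ∃ C, ∀ k, |a k| ≤ C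

theorem SeqBdd.const (c : ℝ) : SeqBdd fun _ => c := ⟨|c|, fun _ => le_rfl⟩

theorem SeqBdd.add {a b : ℕ → ℝ} (ha : SeqBdd a) (hb : SeqBdd b) : SeqBdd fun k => a k + b k := by
  obtain ⟨A, hA⟩ := ha
  obtain ⟨B, hB⟩ := hb
  exact ⟨A + B, fun k => (abs_add_le _ _).trans (add_le_add (hA k) (hB k))⟩

theorem SeqBdd.mul {a b : ℕ → ℝ} (ha : SeqBdd a) (hb : SeqBdd b) : SeqBdd fun k => a k * b k := by
  obtain ⟨A, hA⟩ := ha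
  obtain ⟨B, hB⟩ := hb
  refine ⟨A * B, fun k => ?_⟩
  rw [abs_mul]
  exact mul_le_mul (hA k) (hB k) (abs_nonneg _) ((abs_nonneg _).trans (hA k))

theorem SeqBdd.pow {a : ℕ → ℝ} (ha : SeqBdd a) (n : ℕ) : SeqBdd fun k => a k ^ n := by
  induction n with
  | zero => simpa using SeqBdd.const 1
  | succ n ih => simpa [pow_succ] using ih.mul ha

theorem SeqBdd.sub {a b : ℕ → ℝ} (ha : SeqBdd a) (hb : SeqBdd b) : SeqBdd fun k => a k - b k := by
  simpa [sub_eq_add_neg] using ha.add ((SeqBdd.const (-1)).mul hb)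

theorem SeqBdd.geom {q : ℝ} (h0 : 0 < q) (h1 : q < 1) : SeqBdd fun k => q ^ k :=
  ⟨1, fun k => by rw [abs_of_pos (by positivity)]; exact pow_le_one₀ h0.le h1.le⟩

theorem SeqBdd.qHermite {q : ℝ} (n : ℕ) {x : ℕ → ℝ} (hx : SeqBdd x) :
    SeqBdd fun k => qHermite n (x k) q := by
  unfold DiscreteQGUE.qHermite
  induction Finset.range (n / 2 + 1) using Finset.induction_on with
  | empty => simpa using SeqBdd.const 0
  | insert i s hi ih =>
    simp_rw [Finset.sum_insert hi]
    exact ((SeqBdd.const _).mul (hx.pow _)).add ih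

/-- Half the Jackson integral against the weight, on the positive half of the lattice. -/
noncomputable def latticeSum (q : ℝ) (a : ℕ → ℝ) : ℝ := ∑' k : ℕ, q ^ k * latticeWeight q k * a k

section
variable {q : ℝ} (h0 : 0 < q) (h1 : q < 1)
include h0 h1

theorem summable_lattice {a : ℕ → ℝ} (ha : SeqBdd a) :
    Summable fun k : ℕ => q ^ k * latticeWeight q k * a k := by
  obtain ⟨C, hC⟩ := ha
  refine Summable.of_norm_bounded (((summable_geometric_of_lt_one h0.le h1).mul_right
    (1 / (2 * qPochInf (-q) q) * (1 / qPochInf (q ^ 2) (q ^ 2)))).mul_right C) fun k => ?_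
  have hw := latticeWeight_pos h0 h1 k
  rw [Real.norm_eq_abs, abs_mul, abs_of_pos (by positivity)]
  have := latticeWeight_le h0 h1 k
  have := hC k
  have : 0 ≤ 1 / (2 * qPochInf (-q) q) * (1 / qPochInf (q ^ 2) (q ^ 2)) := hw.le.trans ‹_›
  gcongr

theorem latticeSum_add {a b : ℕ → ℝ} (ha : SeqBdd a) (hb : SeqBdd b) :
    latticeSum q (fun k => a k + b k) = latticeSum q a + latticeSum q b := by
  unfold latticeSum
  rw [← (summable_lattice h0 h1 ha).tsum_add (summable_lattice h0 h1 hb)]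
  simp_rw [mul_add]

omit h0 h1 in
theorem latticeSum_mul (c : ℝ) (a : ℕ → ℝ) :
    latticeSum q (fun k => c * a k) = c * latticeSum q a := by
  unfold latticeSum
  rw [← tsum_mul_left]
  congr 1; ext k; ring

theorem latticeSum_sub {a b : ℕ → ℝ} (ha : SeqBdd a) (hb : SeqBdd b) :
    latticeSum q (fun k => a k - b k) = latticeSum q a - latticeSum q b := by
  have := latticeSum_add h0 h1 ha ((SeqBdd.const (-1)).mul hb)
  rw [latticeSum_mul] at this
  simpa [sub_eq_add_neg] using this

/-- Summation by parts: the term k = 0 vanishes because x = 1 there, and the Pearson relation moves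
all other terms back by one lattice point. -/
theorem latticeSum_shift {c : ℕ → ℝ} (hc : SeqBdd c) :
    latticeSum q (fun k => (1 - (q ^ k) ^ 2) * c k) = q * latticeSum q (fun k => c (k + 1)) := by
  have hb : SeqBdd fun k => (1 - (q ^ k) ^ 2) * c k :=
    ((SeqBdd.const 1).sub ((SeqBdd.geom h0 h1).pow 2)).mul hc
  unfold latticeSum
  rw [(summable_lattice h0 h1 hb).tsum_eq_zero_add, ← tsum_mul_left]
  simp only [pow_zero, one_pow, sub_self, zero_mul, mul_zero, zero_add]
  congr 1; ext k
  rw [latticeWeight_succ h0 h1 k]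
  ring

end

/-- One of two consecutive polynomials is odd, hence divisible by x. -/
theorem qHermite_mul_succ_bdd {q : ℝ} (h0 : 0 < q) (h1 : q < 1) (n : ℕ) :
    SeqBdd fun k => qHermite n (q ^ k) q * qHermite (n + 1) (q ^ k) q / q ^ k := by
  have key : ∀ m : ℕ, SeqBdd fun k => qHermite (2 * m + 1) (q ^ k) q / q ^ k := by
    intro m
    unfold DiscreteQGUE.qHermite
    simp_rw [Finset.sum_div]
    have : ∀ i ∈ Finset.range ((2 * m + 1) / 2 + 1), 2 * i + 1 ≤ 2 * m + 1 := fun i hi => by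
      have := Finset.mem_range.1 hi; omega
    revert this
    induction Finset.range ((2 * m + 1) / 2 + 1) using Finset.induction_on with
    | empty => intro _; simpa using SeqBdd.const 0
    | insert i s hi ih =>
      intro hs
      simp_rw [Finset.sum_insert hi]
      refine SeqBdd.add ?_ (ih fun i hi => hs i (Finset.mem_insert_of_mem hi))
      have h := hs i (Finset.mem_insert_self i s)
      have e : 2 * m + 1 - 2 * i = (2 * m - 2 * i) + 1 := by omega
      have : ∀ k : ℕ, ∀ c : ℝ, c * (q ^ k) ^ (2 * m + 1 - 2 * i) / q ^ k =
          c * (q ^ k) ^ (2 * m - 2 * i) := fun k c => by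
        have : q ^ k ≠ 0 := by positivity
        rw [e, pow_succ]; field_simp
      simp_rw [this]
      exact (SeqBdd.const _).mul ((SeqBdd.geom h0 h1).pow _)
  rcases Nat.even_or_odd' n with ⟨m, rfl | rfl⟩
  · have := (SeqBdd.qHermite (q := q) (2 * m) (SeqBdd.geom h0 h1)).mul (key m)
    simpa only [mul_div_assoc] using this
  · have := (key m).mul (SeqBdd.qHermite (q := q) (2 * m + 1 + 1) (SeqBdd.geom h0 h1))
    simpa only [div_mul_eq_mul_div] using this

/-- The unnormalised moments of the squares of the discrete `q`-Hermite polynomials. -/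
noncomputable def hermiteMoment (q : ℝ) (j m : ℕ) : ℝ :=
  latticeSum q fun k => (q ^ k) ^ m * qHermite j (q ^ k) q ^ 2

section
variable {q : ℝ} (h0 : 0 < q) (h1 : q < 1)
include h0 h1

theorem hermiteMoment_zero_zero : hermiteMoment q 0 0 = 1 / 2 := by
  simp [hermiteMoment, latticeSum, qHermite_zero, tsum_latticeWeight h0 h1]

/-- Summation by parts for c = H_{j+1}(x) H_j(x/q)/x. The raising relation evaluates (1 - x²) c and
the lowering relation evaluates c at qx; both contain the sum of H_j H_{j+1}/x, which cancels. -/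
theorem hermiteMoment_norm_succ (j : ℕ) :
    hermiteMoment q (j + 1) 0 = q ^ j * (1 - q ^ (j + 1)) * hermiteMoment q j 0 := by
  have hx := SeqBdd.geom h0 h1
  have by0 := SeqBdd.qHermite (q := q) j hx
  have by1 := SeqBdd.qHermite (q := q) (j + 1) hx
  have bd := qHermite_mul_succ_bdd h0 h1 j
  have qk : ∀ k : ℕ, q ^ k ≠ 0 := fun k => by positivity
  have low : ∀ k, qHermite (j + 1) (q ^ (k + 1)) q = qHermite (j + 1) (q ^ k) q -
      (1 - q ^ (j + 1)) * q ^ k * qHermite j (q ^ k) q := fun k => by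
    have := qHermite_lowering h0 h1 j (q ^ k)
    rw [pow_succ' q k]; linarith
  have rai : ∀ k, q ^ j * (qHermite j (q ^ k) q - (1 - (q ^ k) ^ 2) * qHermite j (q ^ k / q) q) =
      q ^ k * qHermite (j + 1) (q ^ k) q := fun k => by
    have := qHermite_raising h0 h1 j (q ^ k / q)
    rwa [mul_div_cancel₀ _ h0.ne'] at this
  set c : ℕ → ℝ := fun k => qHermite (j + 1) (q ^ k) q * qHermite j (q ^ k / q) q / q ^ k with hc
  have c1 : ∀ k, c (k + 1) = 1 / q * (qHermite j (q ^ k) q * qHermite (j + 1) (q ^ k) q / q ^ k -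
      (1 - q ^ (j + 1)) * ((q ^ k) ^ 0 * qHermite j (q ^ k) q ^ 2)) := fun k => by
    have := qk k
    have e : q ^ (k + 1) / q = q ^ k := by rw [pow_succ]; field_simp
    simp only [hc]
    rw [low, e, pow_succ q k]; field_simp
  have c2 : ∀ k, (1 - (q ^ k) ^ 2) * c k = qHermite j (q ^ k) q * qHermite (j + 1) (q ^ k) q / q ^ k
      - (1 / q ^ j) * ((q ^ k) ^ 0 * qHermite (j + 1) (q ^ k) q ^ 2) := fun k => by
    have := qk k
    have := qk j
    simp only [hc]
    have r := rai k
    field_simp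
    linear_combination (- qHermite (j + 1) (q ^ k) q) * r
  have bsq : ∀ i, SeqBdd fun k => (q ^ k) ^ 0 * qHermite i (q ^ k) q ^ 2 := fun i =>
    (hx.pow 0).mul ((SeqBdd.qHermite (q := q) i hx).pow 2)
  -- The bound is visible only for the shifted sequence; c 0 involves the point 1/q off the lattice
  -- and is one extra value.
  have bc : SeqBdd c := by
    have b1 : SeqBdd fun k => c (k + 1) := by
      simp_rw [c1]
      exact (SeqBdd.const _).mul (bd.sub ((SeqBdd.const _).mul (bsq j)))
    obtain ⟨C, hC⟩ := b1
    refine ⟨max C |c 0|, fun k => ?_⟩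
    rcases k with _ | k
    · exact le_max_right _ _
    · exact (hC k).trans (le_max_left _ _)
  have s := latticeSum_shift h0 h1 bc
  simp_rw [c1, c2] at s
  rw [latticeSum_sub h0 h1 bd ((SeqBdd.const _).mul (bsq (j + 1))), latticeSum_mul,
    latticeSum_mul, latticeSum_sub h0 h1 bd ((SeqBdd.const _).mul (bsq j)), latticeSum_mul] at s
  have := qk j
  simp only [hermiteMoment, pow_zero, one_mul] at s ⊢
  field_simp at s
  linear_combination -s

theorem hermiteMoment_norm (j : ℕ) :
    hermiteMoment q j 0 = 1 / 2 * (qPoch q q j * q ^ (j * (j - 1) / 2)) := by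
  induction j with
  | zero => rw [hermiteMoment_zero_zero h0 h1]; simp [qPoch_zero]
  | succ j ih =>
    rw [hermiteMoment_norm_succ h0 h1, ih, qPoch_succ]
    have : (j + 1) * (j + 1 - 1) / 2 = j * (j - 1) / 2 + j := by
      have := Finset.sum_range_id j
      have h2 := Finset.sum_range_id (j + 1)
      rw [← this, ← h2, Finset.sum_range_succ]
    rw [this, pow_add]; ring

theorem hermiteMoment_norm_pos (j : ℕ) : 0 < hermiteMoment q j 0 := by
  rw [hermiteMoment_norm h0 h1]
  have := qPoch_self_pos h0 h1 j
  positivity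

theorem hermiteMoment_bdd (j m : ℕ) : SeqBdd fun k => (q ^ k) ^ m * qHermite j (q ^ k) q ^ 2 :=
  ((SeqBdd.geom h0 h1).pow m).mul ((SeqBdd.qHermite (q := q) j (SeqBdd.geom h0 h1)).pow 2)

/-- The q-difference equation is multiplied by x^m H_j(x) and summed. Summation by parts turns (1 -
x²) H_j(x) H_j(x/q) back into H_j(x) H_j(qx), so the sum of these products is determined by the
moments. -/
theorem latticeSum_mul_succ (j m : ℕ) :
    q ^ j * (1 + q ^ 2 * q ^ m) * latticeSum q (fun k => (q ^ k) ^ m *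
      (qHermite j (q ^ k) q * qHermite j (q ^ (k + 1)) q)) =
    q ^ j * (1 + q) * hermiteMoment q j m - q * hermiteMoment q j (m + 2) := by
  have hx := SeqBdd.geom h0 h1
  have hx1 : SeqBdd fun k => q ^ k / q := by simpa [div_eq_mul_inv] using hx.mul (SeqBdd.const q⁻¹)
  have hx2 : SeqBdd fun k => q ^ (k + 1) := by simpa [pow_succ] using hx.mul (SeqBdd.const q)
  have by0 := SeqBdd.qHermite (q := q) j hx
  have bc : SeqBdd fun k => (q ^ k) ^ m * (qHermite j (q ^ k) q * qHermite j (q ^ k / q) q) :=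
    (hx.pow m).mul (by0.mul (SeqBdd.qHermite j hx1))
  have bc' : SeqBdd fun k => (1 - (q ^ k) ^ 2) * ((q ^ k) ^ m *
      (qHermite j (q ^ k) q * qHermite j (q ^ k / q) q)) :=
    ((SeqBdd.const 1).sub (hx.pow 2)).mul bc
  have s := latticeSum_shift h0 h1 bc
  have e : ∀ k : ℕ, (q ^ (k + 1)) ^ m * (qHermite j (q ^ (k + 1)) q * qHermite j (q ^ (k + 1) / q) q)
      = q ^ m * ((q ^ k) ^ m * (qHermite j (q ^ k) q * qHermite j (q ^ (k + 1)) q)) := fun k => by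
    rw [show q ^ (k + 1) / q = q ^ k by rw [pow_succ]; field_simp, pow_succ q k, mul_pow]; ring
  simp_rw [e] at s
  rw [latticeSum_mul] at s
  have d : ∀ k : ℕ, q ^ j * ((q ^ k) ^ m * (qHermite j (q ^ k) q * qHermite j (q ^ (k + 1)) q)) =
      q ^ j * (1 + q) * ((q ^ k) ^ m * qHermite j (q ^ k) q ^ 2) -
      q * ((q ^ k) ^ (m + 2) * qHermite j (q ^ k) q ^ 2) - q ^ j * q * ((1 - (q ^ k) ^ 2) *
        ((q ^ k) ^ m * (qHermite j (q ^ k) q * qHermite j (q ^ k / q) q))) := fun k => by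
    have := qHermite_qDiff h0 h1 j (q ^ k / q)
    rw [mul_div_cancel₀ _ h0.ne', ← pow_succ'] at this
    linear_combination ((q ^ k) ^ m * qHermite j (q ^ k) q) * this
  have t := latticeSum_mul (q := q) (q ^ j) (fun k => (q ^ k) ^ m *
    (qHermite j (q ^ k) q * qHermite j (q ^ (k + 1)) q))
  simp_rw [d] at t
  have b1 := hermiteMoment_bdd h0 h1 j m
  have b2 := hermiteMoment_bdd h0 h1 j (m + 2)
  rw [latticeSum_sub h0 h1 (((SeqBdd.const _).mul b1).sub ((SeqBdd.const _).mul b2))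
    ((SeqBdd.const _).mul bc'), latticeSum_sub h0 h1 ((SeqBdd.const _).mul b1)
    ((SeqBdd.const _).mul b2), latticeSum_mul, latticeSum_mul, latticeSum_mul, s] at t
  unfold hermiteMoment
  linear_combination -t

theorem latticeSum_succ_sq (j m : ℕ) :
    q * q ^ m * latticeSum q (fun k => (q ^ k) ^ m * qHermite j (q ^ (k + 1)) q ^ 2) =
    hermiteMoment q j m - hermiteMoment q j (m + 2) := by
  have b := hermiteMoment_bdd h0 h1 j m
  have b2 := hermiteMoment_bdd h0 h1 j (m + 2)
  have s := latticeSum_shift h0 h1 b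
  have e : ∀ k : ℕ, (q ^ (k + 1)) ^ m * qHermite j (q ^ (k + 1)) q ^ 2 =
      q ^ m * ((q ^ k) ^ m * qHermite j (q ^ (k + 1)) q ^ 2) := fun k => by
    rw [pow_succ q k, mul_pow]; ring
  have e2 : ∀ k : ℕ, (1 - (q ^ k) ^ 2) * ((q ^ k) ^ m * qHermite j (q ^ k) q ^ 2) =
      (q ^ k) ^ m * qHermite j (q ^ k) q ^ 2 - (q ^ k) ^ (m + 2) * qHermite j (q ^ k) q ^ 2 :=
    fun k => by ring
  simp_rw [e, e2] at s
  rw [latticeSum_sub h0 h1 b b2, latticeSum_mul] at s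
  unfold hermiteMoment
  linear_combination -s

/-- The square of the q-difference equation, solved for (1 - x²) H_j(x/q). One factor 1 - x² is
consumed by the shift, and the other becomes 1 - q²x². -/
theorem hermiteMoment_square_relation (j m : ℕ) :
    (q ^ j) ^ 2 * latticeSum q (fun k => (q ^ k) ^ m * qHermite j (q ^ (k + 1)) q ^ 2) -
      2 * q ^ j * (q ^ j * (1 + q) * latticeSum q (fun k => (q ^ k) ^ m *
        (qHermite j (q ^ k) q * qHermite j (q ^ (k + 1)) q)) -
        q * latticeSum q (fun k => (q ^ k) ^ (m + 2) *
        (qHermite j (q ^ k) q * qHermite j (q ^ (k + 1)) q))) +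
      ((q ^ j) ^ 2 * (1 + q) ^ 2 * hermiteMoment q j m -
        2 * q ^ j * (1 + q) * q * hermiteMoment q j (m + 2) + q ^ 2 * hermiteMoment q j (m + 4)) =
    (q ^ j) ^ 2 * q ^ 3 * q ^ m * (hermiteMoment q j m - q ^ 2 * hermiteMoment q j (m + 2)) := by
  have hx := SeqBdd.geom h0 h1
  have hx1 : SeqBdd fun k => q ^ k / q := by simpa [div_eq_mul_inv] using hx.mul (SeqBdd.const q⁻¹)
  have hx2 : SeqBdd fun k => q ^ (k + 1) := by simpa [pow_succ] using hx.mul (SeqBdd.const q)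
  have by0 := SeqBdd.qHermite (q := q) j hx
  have by2 := SeqBdd.qHermite (q := q) j hx2
  have bY : SeqBdd fun k => (q ^ k) ^ m * qHermite j (q ^ (k + 1)) q ^ 2 :=
    (hx.pow m).mul (by2.pow 2)
  have bU : ∀ m, SeqBdd fun k => (q ^ k) ^ m * (qHermite j (q ^ k) q * qHermite j (q ^ (k + 1)) q) :=
    fun m => (hx.pow m).mul (by0.mul by2)
  have bp := hermiteMoment_bdd h0 h1 j
  have bc : SeqBdd fun k => (1 - (q ^ k) ^ 2) * ((q ^ k) ^ m * qHermite j (q ^ k / q) q ^ 2) :=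
    ((SeqBdd.const 1).sub (hx.pow 2)).mul ((hx.pow m).mul ((SeqBdd.qHermite j hx1).pow 2))
  have s := latticeSum_shift h0 h1 bc
  have e : ∀ k : ℕ, (1 - (q ^ (k + 1)) ^ 2) * ((q ^ (k + 1)) ^ m * qHermite j (q ^ (k + 1) / q) q ^ 2)
      = q ^ m * ((q ^ k) ^ m * qHermite j (q ^ k) q ^ 2 -
        q ^ 2 * ((q ^ k) ^ (m + 2) * qHermite j (q ^ k) q ^ 2)) := fun k => by
    rw [show q ^ (k + 1) / q = q ^ k by rw [pow_succ]; field_simp, pow_succ q k, mul_pow]; ring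
  have d : ∀ k : ℕ, (q ^ j * q) ^ 2 * ((1 - (q ^ k) ^ 2) * ((1 - (q ^ k) ^ 2) *
      ((q ^ k) ^ m * qHermite j (q ^ k / q) q ^ 2))) =
      (q ^ j) ^ 2 * ((q ^ k) ^ m * qHermite j (q ^ (k + 1)) q ^ 2) -
      2 * q ^ j * (q ^ j * (1 + q) * ((q ^ k) ^ m *
        (qHermite j (q ^ k) q * qHermite j (q ^ (k + 1)) q)) -
        q * ((q ^ k) ^ (m + 2) * (qHermite j (q ^ k) q * qHermite j (q ^ (k + 1)) q))) +
      ((q ^ j) ^ 2 * (1 + q) ^ 2 * ((q ^ k) ^ m * qHermite j (q ^ k) q ^ 2) -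
        2 * q ^ j * (1 + q) * q * ((q ^ k) ^ (m + 2) * qHermite j (q ^ k) q ^ 2) +
        q ^ 2 * ((q ^ k) ^ (m + 4) * qHermite j (q ^ k) q ^ 2)) := fun k => by
    have := qHermite_qDiff h0 h1 j (q ^ k / q)
    rw [mul_div_cancel₀ _ h0.ne', ← pow_succ'] at this
    have h : q ^ j * q * (1 - (q ^ k) ^ 2) * qHermite j (q ^ k / q) q =
      (q ^ j * (1 + q) - q * (q ^ k) ^ 2) * qHermite j (q ^ k) q -
        q ^ j * qHermite j (q ^ (k + 1)) q := by linear_combination this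
    calc _ = (q ^ k) ^ m * (q ^ j * q * (1 - (q ^ k) ^ 2) * qHermite j (q ^ k / q) q) ^ 2 := by ring
      _ = _ := by rw [h]; ring
  have t := latticeSum_mul (q := q) ((q ^ j * q) ^ 2) (fun k => (1 - (q ^ k) ^ 2) *
    ((1 - (q ^ k) ^ 2) * ((q ^ k) ^ m * qHermite j (q ^ k / q) q ^ 2)))
  simp_rw [d] at t
  have C := SeqBdd.const
  rw [s] at t
  simp_rw [e] at t
  rw [latticeSum_add h0 h1 (((C _).mul bY).sub ((C _).mul (((C _).mul (bU m)).sub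
      ((C _).mul (bU (m + 2)))))) ((((C _).mul (bp m)).sub ((C _).mul (bp (m + 2)))).add
      ((C _).mul (bp (m + 4)))),
    latticeSum_sub h0 h1 ((C _).mul bY) ((C _).mul (((C _).mul (bU m)).sub
      ((C _).mul (bU (m + 2))))),
    latticeSum_add h0 h1 (((C _).mul (bp m)).sub ((C _).mul (bp (m + 2)))) ((C _).mul (bp (m + 4))),
    latticeSum_sub h0 h1 ((C _).mul (bp m)) ((C _).mul (bp (m + 2)))] at t
  simp only [latticeSum_mul] at t
  rw [latticeSum_sub h0 h1 ((C _).mul (bU m)) ((C _).mul (bU (m + 2))),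
    latticeSum_sub h0 h1 (bp m) ((C _).mul (bp (m + 2)))] at t
  simp only [latticeSum_mul] at t
  unfold hermiteMoment
  linear_combination t

/-- The three term recurrence of the even and odd moments. -/
theorem hermiteMoment_recurrence (j m : ℕ) :
    (q ^ j) ^ 2 * (1 - q * q ^ m) * (1 - q ^ 2 * q ^ m) * (1 - q ^ 3 * q ^ m) * (1 + q ^ 4 * q ^ m)
        * hermiteMoment q j m -
      (1 - q ^ 6 * (q ^ m) ^ 2) * ((q ^ j) ^ 2 * (1 + q ^ 2 * q ^ m) * (1 + q ^ 4 * q ^ m) -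
        2 * q ^ 2 * q ^ j * (1 + q) * q ^ m) * hermiteMoment q j (m + 2) -
      q ^ 3 * q ^ m * (1 - q ^ 4 * q ^ m) * (1 + q ^ 2 * q ^ m) * hermiteMoment q j (m + 4) = 0 := by
  have a := latticeSum_mul_succ h0 h1 j m
  have a' := latticeSum_mul_succ h0 h1 j (m + 2)
  have b := latticeSum_succ_sq h0 h1 j m
  have c := hermiteMoment_square_relation h0 h1 j m
  rw [show m + 2 + 2 = m + 4 by ring] at a'
  generalize latticeSum q (fun k => (q ^ k) ^ m * qHermite j (q ^ (k + 1)) q ^ 2) = Y at *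
  generalize latticeSum q (fun k => (q ^ k) ^ m *
    (qHermite j (q ^ k) q * qHermite j (q ^ (k + 1)) q)) = U at *
  generalize latticeSum q (fun k => (q ^ k) ^ (m + 2) *
    (qHermite j (q ^ k) q * qHermite j (q ^ (k + 1)) q)) = U' at *
  generalize hermiteMoment q j m = p0 at *
  generalize hermiteMoment q j (m + 2) = p2 at *
  generalize hermiteMoment q j (m + 4) = p4 at *
  rw [pow_add q m 2] at a'
  generalize q ^ m = z at *
  generalize q ^ j = J at *
  -- The relations are linear in the sums Y, U, U' of shifted products; these multipliers eliminate
  -- all three and leave the moments of orders m, m + 2, m + 4.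
  linear_combination (q * z * (1 + q ^ 2 * z) * (1 + q ^ 4 * z)) * c +
    2 * (1 + q) * J * (q * z * (1 + q ^ 4 * z)) * a -
    2 * q * (q * z * (1 + q ^ 2 * z)) * a' - J ^ 2 * ((1 + q ^ 2 * z) * (1 + q ^ 4 * z)) * b

/-- The recurrence needs this starting value besides the norm. It comes from squaring q H_{j+1} = q
x H_j - q^j d with d = (H_j(x) - H_j(qx))/x. The norm of H_{j+1} is known, d is a multiple of
H_{j-1} (zero for j = 0), and the cross term x H_j d = H_j (H_j(x) - H_j(qx)) is covered by
`latticeSum_mul_succ`. -/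
theorem hermiteMoment_two (j : ℕ) :
    q * hermiteMoment q j 2 =
      (q ^ j * (1 + q) - (q ^ j) ^ 2 * (1 + q ^ 2)) * hermiteMoment q j 0 := by
  have hx := SeqBdd.geom h0 h1
  have hx2 : SeqBdd fun k => q ^ (k + 1) := by simpa [pow_succ] using hx.mul (SeqBdd.const q)
  have by0 := SeqBdd.qHermite (q := q) j hx
  have by2 := SeqBdd.qHermite (q := q) j hx2
  have qk : ∀ k : ℕ, q ^ k ≠ 0 := fun k => by positivity
  obtain ⟨d, bd, hd, nd⟩ : ∃ d : ℕ → ℝ, SeqBdd d ∧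
      (∀ k, qHermite j (q ^ k) q - qHermite j (q ^ (k + 1)) q = q ^ k * d k) ∧
      latticeSum q (fun k => d k ^ 2) * q ^ j = (1 - q ^ j) * q * hermiteMoment q j 0 := by
    rcases j with _ | j
    · refine ⟨fun _ => 0, SeqBdd.const 0, fun k => by simp [qHermite_zero], ?_⟩
      simp [latticeSum]
    · refine ⟨fun k => (1 - q ^ (j + 1)) * qHermite j (q ^ k) q,
        (SeqBdd.const _).mul (SeqBdd.qHermite j hx), fun k => ?_, ?_⟩
      · have := qHermite_lowering h0 h1 j (q ^ k)
        rw [pow_succ' q k]; linarith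
      · rw [hermiteMoment_norm_succ h0 h1]
        simp_rw [mul_pow]
        rw [latticeSum_mul]
        simp only [hermiteMoment, pow_zero, one_mul]
        ring
  have rai : ∀ k, q * ((q ^ k) ^ 0 * qHermite (j + 1) (q ^ k) q ^ 2 * q) =
      q ^ 2 * ((q ^ k) ^ 2 * qHermite j (q ^ k) q ^ 2) -
      2 * q * q ^ j * ((q ^ k) ^ 0 * qHermite j (q ^ k) q ^ 2 -
        (q ^ k) ^ 0 * (qHermite j (q ^ k) q * qHermite j (q ^ (k + 1)) q)) +
      (q ^ j) ^ 2 * d k ^ 2 := fun k => by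
    have e1 := qHermite_raising h0 h1 j (q ^ k / q)
    have e2 := qHermite_qDiff h0 h1 j (q ^ k / q)
    rw [mul_div_cancel₀ _ h0.ne'] at e1 e2
    rw [← pow_succ'] at e2
    have := hd k
    have e3 : q ^ k * (q * qHermite (j + 1) (q ^ k) q) =
        q ^ k * (q * q ^ k * qHermite j (q ^ k) q - q ^ j * d k) := by
      linear_combination (-q) * e1 - e2 - q ^ j * this
    have e4 := mul_left_cancel₀ (qk k) e3
    have e5 : qHermite j (q ^ (k + 1)) q = qHermite j (q ^ k) q - q ^ k * d k := by linarith
    calc _ = (q * qHermite (j + 1) (q ^ k) q) ^ 2 := by ring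
      _ = _ := by rw [e4, e5]; ring
  have C := SeqBdd.const
  have b0 := hermiteMoment_bdd h0 h1 j 0
  have b2 := hermiteMoment_bdd h0 h1 j 2
  have bU : SeqBdd fun k => (q ^ k) ^ 0 * (qHermite j (q ^ k) q * qHermite j (q ^ (k + 1)) q) :=
    (hx.pow 0).mul (by0.mul by2)
  have t : q * q * hermiteMoment q (j + 1) 0 = q ^ 2 * hermiteMoment q j 2 -
      2 * q * q ^ j * (hermiteMoment q j 0 - latticeSum q (fun k => (q ^ k) ^ 0 *
        (qHermite j (q ^ k) q * qHermite j (q ^ (k + 1)) q))) +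
        (q ^ j) ^ 2 * latticeSum q (fun k => d k ^ 2) := by
    unfold hermiteMoment
    rw [← latticeSum_mul, ← latticeSum_sub h0 h1 b0 bU, ← latticeSum_mul, ← latticeSum_mul,
      ← latticeSum_mul, ← latticeSum_sub h0 h1 ((C _).mul b2) ((C _).mul (b0.sub bU)),
      ← latticeSum_add h0 h1 (((C _).mul b2).sub ((C _).mul (b0.sub bU))) ((C _).mul (bd.pow 2))]
    congr 1; ext k
    rw [← rai k]; ring
  have a := latticeSum_mul_succ h0 h1 j 0
  rw [hermiteMoment_norm_succ h0 h1, pow_succ] at t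
  rw [pow_zero, mul_one, zero_add] at a
  generalize latticeSum q (fun k => (q ^ k) ^ 0 *
    (qHermite j (q ^ k) q * qHermite j (q ^ (k + 1)) q)) = U at *
  generalize latticeSum q (fun k => d k ^ 2) = D at *
  generalize hermiteMoment q j 0 = p0 at *
  generalize hermiteMoment q j 2 = p2 at *
  generalize q ^ j = J at *
  have h2 : (1 - q ^ 2) ≠ 0 := by
    have := pow_lt_one₀ h0.le h1 two_ne_zero; linarith
  have h3 : q * (1 - q ^ 2) ≠ 0 := mul_ne_zero h0.ne' h2
  -- Eliminating the cross sum produces the claim multiplied by q(1 - q²).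
  refine mul_left_cancel₀ h3 ?_
  linear_combination (1 + q ^ 2) * t + 2 * q * a + (1 + q ^ 2) * J * nd

end

end DiscreteQGUE

/-! ### Operators on polynomials that are bounded in finitely many derivatives. -/

namespace DiscreteQGUE

open Polynomial

/-- The first `k` derivatives of `F` are bounded by `C` on `S`. -/
def PolyBound (S : Set ℝ) (k : ℕ) (C : ℝ) (F : ℝ[X]) : Prop :=
  ∀ i ≤ k, ∀ s ∈ S, |(derivative^[i] F).eval s| ≤ C

theorem PolyBound.mono {S : Set ℝ} {k l : ℕ} {C D : ℝ} {F : ℝ[X]} (h : PolyBound S l C F)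
    (hk : k ≤ l) (hC : C ≤ D) : PolyBound S k D F :=
  fun i hi s hs => (h i (hi.trans hk) s hs).trans hC

theorem PolyBound.subset {S T : Set ℝ} {k : ℕ} {C : ℝ} {F : ℝ[X]} (h : PolyBound S k C F)
    (hT : T ⊆ S) : PolyBound T k C F :=
  fun i hi s hs => h i hi s (hT hs)

theorem PolyBound.eval {S : Set ℝ} {k : ℕ} {C : ℝ} {F : ℝ[X]} (h : PolyBound S k C F) {s : ℝ}
    (hs : s ∈ S) : |F.eval s| ≤ C := h 0 (Nat.zero_le _) s hs

theorem PolyBound.add {S : Set ℝ} {k : ℕ} {C D : ℝ} {F G : ℝ[X]} (hF : PolyBound S k C F)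
    (hG : PolyBound S k D G) : PolyBound S k (C + D) (F + G) := by
  intro i hi s hs
  rw [iterate_map_add, eval_add]
  exact (abs_add_le _ _).trans (add_le_add (hF i hi s hs) (hG i hi s hs))

theorem PolyBound.smul {S : Set ℝ} {k : ℕ} {C c B : ℝ} {F : ℝ[X]} (hF : PolyBound S k C F)
    (hc : |c| ≤ B) : PolyBound S k (B * C) (c • F) := by
  intro i hi s hs
  rw [iterate_derivative_smul, eval_smul, smul_eq_mul, abs_mul]
  exact mul_le_mul hc (hF i hi s hs) (abs_nonneg _) ((abs_nonneg _).trans hc)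

theorem PolyBound.succ_iff {S : Set ℝ} {k : ℕ} {C : ℝ} {F : ℝ[X]} :
    PolyBound S (k + 1) C F ↔ PolyBound S 0 C F ∧ PolyBound S k C (derivative F) := by
  constructor
  · intro h
    refine ⟨h.mono (Nat.zero_le _) le_rfl, fun i hi s hs => ?_⟩
    have := h (i + 1) (by omega) s hs
    rwa [Function.iterate_succ_apply] at this
  · rintro ⟨h0, h1⟩ i hi s hs
    rcases i with _ | i
    · exact h0 0 le_rfl s hs
    · rw [Function.iterate_succ_apply]; exact h1 i (by omega) s hs

/-- A family of operators on polynomials that is uniformly bounded from `C^l` to `C^k`. -/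
def UnifBounded {ι : Type*} (S : Set ℝ) (k l : ℕ) (T : ι → ℝ[X] → ℝ[X]) : Prop :=
  ∃ A, 0 ≤ A ∧ ∀ i F C, 0 ≤ C → PolyBound S l C F → PolyBound S k (A * C) (T i F)

section
variable {ι : Type*} {S : Set ℝ}

theorem UnifBounded.id {k l : ℕ} (h : k ≤ l) : UnifBounded S k l (fun (_ : ι) F => F) :=
  ⟨1, zero_le_one, fun _ _ _ _ hF => hF.mono h (by simp)⟩

theorem UnifBounded.congr {k l : ℕ} {T U : ι → ℝ[X] → ℝ[X]} (hT : UnifBounded S k l T)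
    (h : ∀ i F, T i F = U i F) : UnifBounded S k l U := by
  have : T = U := funext fun i => funext (h i)
  rwa [← this]

theorem UnifBounded.comp {k l m : ℕ} {T U : ι → ℝ[X] → ℝ[X]} (hT : UnifBounded S k l T)
    (hU : UnifBounded S l m U) : UnifBounded S k m (fun i F => T i (U i F)) := by
  obtain ⟨A, hA, hA'⟩ := hT
  obtain ⟨B, hB, hB'⟩ := hU
  refine ⟨A * B, by positivity, fun i F C hC hF => ?_⟩
  rw [mul_assoc]
  exact hA' i _ _ (by positivity) (hB' i F C hC hF)

theorem UnifBounded.add {k l : ℕ} {T U : ι → ℝ[X] → ℝ[X]} (hT : UnifBounded S k l T)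
    (hU : UnifBounded S k l U) : UnifBounded S k l (fun i F => T i F + U i F) := by
  obtain ⟨A, hA, hA'⟩ := hT
  obtain ⟨B, hB, hB'⟩ := hU
  refine ⟨A + B, by positivity, fun i F C hC hF => ?_⟩
  rw [add_mul]
  exact (hA' i _ _ hC hF).add (hB' i F C hC hF)

theorem UnifBounded.smul {k l : ℕ} {T : ι → ℝ[X] → ℝ[X]} (hT : UnifBounded S k l T) {c : ι → ℝ}
    {B : ℝ} (hc : ∀ i, |c i| ≤ B) : UnifBounded S k l (fun i F => c i • T i F) := by
  obtain ⟨A, hA, hA'⟩ := hT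
  refine ⟨|B| * A, by positivity, fun i F C hC hF => ?_⟩
  rw [mul_assoc]
  exact (hA' i F C hC hF).smul ((hc i).trans (le_abs_self B))

theorem UnifBounded.sub {k l : ℕ} {T U : ι → ℝ[X] → ℝ[X]} (hT : UnifBounded S k l T)
    (hU : UnifBounded S k l U) : UnifBounded S k l (fun i F => T i F - U i F) := by
  have := hT.add (hU.smul (c := fun _ => -1) (B := 1) (by simp))
  simpa [sub_eq_add_neg] using this

theorem UnifBounded.mono {k l k' l' : ℕ} {T : ι → ℝ[X] → ℝ[X]} (hT : UnifBounded S k l T)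
    (hk : k' ≤ k) (hl : l ≤ l') : UnifBounded S k' l' T := by
  obtain ⟨A, hA, hA'⟩ := hT
  exact ⟨A, hA, fun i F C hC hF => (hA' i F C hC (hF.mono hl le_rfl)).mono hk le_rfl⟩

theorem UnifBounded.of_derivative (k : ℕ) :
    UnifBounded S k (k + 1) (fun (_ : ι) F => derivative F) :=
  ⟨1, zero_le_one, fun _ _ _ _ hF => by simpa using (PolyBound.succ_iff.1 hF).2⟩

theorem UnifBounded.mul_left (hS : IsCompact S) (k : ℕ) (W : ℝ[X]) :
    UnifBounded S k k (fun (_ : ι) F => W * F) := by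
  suffices ∀ k : ℕ, ∀ W : ℝ[X], ∃ A, 0 ≤ A ∧ ∀ F C, 0 ≤ C → PolyBound S k C F →
      PolyBound S k (A * C) (W * F) by
    obtain ⟨A, hA, hA'⟩ := this k W
    exact ⟨A, hA, fun _ => hA'⟩
  intro k
  induction k with
  | zero =>
    intro W
    obtain ⟨B, hB⟩ := hS.exists_bound_of_continuousOn (f := fun s => W.eval s)
      W.continuous.continuousOn
    refine ⟨|B|, abs_nonneg B, fun F C hC hF i hi s hs => ?_⟩
    obtain rfl : i = 0 := by omega
    have h1 := hF 0 le_rfl s hs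
    have h2 := (hB s hs).trans (le_abs_self B)
    simp only [Function.iterate_zero, _root_.id, eval_mul, abs_mul] at h1 ⊢
    exact mul_le_mul h2 h1 (abs_nonneg _) (abs_nonneg _)
  | succ k ih =>
    intro W
    obtain ⟨A, hA, hA'⟩ := ih W
    obtain ⟨B, hB, hB'⟩ := ih (derivative W)
    refine ⟨A + B, by positivity, fun F C hC hF => PolyBound.succ_iff.2 ⟨?_, ?_⟩⟩
    · exact (hA' F C hC (hF.mono (by omega) le_rfl)).mono (Nat.zero_le _)
        (mul_le_mul_of_nonneg_right (by linarith) hC)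
    · rw [derivative_mul, add_comm (derivative W * F), add_mul]
      exact (hA' _ C hC (PolyBound.succ_iff.1 hF).2).add (hB' F C hC (hF.mono (by omega) le_rfl))

end

/-- The operator that multiplies the `n`-th coefficient by `φ n`. -/
noncomputable def mulCoeff (φ : ℕ → ℝ) : ℝ[X] →ₗ[ℝ] ℝ[X] :=
  Polynomial.lsum fun n => φ n • Polynomial.monomial n

theorem mulCoeff_monomial (φ : ℕ → ℝ) (n : ℕ) (a : ℝ) :
    mulCoeff φ (monomial n a) = monomial n (φ n * a) := by
  simp [mulCoeff, Polynomial.lsum, smul_monomial]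

theorem mulCoeff_C (φ : ℕ → ℝ) (a : ℝ) : mulCoeff φ (C a) = C (φ 0 * a) := by
  simpa using mulCoeff_monomial φ 0 a

/-- Linear maps on polynomials that agree on the monomials are equal. -/
theorem linearMap_eq_of_monomial {M : Type*} [AddCommMonoid M] [Module ℝ M] {T U : ℝ[X] →ₗ[ℝ] M}
    (h : ∀ n, T (monomial n 1) = U (monomial n 1)) : T = U :=
  Polynomial.lhom_ext' fun n => LinearMap.ext_ring (h n)

theorem mulCoeff_comp (φ ψ : ℕ → ℝ) (F : ℝ[X]) :
    mulCoeff φ (mulCoeff ψ F) = mulCoeff (fun n => φ n * ψ n) F := by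
  have : (mulCoeff φ) ∘ₗ (mulCoeff ψ) = mulCoeff (fun n => φ n * ψ n) :=
    linearMap_eq_of_monomial fun n => by simp [mulCoeff_monomial]
  exact LinearMap.congr_fun this F

theorem derivative_mulCoeff (φ : ℕ → ℝ) (F : ℝ[X]) :
    derivative (mulCoeff φ F) = mulCoeff (fun n => φ (n + 1)) (derivative F) := by
  have : derivative ∘ₗ (mulCoeff φ) = (mulCoeff fun n => φ (n + 1)) ∘ₗ derivative :=
    linearMap_eq_of_monomial fun n => by
      rcases n with _ | n
      · rw [LinearMap.comp_apply, LinearMap.comp_apply, mulCoeff_monomial, derivative_monomial,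
          derivative_monomial]
        simp
      · rw [LinearMap.comp_apply, LinearMap.comp_apply, mulCoeff_monomial, derivative_monomial,
          derivative_monomial, mulCoeff_monomial]
        congr 1; push_cast; ring
  exact LinearMap.congr_fun this F

theorem mulCoeff_linear (c d : ℝ) (F : ℝ[X]) :
    mulCoeff (fun n => c * n + d) F = c • (X * derivative F) + d • F := by
  have : mulCoeff (fun n => c * n + d) =
      c • (LinearMap.mulLeft ℝ X ∘ₗ derivative) + d • LinearMap.id :=
    linearMap_eq_of_monomial fun n => by
      rw [mulCoeff_monomial]
      simp only [LinearMap.add_apply, LinearMap.smul_apply, LinearMap.comp_apply,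
        LinearMap.mulLeft_apply, LinearMap.id_apply]
      rw [derivative_monomial, X_mul_monomial, smul_monomial, smul_monomial]
      rcases n with _ | n
      · simp
      · rw [Nat.add_sub_cancel, ← map_add]
        congr 1; simp
  exact LinearMap.congr_fun this F

/-- This is F(s) - F(0) = s ∫₀¹ F'(θs) dθ: the multiplier 1/(n+1) is the moment of θ^n, so division
by X costs one derivative. -/
theorem divX_eq_mulCoeff (F : ℝ[X]) :
    divX F = mulCoeff (fun n => 1 / (n + 1)) (derivative F) := by
  have h : ∀ F G : ℝ[X], divX (F + G) = divX F + divX G := fun F G => divX_add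
  induction F using Polynomial.induction_on' with
  | add F G hF hG => rw [h, derivative_add, map_add, hF, hG]
  | monomial n a =>
    rcases n with _ | n
    · simp
    · have : ((n : ℝ) + 1) ≠ 0 := by positivity
      rw [← C_mul_X_pow_eq_monomial, divX_C_mul_X_pow, if_neg (Nat.succ_ne_zero n),
        C_mul_X_pow_eq_monomial, C_mul_X_pow_eq_monomial, derivative_monomial, mulCoeff_monomial]
      congr 1
      push_cast [Nat.add_sub_cancel]
      field_simp

section
variable {ι : Type*} {S : Set ℝ}

theorem eval_mulCoeff_integral {a b : ℝ} {w g : ℝ → ℝ} (hw : Continuous w) (hg : Continuous g)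
    (F : ℝ[X]) (s : ℝ) : (mulCoeff (fun n => ∫ θ in a..b, w θ * g θ ^ n) F).eval s =
      ∫ θ in a..b, w θ * F.eval (g θ * s) := by
  induction F using Polynomial.induction_on' with
  | add F G hF hG =>
    rw [map_add, eval_add, hF, hG, ← intervalIntegral.integral_add]
    · simp [mul_add]
    · exact Continuous.intervalIntegrable (by fun_prop) _ _
    · exact Continuous.intervalIntegrable (by fun_prop) _ _
  | monomial n c =>
    rw [mulCoeff_monomial, eval_monomial, ← intervalIntegral.integral_mul_const,
      ← intervalIntegral.integral_mul_const]
    congr 1; ext θ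
    rw [eval_monomial]; ring

/-- Multipliers that are moments of a measure on `[0, 1]` are bounded. -/
theorem UnifBounded.of_mulCoeff_integral (hS : Convex ℝ S) (h0 : (0 : ℝ) ∈ S) {a b : ℝ} (hab : a ≤ b)
    {w g : ℝ → ℝ} (hw : Continuous w) (hg : Continuous g) (hw1 : ∀ θ, |w θ| ≤ 1)
    (hg1 : ∀ θ ∈ Set.Icc a b, g θ ∈ Set.Icc (0 : ℝ) 1) (k : ℕ) :
    UnifBounded S k k (fun (_ : ι) => mulCoeff (fun n => ∫ θ in a..b, w θ * g θ ^ n)) := by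
  refine ⟨b - a, by linarith, fun _ F C hC hF => ?_⟩
  -- Each derivative shifts the index of the multiplier by one, which puts one more factor g into
  -- the weight; on [a, b] this factor lies in [0, 1].
  have iter : ∀ i : ℕ, ∀ F : ℝ[X], derivative^[i] (mulCoeff (fun n => ∫ θ in a..b, w θ * g θ ^ n) F) =
      mulCoeff (fun n => ∫ θ in a..b, (w θ * g θ ^ i) * g θ ^ n) (derivative^[i] F) := by
    intro i
    induction i with
    | zero => intro F; simp
    | succ i ih =>
      intro F
      rw [Function.iterate_succ_apply', ih, derivative_mulCoeff, Function.iterate_succ_apply']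
      congr 2; ext n; congr 1; ext θ; ring
  intro i hi s hs
  rw [iter, eval_mulCoeff_integral (by fun_prop) hg, ← Real.norm_eq_abs]
  refine (intervalIntegral.norm_integral_le_of_norm_le_const (C := C) fun θ hθ => ?_).trans_eq ?_
  · rw [Set.uIoc_of_le hab] at hθ
    have h1 := hg1 θ ⟨hθ.1.le, hθ.2⟩
    have hmem : g θ * s ∈ S := by
      have := hS h0 hs (sub_nonneg.2 h1.2) h1.1 (by ring)
      simpa using this
    rw [Real.norm_eq_abs, abs_mul, abs_mul, abs_pow, abs_of_nonneg h1.1]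
    have e1 : |w θ| * g θ ^ i ≤ 1 * 1 :=
      mul_le_mul (hw1 θ) (pow_le_one₀ h1.1 h1.2) (pow_nonneg h1.1 _) zero_le_one
    calc _ ≤ 1 * 1 * C := mul_le_mul e1 (hF i hi _ hmem) (abs_nonneg _) (by norm_num)
      _ = C := by ring
  · rw [abs_of_nonneg (by linarith)]; ring

theorem UnifBounded.of_divX (hS : Convex ℝ S) (h0 : (0 : ℝ) ∈ S) (k : ℕ) :
    UnifBounded S k (k + 1) (fun (_ : ι) => divX) := by
  have e : (fun n : ℕ => (1 : ℝ) / (n + 1)) = fun n => ∫ θ in (0 : ℝ)..1, 1 * θ ^ n := by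
    ext n; simp
  have := (UnifBounded.of_mulCoeff_integral (ι := ι) hS h0 zero_le_one (w := fun _ => 1) (g := fun θ => θ)
    continuous_const continuous_id (by simp) (fun θ h => h) k).comp (UnifBounded.of_derivative k)
  rw [← e] at this
  exact this.congr fun _ F => (divX_eq_mulCoeff F).symm

theorem UnifBounded.of_mulCoeff_linear (hS : IsCompact S) (c d : ℝ) (k : ℕ) :
    UnifBounded S k (k + 1) (fun (_ : ι) => mulCoeff (fun n => c * n + d)) := by
  have h := (((UnifBounded.mul_left (ι := ι) hS k X).comp (UnifBounded.of_derivative k)).smul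
    (c := fun _ => c) (B := |c|) (fun _ => le_rfl)).add
    ((UnifBounded.id (ι := ι) (S := S) (Nat.le_succ k)).smul (c := fun _ => d) (B := |d|)
      (fun _ => le_rfl))
  exact h.congr fun _ F => (mulCoeff_linear c d F).symm

theorem UnifBounded.of_mulCoeff_linear_pow (hS : IsCompact S) (c d : ℝ) (k m : ℕ) :
    UnifBounded S k (k + m) (fun (_ : ι) => mulCoeff (fun n => (c * n + d) ^ m)) := by
  induction m with
  | zero =>
    have : ∀ F : ℝ[X], mulCoeff (fun n => (c * n + d) ^ 0) F = F := fun F => by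
      have : mulCoeff (fun n => (c * n + d) ^ 0) = LinearMap.id :=
        linearMap_eq_of_monomial fun n => by simp [mulCoeff_monomial]
      rw [this]; rfl
    exact (UnifBounded.id (ι := ι) (S := S) le_rfl).congr fun _ F => (this F).symm
  | succ m ih =>
    have := ih.comp (UnifBounded.of_mulCoeff_linear (ι := ι) hS c d (k + m))
    refine this.congr fun _ F => ?_
    rw [mulCoeff_comp]; simp only [← pow_succ]

end

/-- The divided difference `(F - F(v)) / (X - v)`. -/
noncomputable def divDiff (v : ℝ) (F : ℝ[X]) : ℝ[X] := taylor (-v) (divX (taylor v F))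

theorem sub_mul_divDiff (v : ℝ) (F : ℝ[X]) : (X - C v) * divDiff v F = F - C (F.eval v) := by
  have h := divX_mul_X_add (taylor v F)
  have h2 := congrArg (taylor (-v)) h
  rw [taylor_taylor, neg_add_cancel, taylor_zero, map_add, taylor_mul, taylor_X, taylor_C,
    taylor_coeff_zero] at h2
  rw [divDiff, mul_comm]
  linear_combination h2 + (taylor (-v) (divX (taylor v F))) * (C_neg (a := v)).symm

theorem PolyBound.of_taylor {S T : Set ℝ} {v : ℝ} (hT : ∀ t ∈ T, t + v ∈ S) {k : ℕ} {C : ℝ} {F : ℝ[X]}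
    (h : PolyBound S k C F) : PolyBound T k C (taylor v F) := by
  have e : ∀ i : ℕ, ∀ F : ℝ[X], derivative^[i] (taylor v F) =
      taylor v (derivative^[i] F) := by
    intro i
    induction i with
    | zero => intro F; rfl
    | succ i ih =>
      intro F
      rw [Function.iterate_succ_apply, Function.iterate_succ_apply, ← ih]
      simp [taylor_apply, derivative_comp]
  intro i hi s hs
  rw [e, taylor_eval]
  exact h i hi _ (hT s hs)

/-- Translation by `v i` reduces this to division by X. The integral estimate is repeated on the
translated set, which depends on i, to see that the constant is 1 for every i. -/
theorem UnifBounded.of_divDiff {ι : Type*} {S : Set ℝ} (hS : Convex ℝ S) {v : ι → ℝ}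
    (hv : ∀ i, v i ∈ S) (k : ℕ) : UnifBounded S k (k + 1) (fun i => divDiff (v i)) := by
  refine ⟨1, zero_le_one, fun i F C hC hF => ?_⟩
  have hT : Convex ℝ ((fun t => t + v i) ⁻¹' S) := by
    intro x hx y hy a b ha hb hab
    have := hS hx hy ha hb hab
    simp only [Set.mem_preimage, smul_eq_mul] at this ⊢
    convert! this using 1
    linear_combination (-(v i)) * hab
  have h0 : (0 : ℝ) ∈ (fun t => t + v i) ⁻¹' S := by simpa using hv i
  have e : (fun n : ℕ => (1 : ℝ) / (n + 1)) = fun n => ∫ θ in (0 : ℝ)..1, 1 * θ ^ n := by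
    ext n; simp
  have hF' : PolyBound ((fun t => t + v i) ⁻¹' S) (k + 1) C (taylor (v i) F) :=
    hF.of_taylor fun t ht => ht
  obtain ⟨A, hA, hA'⟩ := UnifBounded.of_mulCoeff_integral (ι := Unit) hT h0 zero_le_one
    (w := fun _ => 1) (g := fun θ => θ)
    continuous_const continuous_id (by simp) (fun θ h => h) k
  have key : PolyBound ((fun t => t + v i) ⁻¹' S) k (1 * C)
      (divX (taylor (v i) F)) := by
    rw [divX_eq_mulCoeff, e]
    intro j hj s hs
    have iter : ∀ i : ℕ, ∀ F : ℝ[X], derivative^[i] (mulCoeff (fun n => ∫ θ in (0 : ℝ)..1, 1 * θ ^ n) F)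
        = mulCoeff (fun n => ∫ θ in (0 : ℝ)..1, (θ ^ i) * θ ^ n) (derivative^[i] F) := by
      intro i
      induction i with
      | zero => intro F; simp
      | succ i ih =>
        intro F
        rw [Function.iterate_succ_apply', ih, derivative_mulCoeff, Function.iterate_succ_apply']
        congr 2; ext n; congr 1; ext θ; ring
    rw [iter, eval_mulCoeff_integral (by fun_prop) (by fun_prop), ← Real.norm_eq_abs]
    refine (intervalIntegral.norm_integral_le_of_norm_le_const (C := C) fun θ hθ => ?_).trans_eq ?_
    · rw [Set.uIoc_of_le zero_le_one] at hθ
      have hmem : θ * s ∈ (fun t => t + v i) ⁻¹' S := by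
        have := hT h0 hs (sub_nonneg.2 hθ.2) hθ.1.le (by ring)
        simpa using this
      rw [Real.norm_eq_abs, abs_mul, abs_pow, abs_of_nonneg hθ.1.le]
      have := (PolyBound.succ_iff.1 hF').2 j hj _ hmem
      calc _ ≤ 1 * C := mul_le_mul (pow_le_one₀ hθ.1.le hθ.2) this (abs_nonneg _) zero_le_one
        _ = C := by ring
    · norm_num
  exact key.of_taylor fun t ht => by simpa using ht

end DiscreteQGUE

/-! ### The moment recurrence in hyperbolic form. -/

namespace DiscreteQGUE

open Polynomial

/-- The `n`-th moment of the `j`-th squared orthonormal function in the variable `s = q x²`. -/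
noncomputable def normMoment (q : ℝ) (j n : ℕ) : ℝ :=
  q ^ n * hermiteMoment q j (2 * n) / hermiteMoment q j 0

theorem normMoment_zero {q : ℝ} (h0 : 0 < q) (h1 : q < 1) (j : ℕ) : normMoment q j 0 = 1 := by
  have := (hermiteMoment_norm_pos h0 h1 j).ne'
  simp [normMoment, this]

/-- The half-integer shift in y = e^{-ε(j+1/2)} combines the powers of q into hyperbolic functions
of ε, so that parity in ε is manifest; this is why the expansion proceeds in powers of ε². -/
theorem normMoment_sinh_zero {ε : ℝ} (hε : 0 < ε) (j : ℕ) :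
    normMoment (Real.exp (-ε)) j 1 = 2 * Real.exp (-ε * (j + 1 / 2)) * Real.cosh (ε / 2) -
      2 * Real.exp (-ε * (j + 1 / 2)) ^ 2 * Real.cosh ε := by
  have h0 := Real.exp_pos (-ε)
  have h1 : Real.exp (-ε) < 1 := by simpa using hε
  have hp := (hermiteMoment_norm_pos h0 h1 j).ne'
  have t := hermiteMoment_two h0 h1 j
  have hX := Real.exp_pos (ε / 2)
  have eq : Real.exp (-ε) = (Real.exp (ε / 2) ^ 2)⁻¹ := by
    rw [← Real.exp_nat_mul, ← Real.exp_neg]; congr 1; push_cast; ring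
  have ej : Real.exp (-ε) ^ j = Real.exp (-ε * (j + 1 / 2)) * Real.exp (ε / 2) := by
    rw [← Real.exp_nat_mul, ← Real.exp_add]; congr 1; ring
  have ec1 : Real.cosh (ε / 2) = (Real.exp (ε / 2) + (Real.exp (ε / 2))⁻¹) / 2 := by
    rw [Real.cosh_eq, Real.exp_neg]
  have ec2 : Real.cosh ε = (Real.exp (ε / 2) ^ 2 + (Real.exp (ε / 2) ^ 2)⁻¹) / 2 := by
    rw [Real.cosh_eq, Real.exp_neg, ← Real.exp_nat_mul]; congr 3 <;> push_cast <;> ring_nf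
  rw [normMoment, pow_one, mul_one, t, mul_div_assoc, div_self hp, ej, ec1, ec2, eq]
  field_simp

/-- The moment recurrence divided by the norm and by the power of q that makes each coefficient odd
in ε for fixed y; the products of factors then become sums of sinh(aε) with a affine in n. The
terms, including those with the factor 0, are spelled out exactly as `relOp` produces them on a
monomial of degree n + 1. -/
theorem normMoment_sinh_succ {ε : ℝ} (hε : 0 < ε) (j n : ℕ) {y : ℝ}
    (hy : y = Real.exp (-ε * (j + 1 / 2))) :
    1 / 2 * (Real.sinh ((2 * ((n + 1 : ℕ) : ℝ) + 1) * ε) +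
      Real.sinh ((0 * ((n + 1 : ℕ) : ℝ) + 1) * ε)) * normMoment (Real.exp (-ε)) j (n + 2) -
    y * (Real.sinh ((2 * ((n + 1 : ℕ) : ℝ) + 3 / 2) * ε) +
      Real.sinh ((2 * ((n + 1 : ℕ) : ℝ) + 1 / 2) * ε)) * normMoment (Real.exp (-ε)) j (n + 1) +
    y ^ 2 / 2 * (Real.sinh ((4 * ((n + 1 : ℕ) : ℝ) + 2) * ε) +
      Real.sinh ((2 * ((n + 1 : ℕ) : ℝ) + 2) * ε) +
      Real.sinh ((2 * ((n + 1 : ℕ) : ℝ) + 0) * ε)) * normMoment (Real.exp (-ε)) j (n + 1) -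
    y ^ 2 / 2 * (Real.sinh ((4 * (n : ℝ) + 5) * ε) + Real.sinh ((0 * (n : ℝ) + 1) * ε) -
      Real.sinh ((2 * (n : ℝ) + 3) * ε) + Real.sinh ((2 * (n : ℝ) + 1) * ε) -
      Real.sinh ((2 * (n : ℝ) + 4) * ε) - Real.sinh ((2 * (n : ℝ) + 2) * ε) +
      Real.sinh ((0 * (n : ℝ) + 2) * ε)) * normMoment (Real.exp (-ε)) j n = 0 := by
  have h0 := Real.exp_pos (-ε)
  have h1 : Real.exp (-ε) < 1 := by simpa using hε
  have hp := hermiteMoment_norm_pos h0 h1 j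
  have t := hermiteMoment_recurrence h0 h1 j (2 * n)
  have hX := Real.exp_pos (ε / 2)
  have hT := Real.exp_pos (n * ε)
  -- Everything becomes rational in e^{nε} and e^{ε/2}; here d counts half units of ε.
  have key : ∀ (c d : ℕ) (x : ℝ), x = c * n + d / 2 → Real.sinh (x * ε) =
      (Real.exp (n * ε) ^ c * Real.exp (ε / 2) ^ d -
        (Real.exp (n * ε) ^ c * Real.exp (ε / 2) ^ d)⁻¹) / 2 := fun c d x hx => by
    rw [hx, Real.sinh_eq, Real.exp_neg, ← Real.exp_nat_mul, ← Real.exp_nat_mul, ← Real.exp_add]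
    congr 3 <;> ring_nf
  have eq : Real.exp (-ε) = (Real.exp (ε / 2) ^ 2)⁻¹ := by
    rw [← Real.exp_nat_mul, ← Real.exp_neg]; congr 1; push_cast; ring
  have ej : Real.exp (-ε) ^ j = y * Real.exp (ε / 2) := by
    rw [hy, ← Real.exp_nat_mul, ← Real.exp_add]; congr 1; ring
  have en : Real.exp (-ε) ^ n = (Real.exp (n * ε))⁻¹ := by
    rw [← Real.exp_nat_mul, ← Real.exp_neg]; congr 1; ring
  have s1 := key 2 6 (2 * ((n + 1 : ℕ) : ℝ) + 1) (by push_cast; ring)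
  have s2 := key 0 2 (0 * ((n + 1 : ℕ) : ℝ) + 1) (by push_cast; ring)
  have s3 := key 2 7 (2 * ((n + 1 : ℕ) : ℝ) + 3 / 2) (by push_cast; ring)
  have s4 := key 2 5 (2 * ((n + 1 : ℕ) : ℝ) + 1 / 2) (by push_cast; ring)
  have s5 := key 4 12 (4 * ((n + 1 : ℕ) : ℝ) + 2) (by push_cast; ring)
  have s6 := key 2 8 (2 * ((n + 1 : ℕ) : ℝ) + 2) (by push_cast; ring)
  have s7 := key 2 4 (2 * ((n + 1 : ℕ) : ℝ) + 0) (by push_cast; ring)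
  have s8 := key 4 10 (4 * (n : ℝ) + 5) (by push_cast; ring)
  have s9 := key 0 2 (0 * (n : ℝ) + 1) (by push_cast; ring)
  have s10 := key 2 6 (2 * (n : ℝ) + 3) (by push_cast; ring)
  have s11 := key 2 2 (2 * (n : ℝ) + 1) (by push_cast; ring)
  have s12 := key 2 8 (2 * (n : ℝ) + 4) (by push_cast; ring)
  have s13 := key 2 4 (2 * (n : ℝ) + 2) (by push_cast; ring)
  have s14 := key 0 4 (0 * (n : ℝ) + 2) (by push_cast; ring)
  rw [s1, s2, s3, s4, s5, s6, s7, s8, s9, s10, s11, s12, s13, s14]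
  clear s1 s2 s3 s4 s5 s6 s7 s8 s9 s10 s11 s12 s13 s14 key
  simp only [normMoment]
  rw [show 2 * (n + 2) = 2 * n + 4 by ring, show 2 * (n + 1) = 2 * n + 2 by ring,
    pow_add _ n 2, pow_add _ n 1, en]
  rw [show 2 * n = n * 2 by ring, pow_mul, ej, en] at t
  rw [show n * 2 = 2 * n by ring] at t
  have hp' := hp.ne'
  rw [eq] at t hp' ⊢
  generalize hermiteMoment (Real.exp (ε / 2) ^ 2)⁻¹ j 0 = p at *
  generalize hermiteMoment (Real.exp (ε / 2) ^ 2)⁻¹ j (2 * n) = p0 at *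
  generalize hermiteMoment (Real.exp (ε / 2) ^ 2)⁻¹ j (2 * n + 2) = p2 at *
  generalize hermiteMoment (Real.exp (ε / 2) ^ 2)⁻¹ j (2 * n + 4) = p4 at *
  generalize Real.exp (ε / 2) = X at *
  generalize Real.exp (n * ε) = T at *
  clear en ej eq hy h0 h1 hp
  field_simp at t ⊢
  linear_combination -t

end DiscreteQGUE

/-! ### The means as functionals on polynomials and the exact relation they satisfy. -/

namespace DiscreteQGUE

open Polynomial

/-- The mean of a function on the lattice against the `j`-th squared orthonormal function. -/
noncomputable def latticeMean (q : ℝ) (j : ℕ) (g : ℕ → ℝ) : ℝ :=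
  latticeSum q (fun k => qHermite j (q ^ k) q ^ 2 * g k) / hermiteMoment q j 0

section
variable {q : ℝ} (h0 : 0 < q) (h1 : q < 1)
include h0 h1

theorem seqBdd_hermite_sq_mul (j : ℕ) {g : ℕ → ℝ} (hg : SeqBdd g) :
    SeqBdd fun k => qHermite j (q ^ k) q ^ 2 * g k :=
  ((SeqBdd.qHermite j (SeqBdd.geom h0 h1)).pow 2).mul hg

theorem latticeMean_add (j : ℕ) {f g : ℕ → ℝ} (hf : SeqBdd f) (hg : SeqBdd g) :
    latticeMean q j (fun k => f k + g k) = latticeMean q j f + latticeMean q j g := by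
  unfold latticeMean
  simp_rw [mul_add]
  rw [latticeSum_add h0 h1 (seqBdd_hermite_sq_mul h0 h1 j hf) (seqBdd_hermite_sq_mul h0 h1 j hg),
    add_div]

theorem latticeMean_sub (j : ℕ) {f g : ℕ → ℝ} (hf : SeqBdd f) (hg : SeqBdd g) :
    latticeMean q j (fun k => f k - g k) = latticeMean q j f - latticeMean q j g := by
  unfold latticeMean
  simp_rw [mul_sub]
  rw [latticeSum_sub h0 h1 (seqBdd_hermite_sq_mul h0 h1 j hf) (seqBdd_hermite_sq_mul h0 h1 j hg),
    sub_div]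

/-- The weight is positive and the mean of 1 is 1. This is the source of all bounds that are uniform
in j. -/
theorem abs_latticeMean_le (j : ℕ) {g : ℕ → ℝ} {C : ℝ} (hg : ∀ k, |g k| ≤ C) :
    |latticeMean q j g| ≤ C := by
  have hp := hermiteMoment_norm_pos h0 h1 j
  have hb := (SeqBdd.qHermite (q := q) j (SeqBdd.geom h0 h1)).pow 2
  have hs := ((summable_lattice h0 h1 hb).mul_right C).hasSum
  rw [tsum_mul_right] at hs
  have : ‖∑' k : ℕ, q ^ k * latticeWeight q k * (qHermite j (q ^ k) q ^ 2 * g k)‖ ≤ _ :=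
    tsum_of_norm_bounded hs fun k => by
      have := latticeWeight_pos h0 h1 k
      rw [← mul_assoc, Real.norm_eq_abs, abs_mul, abs_of_nonneg (by positivity)]
      have := hg k
      gcongr
  rw [latticeMean, abs_div, abs_of_pos hp, div_le_iff₀ hp]
  refine this.trans_eq ?_
  simp [hermiteMoment, latticeSum, mul_comm]

omit h0 h1 in
theorem latticeMean_mul (j : ℕ) (c : ℝ) (g : ℕ → ℝ) :
    latticeMean q j (fun k => c * g k) = c * latticeMean q j g := by
  unfold latticeMean
  rw [← mul_div_assoc, ← latticeSum_mul]
  congr 2; ext k; ring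

end

theorem SeqBdd.eval {x : ℕ → ℝ} (hx : SeqBdd x) (F : ℝ[X]) : SeqBdd fun k => F.eval (x k) := by
  induction F using Polynomial.induction_on' with
  | add F G hF hG => simpa using hF.add hG
  | monomial n a => simpa using (SeqBdd.const a).mul (hx.pow n)

/-- The mean of a polynomial in `s = q x²` against the `j`-th squared orthonormal function. -/
noncomputable def hermiteExp (q : ℝ) (j : ℕ) : ℝ[X] →ₗ[ℝ] ℝ :=
  Polynomial.lsum fun n => normMoment q j n • LinearMap.id

theorem hermiteExp_monomial (q : ℝ) (j n : ℕ) (a : ℝ) :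
    hermiteExp q j (monomial n a) = normMoment q j n * a := by
  simp [hermiteExp, Polynomial.lsum]

theorem hermiteExp_eq {q : ℝ} (h0 : 0 < q) (h1 : q < 1) (j : ℕ) (F : ℝ[X]) :
    hermiteExp q j F = latticeMean q j fun k => F.eval (q * (q ^ k) ^ 2) := by
  have hx : SeqBdd fun k => q * (q ^ k) ^ 2 :=
    (SeqBdd.const q).mul ((SeqBdd.geom h0 h1).pow 2)
  induction F using Polynomial.induction_on' with
  | add F G hF hG =>
    simp_rw [map_add, hF, hG, eval_add]
    rw [latticeMean_add h0 h1 j (hx.eval F) (hx.eval G)]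
  | monomial n a =>
    rw [hermiteExp_monomial]
    simp_rw [eval_monomial]
    rw [latticeMean_mul, mul_comm]
    congr 1
    rw [normMoment, hermiteMoment, latticeMean, ← latticeSum_mul]
    congr 2; ext k
    rw [mul_pow, pow_mul]; ring

theorem hermiteExp_C {q : ℝ} (h0 : 0 < q) (h1 : q < 1) (j : ℕ) (a : ℝ) :
    hermiteExp q j (C a) = a := by
  rw [← monomial_zero_left, hermiteExp_monomial, normMoment_zero h0 h1, one_mul]

theorem abs_hermiteExp_le {q : ℝ} (h0 : 0 < q) (h1 : q < 1) (j : ℕ) {F : ℝ[X]} {C : ℝ}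
    (hF : ∀ s ∈ Set.Icc (0 : ℝ) 1, |F.eval s| ≤ C) : |hermiteExp q j F| ≤ C := by
  rw [hermiteExp_eq h0 h1]
  refine abs_latticeMean_le h0 h1 j fun k => hF _ ⟨by positivity, ?_⟩
  exact mul_le_one₀ h1.le (by positivity) (pow_le_one₀ (by positivity) (pow_le_one₀ h0.le h1.le))

/-- The operator in the moment recurrence, for a multiplier built from the function `φ`. -/
noncomputable def relOp (φ : ℝ → ℝ) (y : ℝ) (F : ℝ[X]) : ℝ[X] :=
  let T := fun c d : ℝ => mulCoeff (fun n => φ (c * n + d))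
  (1 / 2 : ℝ) • (X * (T 2 1 F + T 0 1 F)) - y • (T 2 (3 / 2) F + T 2 (1 / 2) F) +
    (y ^ 2 / 2) • (T 4 2 F + T 2 2 F + T 2 0 F) -
    (y ^ 2 / 2) • (T 4 5 (divX F) + T 0 1 (divX F) - T 2 3 (divX F) + T 2 1 (divX F) -
      T 2 4 (divX F) - T 2 2 (divX F) + T 0 2 (divX F))

theorem relOp_add (φ : ℝ → ℝ) (y : ℝ) (F G : ℝ[X]) :
    relOp φ y (F + G) = relOp φ y F + relOp φ y G := by
  simp only [relOp, map_add, divX_add, mul_add, smul_add, smul_sub]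
  abel

theorem mulCoeff_add_fun (φ ψ : ℕ → ℝ) (F : ℝ[X]) :
    mulCoeff (fun n => φ n + ψ n) F = mulCoeff φ F + mulCoeff ψ F := by
  have : mulCoeff (fun n => φ n + ψ n) = mulCoeff φ + mulCoeff ψ :=
    linearMap_eq_of_monomial fun n => by simp [mulCoeff_monomial]
  rw [this]; rfl

theorem mulCoeff_mul_fun (c : ℝ) (φ : ℕ → ℝ) (F : ℝ[X]) :
    mulCoeff (fun n => c * φ n) F = c • mulCoeff φ F := by
  have : mulCoeff (fun n => c * φ n) = c • mulCoeff φ :=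
    linearMap_eq_of_monomial fun n => by simp [mulCoeff_monomial, smul_monomial]
  rw [this]; rfl

theorem relOp_add_fun (φ ψ : ℝ → ℝ) (y : ℝ) (F : ℝ[X]) :
    relOp (fun a => φ a + ψ a) y F = relOp φ y F + relOp ψ y F := by
  simp only [relOp, mulCoeff_add_fun, mul_add, smul_add, smul_sub]
  abel

theorem relOp_mul_fun (c : ℝ) (φ : ℝ → ℝ) (y : ℝ) (F : ℝ[X]) :
    relOp (fun a => c * φ a) y F = c • relOp φ y F := by
  simp only [relOp, mulCoeff_mul_fun, mul_add, smul_add, smul_sub, mul_smul_comm, smul_smul,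
    mul_comm _ c]

/-- On a monomial of degree n + 1 this is the recurrence between the moments of orders n, n + 1, n +
2. On constants the terms with `divX` drop out and it is the formula for the moment of order one. -/
theorem hermiteExp_relOp {ε : ℝ} (hε : 0 < ε) (j : ℕ) {y : ℝ}
    (hy : y = Real.exp (-ε * (j + 1 / 2))) (F : ℝ[X]) :
    hermiteExp (Real.exp (-ε)) j (relOp (fun a => Real.sinh (a * ε)) y F) = 0 := by
  have e0 := normMoment_sinh_zero hε j
  rw [← hy] at e0
  have h0 := Real.exp_pos (-ε)
  have h1 : Real.exp (-ε) < 1 := by simpa using hε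
  induction F using Polynomial.induction_on' with
  | add F G hF hG => rw [relOp_add, map_add, hF, hG, add_zero]
  | monomial n a =>
    rcases n with _ | n
    · simp only [relOp, divX_C, monomial_zero_left, mulCoeff_C, map_zero]
      simp only [mul_add, X_mul_C, smul_add, ← C_mul_X_eq_monomial.symm, smul_C, smul_monomial,
        map_add, map_sub, hermiteExp_monomial, hermiteExp_C h0 h1, smul_eq_mul, smul_zero, sub_zero,
        add_zero]
      simp only [e0]
      have e1 : Real.sinh (3 / 2 * ε) =
          Real.sinh ε * Real.cosh (ε / 2) + Real.cosh ε * Real.sinh (ε / 2) := by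
        rw [← Real.sinh_add]; ring_nf
      have e2 : Real.sinh (1 / 2 * ε) =
          Real.sinh ε * Real.cosh (ε / 2) - Real.cosh ε * Real.sinh (ε / 2) := by
        rw [← Real.sinh_sub]; ring_nf
      have e3 : Real.sinh (2 * ε) = 2 * Real.sinh ε * Real.cosh ε := Real.sinh_two_mul ε
      simp only [mul_zero, zero_add, zero_mul, Real.sinh_zero, e1, e2, e3, one_mul,
        CharP.cast_eq_zero]
      ring
    · have d : divX (monomial (n + 1) a) = monomial n a := by
        rw [← C_mul_X_pow_eq_monomial, divX_C_mul_X_pow, if_neg (Nat.succ_ne_zero n),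
          Nat.add_sub_cancel, C_mul_X_pow_eq_monomial]
      have key := normMoment_sinh_succ hε j n hy
      simp only [relOp, d, mulCoeff_monomial, mul_add, X_mul_monomial, smul_add, smul_sub,
        smul_monomial, map_add, map_sub, hermiteExp_monomial, smul_eq_mul]
      linear_combination a * key

/-! ### Taylor expansion of the multipliers -/

/-- An exponential multiplier is a dilation of the argument. Hence hyperbolic multipliers, although
exponentially large in the degree, are harmless once [0, 1] is enlarged to a longer interval. -/
theorem eval_mulCoeff_exp (c d σ : ℝ) (F : ℝ[X]) (s : ℝ) :
    (mulCoeff (fun n => Real.exp ((c * n + d) * σ)) F).eval s =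
      Real.exp (d * σ) * F.eval (Real.exp (c * σ) * s) := by
  induction F using Polynomial.induction_on' with
  | add F G hF hG => rw [map_add, eval_add, hF, hG, eval_add, mul_add]
  | monomial n a =>
    rw [mulCoeff_monomial, eval_monomial, eval_monomial, mul_pow, ← Real.exp_nat_mul,
      show (c * n + d) * σ = d * σ + n * (c * σ) by ring, Real.exp_add]
    ring

theorem eval_mulCoeff_cosh (c d σ : ℝ) (F : ℝ[X]) (s : ℝ) :
    (mulCoeff (fun n => Real.cosh ((c * n + d) * σ)) F).eval s =
      1 / 2 * (Real.exp (d * σ) * F.eval (Real.exp (c * σ) * s)) +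
      1 / 2 * (Real.exp (-(d * σ)) * F.eval (Real.exp (-(c * σ)) * s)) := by
  have : (fun n : ℕ => Real.cosh ((c * n + d) * σ)) = fun n : ℕ =>
      (1 / 2 * Real.exp ((c * n + d) * σ) + 1 / 2 * Real.exp ((c * n + d) * (-σ))) := by
    ext n; rw [Real.cosh_eq]; ring_nf
  rw [this, mulCoeff_add_fun, mulCoeff_mul_fun, mulCoeff_mul_fun, eval_add, eval_smul, eval_smul,
    eval_mulCoeff_exp, eval_mulCoeff_exp, smul_eq_mul, smul_eq_mul, mul_neg, mul_neg]

theorem hasDerivAt_eval_mulCoeff {φ φ' : ℕ → ℝ → ℝ} {σ : ℝ}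
    (h : ∀ n, HasDerivAt (φ n) (φ' n σ) σ) (F : ℝ[X]) (s : ℝ) :
    HasDerivAt (fun σ => (mulCoeff (fun n => φ n σ) F).eval s)
      ((mulCoeff (fun n => φ' n σ) F).eval s) σ := by
  induction F using Polynomial.induction_on' with
  | add F G hF hG =>
    simp only [map_add, eval_add]
    exact hF.add hG
  | monomial n a =>
    simp only [mulCoeff_monomial, eval_monomial]
    exact ((h n).mul_const a).mul_const _

theorem abs_le_mul_pow_succ {f f' : ℝ → ℝ} {e M : ℝ} {k : ℕ} (hM : 0 ≤ M)
    (hf : ∀ σ, HasDerivAt f (f' σ) σ) (hf0 : f 0 = 0)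
    (h : ∀ σ ∈ Set.Icc 0 e, |f' σ| ≤ M * σ ^ k) : ∀ σ ∈ Set.Icc 0 e, |f σ| ≤ M * σ ^ (k + 1) := by
  intro σ hσ
  have := (convex_Icc (0 : ℝ) σ).norm_image_sub_le_of_norm_hasDerivWithin_le (f := f) (f' := f')
    (C := M * σ ^ k) (fun x _ => (hf x).hasDerivWithinAt) (fun x hx => by
      refine (h x ⟨hx.1, hx.2.trans hσ.2⟩).trans ?_
      have := pow_le_pow_left₀ hx.1 hx.2 k
      gcongr) (Set.left_mem_Icc.2 hσ.1) (Set.right_mem_Icc.2 hσ.1)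
  rw [hf0, sub_zero, sub_zero, Real.norm_eq_abs, Real.norm_eq_abs, abs_of_nonneg hσ.1] at this
  rwa [pow_succ, ← mul_assoc]

/-- A family of functionals on polynomials that is uniformly bounded on `C^l`. -/
def FunBounded {ι : Type*} (S : Set ℝ) (l : ℕ) (L : ι → ℝ[X] → ℝ) : Prop :=
  ∃ A, 0 ≤ A ∧ ∀ i F C, 0 ≤ C → PolyBound S l C F → |L i F| ≤ A * C

section
variable {ι : Type*} {S : Set ℝ}

theorem FunBounded.comp {l m : ℕ} {L : ι → ℝ[X] → ℝ} {U : ι → ℝ[X] → ℝ[X]}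
    (hL : FunBounded S l L) (hU : UnifBounded S l m U) : FunBounded S m (fun i F => L i (U i F)) := by
  obtain ⟨A, hA, hA'⟩ := hL
  obtain ⟨B, hB, hB'⟩ := hU
  refine ⟨A * B, by positivity, fun i F C hC hF => ?_⟩
  rw [mul_assoc]
  exact hA' i _ _ (by positivity) (hB' i F C hC hF)

theorem FunBounded.add {l : ℕ} {L M : ι → ℝ[X] → ℝ} (hL : FunBounded S l L)
    (hM : FunBounded S l M) : FunBounded S l (fun i F => L i F + M i F) := by
  obtain ⟨A, hA, hA'⟩ := hL
  obtain ⟨B, hB, hB'⟩ := hM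
  refine ⟨A + B, by positivity, fun i F C hC hF => ?_⟩
  rw [add_mul]
  exact (abs_add_le _ _).trans (add_le_add (hA' i F C hC hF) (hB' i F C hC hF))

theorem FunBounded.mul {l : ℕ} {L : ι → ℝ[X] → ℝ} (hL : FunBounded S l L) {c : ι → ℝ} {B : ℝ}
    (hc : ∀ i, |c i| ≤ B) : FunBounded S l (fun i F => c i * L i F) := by
  obtain ⟨A, hA, hA'⟩ := hL
  refine ⟨|B| * A, by positivity, fun i F C hC hF => ?_⟩
  rw [abs_mul, mul_assoc]
  exact mul_le_mul ((hc i).trans (le_abs_self B)) (hA' i F C hC hF) (abs_nonneg _) (abs_nonneg _)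

theorem FunBounded.sub {l : ℕ} {L M : ι → ℝ[X] → ℝ} (hL : FunBounded S l L)
    (hM : FunBounded S l M) : FunBounded S l (fun i F => L i F - M i F) := by
  have := hL.add (hM.mul (c := fun _ => -1) (B := 1) (by simp))
  simpa [sub_eq_add_neg] using this

theorem FunBounded.mono {l m : ℕ} {L : ι → ℝ[X] → ℝ} (hL : FunBounded S l L) (h : l ≤ m) :
    FunBounded S m L := by
  obtain ⟨A, hA, hA'⟩ := hL
  exact ⟨A, hA, fun i F C hC hF => hA' i F C hC (hF.mono h le_rfl)⟩

end

/-- The remainder of `sinh` after its third order Taylor polynomial. -/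
noncomputable def sinhRem (z : ℝ) : ℝ := Real.sinh z - z - z ^ 3 / 6

/-- Parameters `(ε, y, s)` with `0 < ε ≤ Λ` and `y, s` in the unit interval. -/
def RelParam (Λ : ℝ) : Type :=
  {p : ℝ × ℝ × ℝ // (0 < p.1 ∧ p.1 ≤ Λ) ∧ p.2.1 ∈ Set.Icc (0 : ℝ) 1 ∧ p.2.2 ∈ Set.Icc (0 : ℝ) 1}

/-- With a_n = cn + d, the fifth σ-derivative of the remainder is a_n⁵ cosh(a_n σ): a differential
operator of order five followed by an average of two dilations, which map [0, 1] into [0, R] because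
R ≥ e^{cΛ}. Every lower derivative vanishes at σ = 0, so five integrations give the factor ε⁵. -/
theorem funBounded_sinhRem {Λ R c d : ℝ} (hc : 0 ≤ c) (hR : Real.exp (c * Λ) ≤ R) :
    FunBounded (Set.Icc 0 R) 5 (fun (p : RelParam Λ) F =>
      (mulCoeff (fun n => sinhRem ((c * n + d) * p.1.1)) F).eval p.1.2.2 / p.1.1 ^ 5) := by
  obtain ⟨A, hA, hA'⟩ := UnifBounded.of_mulCoeff_linear_pow (ι := Unit) (S := Set.Icc 0 R)
    isCompact_Icc c d 0 5
  refine ⟨Real.exp (|d| * Λ) * A, by positivity, fun p F C hC hF => ?_⟩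
  obtain ⟨⟨ε, y, s⟩, ⟨hε, hεΛ⟩, hy, hs⟩ := p
  simp only at hε hεΛ hs ⊢
  set a : ℕ → ℝ := fun n => c * n + d with ha
  set H := mulCoeff (fun n => a n ^ 5) F with hH
  have bH : PolyBound (Set.Icc 0 R) 0 (A * C) H := hA' () F C hC hF
  have hM : 0 ≤ Real.exp (|d| * Λ) * A * C := by positivity
  have bound : ∀ σ ∈ Set.Icc 0 ε, |(mulCoeff (fun n => a n ^ 5 * Real.cosh (a n * σ)) F).eval s| ≤
      Real.exp (|d| * Λ) * A * C * σ ^ 0 := by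
    intro σ hσ
    have e : mulCoeff (fun n => a n ^ 5 * Real.cosh (a n * σ)) F =
        mulCoeff (fun n => Real.cosh (a n * σ)) H := by
      rw [hH, mulCoeff_comp]; congr 2; ext n; ring
    have hσΛ := hσ.2.trans hεΛ
    rw [e, eval_mulCoeff_cosh]
    have m1 : Real.exp (c * σ) * s ∈ Set.Icc 0 R := by
      refine ⟨by have := hs.1; positivity, ?_⟩
      calc Real.exp (c * σ) * s ≤ Real.exp (c * σ) * 1 := by
            have := hs.2; gcongr
        _ ≤ Real.exp (c * Λ) := by rw [mul_one]; gcongr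
        _ ≤ R := hR
    have m2 : Real.exp (-(c * σ)) * s ∈ Set.Icc 0 R := by
      refine ⟨by have := hs.1; positivity, ?_⟩
      calc Real.exp (-(c * σ)) * s ≤ Real.exp (c * σ) * s := by
            have := hs.1
            have := hσ.1
            gcongr
            have : 0 ≤ c * σ := by positivity
            linarith
        _ ≤ R := m1.2
    have d1 : Real.exp (d * σ) ≤ Real.exp (|d| * Λ) := by
      have := hσ.1
      refine Real.exp_le_exp.2 ?_
      calc d * σ ≤ |d| * σ := by gcongr; exact le_abs_self d
        _ ≤ _ := by gcongr
    have d2 : Real.exp (-(d * σ)) ≤ Real.exp (|d| * Λ) := by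
      have := hσ.1
      refine Real.exp_le_exp.2 ?_
      calc -(d * σ) = (-d) * σ := by ring
        _ ≤ |d| * σ := by gcongr; exact neg_le_abs d
        _ ≤ _ := by gcongr
    have b1 := bH.eval m1
    have b2 := bH.eval m2
    refine (abs_add_le _ _).trans ?_
    rw [abs_mul, abs_mul, abs_mul, abs_mul, Real.abs_exp, Real.abs_exp, abs_of_pos (one_half_pos)]
    have g1 := mul_le_mul d1 b1 (abs_nonneg _) (Real.exp_pos _).le
    have g2 := mul_le_mul d2 b2 (abs_nonneg _) (Real.exp_pos _).le
    rw [pow_zero]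
    linarith
  have base : ∀ n (σ : ℝ), HasDerivAt (fun σ => a n * σ) (a n) σ := fun n σ => by
    simpa using (hasDerivAt_id σ).const_mul (a n)
  have zero : ∀ φ : ℕ → ℝ, (∀ n, φ n = 0) → (mulCoeff φ F).eval s = 0 := fun φ hφ => by
    have : φ = fun n => 0 * φ n := by ext n; simp [hφ n]
    rw [this, mulCoeff_mul_fun]; simp
  have s4 := abs_le_mul_pow_succ hM (fun σ => hasDerivAt_eval_mulCoeff
    (φ := fun n σ => a n ^ 4 * Real.sinh (a n * σ))
    (φ' := fun n σ => a n ^ 5 * Real.cosh (a n * σ)) (fun n => by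
      refine (((base n σ).sinh).const_mul _).congr_deriv ?_; ring) F s)
    (zero _ fun n => by simp) bound
  have s3 := abs_le_mul_pow_succ hM (fun σ => hasDerivAt_eval_mulCoeff
    (φ := fun n σ => a n ^ 3 * (Real.cosh (a n * σ) - 1))
    (φ' := fun n σ => a n ^ 4 * Real.sinh (a n * σ)) (fun n => by
      refine (((base n σ).cosh.sub_const 1).const_mul _).congr_deriv ?_; ring) F s)
    (zero _ fun n => by simp) s4
  have s2 := abs_le_mul_pow_succ hM (fun σ => hasDerivAt_eval_mulCoeff
    (φ := fun n σ => a n ^ 2 * (Real.sinh (a n * σ) - a n * σ))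
    (φ' := fun n σ => a n ^ 3 * (Real.cosh (a n * σ) - 1)) (fun n => by
      refine (((base n σ).sinh.sub (base n σ)).const_mul _).congr_deriv ?_; ring) F s)
    (zero _ fun n => by simp) s3
  have s1 := abs_le_mul_pow_succ hM (fun σ => hasDerivAt_eval_mulCoeff
    (φ := fun n σ => a n * (Real.cosh (a n * σ) - 1 - (a n * σ) ^ 2 / 2))
    (φ' := fun n σ => a n ^ 2 * (Real.sinh (a n * σ) - a n * σ)) (fun n => by
      refine ((((base n σ).cosh.sub_const 1).sub (((base n σ).pow 2).div_const 2)).const_mul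
        _).congr_deriv ?_
      push_cast; ring) F s)
    (zero _ fun n => by simp) s2
  have s0 := abs_le_mul_pow_succ hM (fun σ => hasDerivAt_eval_mulCoeff
    (φ := fun n σ => sinhRem (a n * σ))
    (φ' := fun n σ => a n * (Real.cosh (a n * σ) - 1 - (a n * σ) ^ 2 / 2)) (fun n => by
      refine ((((base n σ).sinh).sub (base n σ)).sub (((base n σ).pow 3).div_const 6)).congr_deriv ?_
      push_cast; ring) F s)
    (zero _ fun n => by simp [sinhRem]) s1
  rw [abs_div, abs_of_pos (pow_pos hε 5), div_le_iff₀ (pow_pos hε 5)]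
  exact s0 ε ⟨hε.le, le_rfl⟩

end DiscreteQGUE

/-! ### The approximate relation and the expansion of a single mean. -/

namespace DiscreteQGUE

open Polynomial

theorem FunBounded.congr {ι : Type*} {S : Set ℝ} {l : ℕ} {L M : ι → ℝ[X] → ℝ}
    (hL : FunBounded S l L) (h : ∀ i F, L i F = M i F) : FunBounded S l M := by
  have : L = M := funext fun i => funext (h i)
  rwa [← this]

/-- Five derivatives for the remainder and one more for `divX`; the slopes 0, 2 and 4 in the
multipliers dictate the conditions on R. -/
theorem funBounded_relOp_sinhRem {Λ R : ℝ} (hR : 1 ≤ R) (h2 : Real.exp (2 * Λ) ≤ R)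
    (h4 : Real.exp (4 * Λ) ≤ R) :
    FunBounded (Set.Icc 0 R) 6 (fun (p : RelParam Λ) F =>
      (relOp (fun a => sinhRem (a * p.1.1)) p.1.2.1 F).eval p.1.2.2 / p.1.1 ^ 5) := by
  have hS : Convex ℝ (Set.Icc 0 R) := convex_Icc 0 R
  have z : (0 : ℝ) ∈ Set.Icc 0 R := ⟨le_rfl, by linarith⟩
  have f0 : ∀ d : ℝ, FunBounded (Set.Icc 0 R) 5 (fun (p : RelParam Λ) F =>
      (mulCoeff (fun n => sinhRem ((0 * n + d) * p.1.1)) F).eval p.1.2.2 / p.1.1 ^ 5) := fun d =>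
    funBounded_sinhRem le_rfl (by simpa using hR)
  have f2 : ∀ d : ℝ, FunBounded (Set.Icc 0 R) 5 (fun (p : RelParam Λ) F =>
      (mulCoeff (fun n => sinhRem ((2 * n + d) * p.1.1)) F).eval p.1.2.2 / p.1.1 ^ 5) := fun d =>
    funBounded_sinhRem zero_le_two h2
  have f4 : ∀ d : ℝ, FunBounded (Set.Icc 0 R) 5 (fun (p : RelParam Λ) F =>
      (mulCoeff (fun n => sinhRem ((4 * n + d) * p.1.1)) F).eval p.1.2.2 / p.1.1 ^ 5) := fun d =>
    funBounded_sinhRem zero_le_four h4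
  have D := UnifBounded.of_divX (ι := RelParam Λ) hS z 5
  have m : 5 ≤ 6 := by norm_num
  have c1 : ∀ p : RelParam Λ, |p.1.2.2 / 2| ≤ 1 := fun p => by
    have := p.2.2.2.1; have := p.2.2.2.2
    rw [abs_of_nonneg] <;> linarith
  have c2 : ∀ p : RelParam Λ, |p.1.2.1| ≤ 1 := fun p => by
    rw [abs_of_nonneg p.2.2.1.1]; exact p.2.2.1.2
  have c3 : ∀ p : RelParam Λ, |p.1.2.1 ^ 2 / 2| ≤ 1 := fun p => by
    rw [abs_of_nonneg (by positivity)]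
    have := pow_le_one₀ (n := 2) p.2.2.1.1 p.2.2.1.2
    linarith
  have key := ((((((f2 1).add (f0 1)).mul c1).sub (((f2 (3 / 2)).add (f2 (1 / 2))).mul c2)).add
    ((((f4 2).add (f2 2)).add (f2 0)).mul c3)).mono m).sub
    ((((((((f4 5).add (f0 1)).sub (f2 3)).add (f2 1)).sub (f2 4)).sub (f2 2)).add
      (f0 2)).comp D |>.mul c3)
  refine key.congr fun p F => ?_
  simp only [relOp, eval_sub, eval_add, eval_smul, eval_mul, eval_X, smul_eq_mul]
  ring

/-- The exact relation with sinh(aε) = εa + ε³a³/6 + O(ε⁵), divided by ε. As sinh is odd there are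
no intermediate orders. -/
theorem abs_hermiteExp_relOp_le {Λ R : ℝ} (hR : 1 ≤ R) (h2 : Real.exp (2 * Λ) ≤ R)
    (h4 : Real.exp (4 * Λ) ≤ R) : ∃ A, 0 ≤ A ∧ ∀ ε, 0 < ε → ε ≤ Λ → ∀ j : ℕ, ∀ y,
      y = Real.exp (-ε * (j + 1 / 2)) → ∀ F C, 0 ≤ C → PolyBound (Set.Icc 0 R) 6 C F →
      |hermiteExp (Real.exp (-ε)) j (relOp (fun a => a) y F) +
        ε ^ 2 * hermiteExp (Real.exp (-ε)) j ((1 / 6 : ℝ) • relOp (fun a => a ^ 3) y F)| ≤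
        A * C * ε ^ 4 := by
  obtain ⟨A, hA, hA'⟩ := funBounded_relOp_sinhRem hR h2 h4
  refine ⟨A, hA, fun ε hε hεΛ j y hy F C hC hF => ?_⟩
  have h0 := Real.exp_pos (-ε)
  have h1 : Real.exp (-ε) < 1 := by simpa using hε
  have hy0 : y ∈ Set.Icc (0 : ℝ) 1 := by
    rw [hy]
    refine ⟨(Real.exp_pos _).le, Real.exp_le_one_iff.2 ?_⟩
    have : 0 ≤ ε * ((j : ℝ) + 1 / 2) := by positivity
    linarith
  have b : |hermiteExp (Real.exp (-ε)) j (relOp (fun a => sinhRem (a * ε)) y F)| ≤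
      A * C * ε ^ 5 := by
    refine abs_hermiteExp_le h0 h1 j fun s hs => ?_
    have := hA' ⟨(ε, y, s), ⟨hε, hεΛ⟩, hy0, hs⟩ F C hC hF
    simp only at this
    rwa [abs_div, abs_of_pos (pow_pos hε 5), div_le_iff₀ (pow_pos hε 5)] at this
  have e := hermiteExp_relOp hε j hy F
  have : (fun a => Real.sinh (a * ε)) =
      fun a => (ε * a + (ε ^ 3 / 6) * a ^ 3) + sinhRem (a * ε) := by
    ext a; rw [sinhRem]; ring
  rw [this, relOp_add_fun, relOp_add_fun, relOp_mul_fun, relOp_mul_fun, map_add, map_add,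
    map_smul, map_smul, smul_eq_mul, smul_eq_mul] at e
  rw [map_smul, smul_eq_mul]
  have : ε * |hermiteExp (Real.exp (-ε)) j (relOp (fun a => a) y F) +
        ε ^ 2 * (1 / 6 * hermiteExp (Real.exp (-ε)) j (relOp (fun a => a ^ 3) y F))| ≤
      ε * (A * C * ε ^ 4) := by
    rw [← abs_of_pos hε, ← abs_mul, abs_of_pos hε,
      show ∀ a b : ℝ, ε * (a + ε ^ 2 * (1 / 6 * b)) = ε * a + ε ^ 3 / 6 * b by intros; ring,
      eq_neg_of_add_eq_zero_left e, abs_neg]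
    exact b.trans_eq (by ring)
  exact le_of_mul_le_mul_left this hε

/-- For the linear multiplier the seven terms with `divX` cancel, and the terms in y and y² combine
to v = 4y(1-y). With θ = s d/ds the leading operator is s(θ + 1) - v(θ + 1/2). -/
theorem relOp_id (y : ℝ) (F : ℝ[X]) : relOp (fun a => a) y F =
    X * mulCoeff (fun n => 1 * n + 1) F -
      (4 * (y * (1 - y))) • mulCoeff (fun n => 1 * n + 1 / 2) F := by
  simp only [relOp, mulCoeff_linear, mul_add, mul_smul_comm]
  module

theorem divX_monomial_succ (n : ℕ) (a : ℝ) : divX (monomial (n + 1) a) = monomial n a := by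
  rw [← C_mul_X_pow_eq_monomial, divX_C_mul_X_pow, if_neg (Nat.succ_ne_zero n),
    Nat.add_sub_cancel, C_mul_X_pow_eq_monomial]

theorem unifBounded_relOp_pow {ι : Type*} {S : Set ℝ} (hS : IsCompact S) (hS' : Convex ℝ S)
    (z : (0 : ℝ) ∈ S) {y : ι → ℝ} (hy : ∀ i, y i ∈ Set.Icc (0 : ℝ) 1) (k m : ℕ) :
    UnifBounded S k (k + m + 1) (fun i F => relOp (fun a => a ^ m) (y i) F) := by
  have L := fun c d : ℝ => UnifBounded.of_mulCoeff_linear_pow (ι := ι) hS c d k m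
  have D := UnifBounded.of_divX (ι := ι) hS' z (k + m)
  have c2 : ∀ i, |y i| ≤ 1 := fun i => by
    rw [abs_of_nonneg (hy i).1]; exact (hy i).2
  have c3 : ∀ i, |y i ^ 2 / 2| ≤ 1 := fun i => by
    rw [abs_of_nonneg (by positivity)]
    have := pow_le_one₀ (n := 2) (hy i).1 (hy i).2
    linarith
  have X1 := (UnifBounded.mul_left (ι := ι) hS k X).comp ((L 2 1).add (L 0 1))
  exact ((((X1.smul (c := fun _ => 1 / 2) (B := 1 / 2) (by norm_num)).sub
    (((L 2 (3 / 2)).add (L 2 (1 / 2))).smul c2)).add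
    ((((L 4 2).add (L 2 2)).add (L 2 0)).smul c3)).mono le_rfl (Nat.le_succ _)).sub
    ((((((((L 4 5).add (L 0 1)).sub (L 2 3)).add (L 2 1)).sub (L 2 4)).sub (L 2 2)).add
      (L 0 2)).comp D |>.smul c3)

/-! ### Inversion of the leading operator -/

/-- The mean value of `sin ^ (2 n)`. -/
noncomputable def sinMean (n : ℕ) : ℝ := ∏ i ∈ Finset.range n, (2 * (i : ℝ) + 1) / (2 * i + 2)

/-- Half the integral of `sin ^ (2 n + 1)` over `[0, π]`. -/
noncomputable def sinMeanOdd (n : ℕ) : ℝ := ∏ i ∈ Finset.range n, (2 * (i : ℝ) + 2) / (2 * i + 3)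

theorem sinMean_succ (n : ℕ) : sinMean (n + 1) = sinMean n * ((2 * n + 1) / (2 * n + 2)) :=
  Finset.prod_range_succ _ _

theorem sinMean_pos (n : ℕ) : 0 < sinMean n := Finset.prod_pos fun i _ => by positivity

/-- Wallis: even and odd sine integrals are reciprocal up to the factor 2n + 1. So the multiplier
needed to invert the leading operator is again a moment sequence, hence bounded. -/
theorem sinMean_mul_sinMeanOdd (n : ℕ) : (2 * n + 1) * sinMeanOdd n * sinMean n = 1 := by
  induction n with
  | zero => simp [sinMeanOdd, sinMean]
  | succ n ih =>
    rw [sinMean_succ, sinMeanOdd, Finset.prod_range_succ, ← sinMeanOdd]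
    push_cast
    field_simp
    linear_combination (2 * (n : ℝ) + 3) * ih

theorem sinMean_eq_integral (n : ℕ) :
    sinMean n = ∫ θ in (0 : ℝ)..Real.pi, 1 / Real.pi * (Real.sin θ ^ 2) ^ n := by
  simp_rw [← pow_mul]
  rw [intervalIntegral.integral_const_mul, integral_sin_pow_even, sinMean]
  field_simp

theorem sinMeanOdd_eq_integral (n : ℕ) :
    sinMeanOdd n = ∫ θ in (0 : ℝ)..Real.pi, Real.sin θ / 2 * (Real.sin θ ^ 2) ^ n := by
  have : ∀ θ, Real.sin θ / 2 * (Real.sin θ ^ 2) ^ n = 1 / 2 * Real.sin θ ^ (2 * n + 1) := by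
    intro θ; rw [← pow_mul]; ring
  simp_rw [this]
  rw [intervalIntegral.integral_const_mul, integral_sin_pow_odd, sinMeanOdd]
  ring

section
variable {ι : Type*} {S : Set ℝ}

theorem unifBounded_sinMean (hS : Convex ℝ S) (h0 : (0 : ℝ) ∈ S) (k : ℕ) :
    UnifBounded S k k (fun (_ : ι) => mulCoeff sinMean) := by
  have := UnifBounded.of_mulCoeff_integral (ι := ι) hS h0 Real.pi_nonneg
    (w := fun _ => 1 / Real.pi) (g := fun θ => Real.sin θ ^ 2) (by fun_prop) (by fun_prop)
    (fun _ => by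
      rw [abs_of_pos (by positivity), div_le_one Real.pi_pos]
      linarith [Real.pi_gt_three])
    (fun θ _ => ⟨by positivity, Real.sin_sq_le_one θ⟩) k
  simpa only [← sinMean_eq_integral] using this

theorem unifBounded_sinMeanOdd (hS : Convex ℝ S) (h0 : (0 : ℝ) ∈ S) (k : ℕ) :
    UnifBounded S k k (fun (_ : ι) => mulCoeff sinMeanOdd) := by
  have := UnifBounded.of_mulCoeff_integral (ι := ι) hS h0 Real.pi_nonneg
    (w := fun θ => Real.sin θ / 2) (g := fun θ => Real.sin θ ^ 2) (by fun_prop) (by fun_prop)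
    (fun θ => by
      rw [abs_div, abs_two]
      linarith [Real.abs_sin_le_one θ])
    (fun θ _ => ⟨by positivity, Real.sin_sq_le_one θ⟩) k
  simpa only [← sinMeanOdd_eq_integral] using this

end

/-- The leading order of the mean: `F` averaged over the arcsine law on `[0, v]`. -/
noncomputable def arcsineMean (v : ℝ) : ℝ[X] →ₗ[ℝ] ℝ := Polynomial.leval v ∘ₗ mulCoeff sinMean

theorem arcsineMean_monomial (v : ℝ) (n : ℕ) (a : ℝ) :
    arcsineMean v (monomial n a) = sinMean n * a * v ^ n := by
  simp [arcsineMean, mulCoeff_monomial, leval]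

/-- The right inverse of the leading operator on the polynomials of zero mean. -/
noncomputable def solveOp (v : ℝ) (F : ℝ[X]) : ℝ[X] :=
  (2 : ℝ) • mulCoeff sinMeanOdd (divDiff v (mulCoeff sinMean F))

/-- The two Wallis multipliers conjugate the leading operator to multiplication by X - v. Its range
consists of the polynomials that vanish at v, where the divided difference inverts it, and the value
of `mulCoeff sinMean F` at v is the arcsine mean of F. -/
theorem relOp_solveOp (y : ℝ) (F : ℝ[X]) : relOp (fun a => a) y (solveOp (4 * (y * (1 - y))) F) =
    F - C (arcsineMean (4 * (y * (1 - y))) F) := by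
  set v := 4 * (y * (1 - y)) with hv
  have key : ∀ H : ℝ[X], X * mulCoeff (fun n => 1 * n + 1) ((2 : ℝ) • mulCoeff sinMeanOdd H) -
      v • mulCoeff (fun n => 1 * n + 1 / 2) ((2 : ℝ) • mulCoeff sinMeanOdd H) =
      mulCoeff (fun n => 1 / sinMean n) ((X - C v) * H) := by
    intro H
    induction H using Polynomial.induction_on' with
    | add F G hF hG =>
      rw [mul_add, map_add (mulCoeff fun n => 1 / sinMean n), ← hF, ← hG]
      simp only [map_add, smul_add, mul_add]
      abel
    | monomial n a =>
      have h1 := sinMean_mul_sinMeanOdd n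
      have p := (sinMean_pos n).ne'
      have e1 : (1 * (n : ℝ) + 1) * (2 * (sinMeanOdd n * a)) = 1 / sinMean (n + 1) * a := by
        rw [sinMean_succ]
        field_simp
        linear_combination a * h1
      have e2 : v * ((1 * (n : ℝ) + 1 / 2) * (2 * (sinMeanOdd n * a))) =
          1 / sinMean n * (v * a) := by
        field_simp
        linear_combination v * a * h1
      simp only [sub_mul, map_sub, X_mul_monomial, C_mul_monomial, mulCoeff_monomial, smul_monomial,
        smul_eq_mul, e1, e2]
  have inv : ∀ G : ℝ[X], mulCoeff (fun n => 1 / sinMean n) (mulCoeff sinMean G) = G := by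
    intro G
    rw [mulCoeff_comp]
    have : mulCoeff (fun n => 1 / sinMean n * sinMean n) = LinearMap.id :=
      linearMap_eq_of_monomial fun n => by
        simp [mulCoeff_monomial, (sinMean_pos n).ne']
    rw [this]; rfl
  rw [relOp_id, solveOp, key, sub_mul_divDiff, map_sub, inv, mulCoeff_C]
  congr 2
  simp [arcsineMean, leval, sinMean]

theorem unifBounded_solveOp {ι : Type*} {S : Set ℝ} (hS : Convex ℝ S) (h0 : (0 : ℝ) ∈ S)
    {v : ι → ℝ} (hv : ∀ i, v i ∈ S) (k : ℕ) :
    UnifBounded S k (k + 1) (fun i F => solveOp (v i) F) :=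
  ((unifBounded_sinMeanOdd hS h0 k).comp ((UnifBounded.of_divDiff hS hv k).comp
    (unifBounded_sinMean hS h0 (k + 1)))).smul (c := fun _ => 2) (B := 2) (by norm_num)

/-! ### The correction functional -/

/-- The correction to the mean at order `ε ^ 2`. -/
noncomputable def meanCorrection (y : ℝ) : ℝ[X] →ₗ[ℝ] ℝ :=
  Polynomial.leval (4 * (y * (1 - y))) ∘ₗ
    (mulCoeff (fun n => n * (n - 1) / 6) +
      derivative ∘ₗ mulCoeff (fun n => y / 2 - 2 * y ^ 2 / 3 * (2 * n ^ 2 + 1)) +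
      derivative ∘ₗ derivative ∘ₗ mulCoeff (fun n => 2 * y ^ 2 / 3 * (2 * n - 1))) ∘ₗ
    mulCoeff sinMean

theorem meanCorrection_monomial (y : ℝ) (n : ℕ) (a : ℝ) :
    meanCorrection y (monomial n a) = sinMean n * a *
      (n * (n - 1) / 6 * (4 * (y * (1 - y))) ^ n +
        (y / 2 - 2 * y ^ 2 / 3 * (2 * n ^ 2 + 1)) * n * (4 * (y * (1 - y))) ^ (n - 1) +
        2 * y ^ 2 / 3 * (2 * n - 1) * n * (n - 1 : ℕ) * (4 * (y * (1 - y))) ^ (n - 2)) := by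
  simp only [meanCorrection, LinearMap.comp_apply, LinearMap.add_apply, mulCoeff_monomial]
  simp only [derivative_monomial, leval, map_add, LinearMap.coe_mk, AddHom.coe_mk, eval_monomial]
  rw [show n - 1 - 1 = n - 2 by omega]
  ring

theorem meanCorrection_C (y a : ℝ) : meanCorrection y (C a) = 0 := by
  rw [← monomial_zero_left, meanCorrection_monomial]
  simp

/-- Together with vanishing on constants this determines the correction, since every F is its
arcsine mean plus the leading operator applied to `solveOp v F`. The low degrees are separate
because the exponents n - 1 and n - 2 are truncated. -/
theorem meanCorrection_relOp (y : ℝ) (F : ℝ[X]) :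
    meanCorrection y (relOp (fun a => a) y F) =
      -arcsineMean (4 * (y * (1 - y))) ((1 / 6 : ℝ) • relOp (fun a => a ^ 3) y F) := by
  induction F using Polynomial.induction_on' with
  | add F G hF hG => rw [relOp_add, relOp_add, smul_add, map_add, map_add, hF, hG]; ring
  | monomial n a =>
    rw [relOp_id]
    rcases n with _ | _ | n
    · have d : divX (monomial 0 a) = 0 := by rw [monomial_zero_left, divX_C]
      simp only [relOp, d, map_zero, sub_zero, add_zero, smul_zero, mulCoeff_monomial, ← map_add,
        X_mul_monomial, smul_monomial, smul_eq_mul]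
      simp only [map_sub, map_add, map_smul, meanCorrection_monomial, arcsineMean_monomial,
        sinMean_succ, smul_eq_mul]
      simp [sinMean]
      ring
    · simp only [relOp, divX_monomial_succ, mulCoeff_monomial, ← map_add, ← map_sub, X_mul_monomial,
        smul_monomial, smul_eq_mul]
      simp only [map_sub, map_add, map_smul, meanCorrection_monomial, arcsineMean_monomial,
        sinMean_succ, smul_eq_mul]
      simp [sinMean]
      ring
    · simp only [relOp, divX_monomial_succ, mulCoeff_monomial, ← map_add, ← map_sub, X_mul_monomial,
        smul_monomial, smul_eq_mul]
      simp only [map_sub, map_add, map_smul, meanCorrection_monomial, arcsineMean_monomial,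
        sinMean_succ, smul_eq_mul]
      have e1 : n + 1 + 1 + 1 - 1 = n + 2 := rfl
      have e2 : n + 1 + 1 + 1 - 2 = n + 1 := rfl
      have e3 : n + 1 + 1 - 1 = n + 1 := rfl
      have e4 : n + 1 + 1 - 2 = n := rfl
      rw [e1, e2, e3, e4]
      push_cast
      field_simp
      ring

/-- Expansion of the mean of a polynomial, with an error bounded by finitely many derivatives. -/
theorem hermiteExp_expansion {Λ : ℝ} (hΛ : 0 ≤ Λ) : ∃ R, 1 ≤ R ∧ ∃ A, 0 ≤ A ∧ ∀ ε, 0 < ε → ε ≤ Λ →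
    ∀ j : ℕ, ∀ y, y = Real.exp (-ε * (j + 1 / 2)) → ∀ F C, 0 ≤ C →
      PolyBound (Set.Icc 0 R) 12 C F →
      |hermiteExp (Real.exp (-ε)) j F - (arcsineMean (4 * (y * (1 - y))) F +
        ε ^ 2 * meanCorrection y F)| ≤ A * C * ε ^ 4 := by
  set R := Real.exp (4 * Λ) with hR
  have h1 : 1 ≤ R := Real.one_le_exp (by positivity)
  have h2 : Real.exp (2 * Λ) ≤ R := Real.exp_le_exp.2 (by linarith)
  have hS : Convex ℝ (Set.Icc 0 R) := convex_Icc 0 R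
  have hK : IsCompact (Set.Icc 0 R) := isCompact_Icc
  have z : (0 : ℝ) ∈ Set.Icc 0 R := ⟨le_rfl, by linarith⟩
  obtain ⟨A, hA, hA'⟩ := abs_hermiteExp_relOp_le h1 h2 le_rfl
  have hv : ∀ i : Set.Icc (0 : ℝ) 1, 4 * (i.1 * (1 - i.1)) ∈ Set.Icc 0 R := fun i => by
    have := i.2.1; have := i.2.2
    exact ⟨by have : 0 ≤ 1 - i.1 := by linarith
              positivity, by nlinarith [sq_nonneg (1 - 2 * i.1)]⟩
  have hy' : ∀ i : Set.Icc (0 : ℝ) 1, i.1 ∈ Set.Icc (0 : ℝ) 1 := fun i => i.2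
  have solve := fun k => unifBounded_solveOp hS z hv k
  have corr := fun k => (unifBounded_relOp_pow hK hS z hy' k 3).smul (c := fun _ => 1 / 6)
    (B := 1 / 6) (by norm_num)
  -- Count of derivatives: `solveOp` costs one, the cubic operator four (three for its multipliers,
  -- one for `divX`), and the approximate relation needs six. The longest chain is 6 + 1 + 4 + 1 =
  -- 12.
  obtain ⟨A1, hA1, b1⟩ := solve 6
  obtain ⟨A2, hA2, b2⟩ := (solve 6).comp ((corr 7).comp (solve 11))
  obtain ⟨A3, hA3, b3⟩ := (corr 0).comp ((solve 4).comp ((corr 5).comp (solve 9)))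
  refine ⟨R, h1, A * A1 + (A * A2) * Λ ^ 2 + A3, by positivity, fun ε hε hεΛ j y hy F C hC hF => ?_⟩
  have hy0 : y ∈ Set.Icc (0 : ℝ) 1 := by
    rw [hy]
    refine ⟨(Real.exp_pos _).le, Real.exp_le_one_iff.2 ?_⟩
    have : 0 ≤ ε * ((j : ℝ) + 1 / 2) := by positivity
    linarith
  have q0 := Real.exp_pos (-ε)
  have q1 : Real.exp (-ε) < 1 := by simpa using hε
  set v := 4 * (y * (1 - y)) with hvdef
  set G1 := solveOp v F with hG1
  set H := (1 / 6 : ℝ) • relOp (fun a => a ^ 3) y G1 with hH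
  set G2 := solveOp v H with hG2
  -- The relation for G1 replaces the mean of F by its arcsine mean minus ε² times the mean of H;
  -- the relation for G2 replaces the mean of H by its arcsine mean up to O(ε²).
  have i1 := hA' ε hε hεΛ j y hy G1 (A1 * C) (by positivity)
    (b1 ⟨y, hy0⟩ F C hC (hF.mono (by norm_num) le_rfl))
  have i2 := hA' ε hε hεΛ j y hy G2 (A2 * C) (by positivity)
    (b2 ⟨y, hy0⟩ F C hC (hF.mono (by norm_num) le_rfl))
  have i3 : |hermiteExp (Real.exp (-ε)) j ((1 / 6 : ℝ) • relOp (fun a => a ^ 3) y G2)| ≤ A3 * C := by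
    refine abs_hermiteExp_le q0 q1 j fun s hs => ?_
    exact (b3 ⟨y, hy0⟩ F C hC (hF.mono (by norm_num) le_rfl)).eval ⟨hs.1, hs.2.trans h1⟩
  have c1 := meanCorrection_relOp y G1
  rw [hG1, relOp_solveOp, map_sub, hermiteExp_C q0 q1] at i1
  rw [hG2, relOp_solveOp, map_sub, hermiteExp_C q0 q1] at i2
  rw [← hG1, ← hH] at i1
  rw [← hG2] at i2
  rw [hG1, relOp_solveOp, map_sub, meanCorrection_C, ← hG1, ← hH, sub_zero, ← hvdef] at c1
  rw [← hvdef] at i1 i2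
  rw [c1]
  set e0 := hermiteExp (Real.exp (-ε)) j F
  set e1 := hermiteExp (Real.exp (-ε)) j H
  set e2 := hermiteExp (Real.exp (-ε)) j ((1 / 6 : ℝ) • relOp (fun a => a ^ 3) y G2)
  have i2' : ε ^ 2 * |e1 - arcsineMean v H + ε ^ 2 * e2| ≤ Λ ^ 2 * (A * (A2 * C) * ε ^ 4) := by
    have : ε ^ 2 ≤ Λ ^ 2 := by gcongr
    exact mul_le_mul this i2 (abs_nonneg _) (by positivity)
  have i3' : ε ^ 4 * |e2| ≤ ε ^ 4 * (A3 * C) := by gcongr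
  rw [← abs_of_nonneg (show 0 ≤ ε ^ 2 by positivity), ← abs_mul,
    abs_of_nonneg (show 0 ≤ ε ^ 2 by positivity)] at i2'
  rw [← abs_of_nonneg (show 0 ≤ ε ^ 4 by positivity), ← abs_mul,
    abs_of_nonneg (show 0 ≤ ε ^ 4 by positivity)] at i3'
  calc _ = |(e0 - arcsineMean v F + ε ^ 2 * e1) - ε ^ 2 * (e1 - arcsineMean v H + ε ^ 2 * e2) +
        ε ^ 4 * e2| := by congr 1; ring
    _ ≤ _ := (abs_add_le _ _).trans (add_le_add_left (abs_sub _ _) _)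
    _ ≤ _ := by linarith

end DiscreteQGUE

namespace DiscreteQGUE

open Polynomial

/-! ### The midpoint rule -/

/-- The defect is differentiated in the half-width σ until only g2 is left. It and its derivatives
vanish at σ = 0, so three integrations give σ³. -/
theorem midpoint_first_order {G g0 g1 g2 : ℝ → ℝ} (hG : ∀ x, HasDerivAt G (g0 x) x)
    (h0 : ∀ x, HasDerivAt g0 (g1 x) x) (h1 : ∀ x, HasDerivAt g1 (g2 x) x) {c e M : ℝ} (hM : 0 ≤ M)
    (he : 0 ≤ e) (hb : ∀ x ∈ Set.Icc (c - e) (c + e), |g2 x| ≤ M) :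
    |G (c + e) - G (c - e) - 2 * e * g0 c| ≤ 2 * M * e ^ 3 := by
  have plus : ∀ {f f' : ℝ → ℝ}, (∀ x, HasDerivAt f (f' x) x) → ∀ σ,
      HasDerivAt (fun σ => f (c + σ)) (f' (c + σ)) σ := fun h σ => (h _).comp_const_add c σ
  have minus : ∀ {f f' : ℝ → ℝ}, (∀ x, HasDerivAt f (f' x) x) → ∀ σ,
      HasDerivAt (fun σ => f (c - σ)) (-f' (c - σ)) σ := fun h σ => (h _).comp_const_sub c σ
  have s2 := abs_le_mul_pow_succ (e := e) (M := 2 * M) (k := 0) (by positivity)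
    (f := fun σ => g1 (c + σ) - g1 (c - σ)) (f' := fun σ => g2 (c + σ) + g2 (c - σ))
    (fun σ => ((plus h1 σ).sub (minus h1 σ)).congr_deriv (by ring)) (by simp) (fun σ hσ => by
      have b1 := hb (c + σ) ⟨by linarith [hσ.1], by linarith [hσ.2]⟩
      have b2 := hb (c - σ) ⟨by linarith [hσ.2], by linarith [hσ.1]⟩
      rw [pow_zero]
      exact (abs_add_le _ _).trans (by linarith))
  have s1 := abs_le_mul_pow_succ (by positivity)
    (f := fun σ => g0 (c + σ) + g0 (c - σ) - 2 * g0 c)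
    (fun σ => (((plus h0 σ).add (minus h0 σ)).sub_const (2 * g0 c)).congr_deriv
      (g' := g1 (c + σ) - g1 (c - σ)) (by ring)) (by simp; ring) s2
  have s0 := abs_le_mul_pow_succ (by positivity)
    (f := fun σ => G (c + σ) - G (c - σ) - 2 * σ * g0 c)
    (fun σ => (((plus hG σ).sub (minus hG σ)).sub
      (((hasDerivAt_id σ).const_mul 2).mul_const (g0 c))).congr_deriv
      (g' := g0 (c + σ) + g0 (c - σ) - 2 * g0 c) (by ring)) (by simp) s1
  exact s0 e ⟨he, le_rfl⟩

/-- The term of third order in e is written as a difference of g1 at the ends of the cell instead of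
g2 at its centre, so that it telescopes over adjacent cells. For e = 1/(2N) the factor e²/6 is
1/(24N²). -/
theorem midpoint_second_order {G g0 g1 g2 g3 g4 : ℝ → ℝ} (hG : ∀ x, HasDerivAt G (g0 x) x)
    (h0 : ∀ x, HasDerivAt g0 (g1 x) x) (h1 : ∀ x, HasDerivAt g1 (g2 x) x)
    (h2 : ∀ x, HasDerivAt g2 (g3 x) x) (h3 : ∀ x, HasDerivAt g3 (g4 x) x) {c e M : ℝ} (hM : 0 ≤ M)
    (he : 0 ≤ e) (hb : ∀ x ∈ Set.Icc (c - e) (c + e), |g4 x| ≤ M) :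
    |G (c + e) - G (c - e) - 2 * e * g0 c - e ^ 2 / 6 * (g1 (c + e) - g1 (c - e))| ≤
      3 * M * e ^ 5 := by
  have plus : ∀ {f f' : ℝ → ℝ}, (∀ x, HasDerivAt f (f' x) x) → ∀ σ,
      HasDerivAt (fun σ => f (c + σ)) (f' (c + σ)) σ := fun h σ => (h _).comp_const_add c σ
  have minus : ∀ {f f' : ℝ → ℝ}, (∀ x, HasDerivAt f (f' x) x) → ∀ σ,
      HasDerivAt (fun σ => f (c - σ)) (-f' (c - σ)) σ := fun h σ => (h _).comp_const_sub c σ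
  have B : ∀ σ ∈ Set.Icc 0 e, |g4 (c + σ) + g4 (c - σ)| ≤ 2 * M := fun σ hσ => by
    have b1 := hb (c + σ) ⟨by linarith [hσ.1], by linarith [hσ.2]⟩
    have b2 := hb (c - σ) ⟨by linarith [hσ.2], by linarith [hσ.1]⟩
    exact (abs_add_le _ _).trans (by linarith)
  have s4 := abs_le_mul_pow_succ (e := e) (M := 2 * M) (k := 0) (by positivity)
    (f := fun σ => g3 (c + σ) - g3 (c - σ)) (f' := fun σ => g4 (c + σ) + g4 (c - σ))
    (fun σ => ((plus h3 σ).sub (minus h3 σ)).congr_deriv (by ring)) (by simp) (fun σ hσ => by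
      rw [pow_zero, mul_one]; exact B σ hσ)
  have hid := fun σ : ℝ => hasDerivAt_id' σ
  have s2 := abs_le_mul_pow_succ (e := e) (M := 3 * M) (k := 2) (by positivity)
    (f := fun σ => 2 / 3 * (g1 (c + σ) - g1 (c - σ)) - 2 / 3 * σ * (g2 (c + σ) + g2 (c - σ)) -
      σ ^ 2 / 6 * (g3 (c + σ) - g3 (c - σ)))
    (f' := fun σ => -σ * (g3 (c + σ) - g3 (c - σ)) - σ ^ 2 / 6 * (g4 (c + σ) + g4 (c - σ)))
    (fun σ => (((((plus h1 σ).sub (minus h1 σ)).const_mul (2 / 3)).sub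
      (((hid σ).const_mul (2 / 3)).mul ((plus h2 σ).add (minus h2 σ)))).sub
      ((((hid σ).pow 2).div_const 6).mul ((plus h3 σ).sub (minus h3 σ)))).congr_deriv (by
        simp only [Pi.pow_apply, Pi.sub_apply, Pi.add_apply]; push_cast; ring))
    (by simp) (fun σ hσ => by
      have b1 := s4 σ hσ
      have b2 := B σ hσ
      have hσ0 := hσ.1
      refine (abs_sub _ _).trans ?_
      rw [abs_mul, abs_mul, abs_neg, abs_of_nonneg hσ0,
        abs_of_nonneg (show 0 ≤ σ ^ 2 / 6 by positivity)]
      have c1 : σ * |g3 (c + σ) - g3 (c - σ)| ≤ σ * (2 * M * σ ^ (0 + 1)) := by gcongr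
      have c2 : σ ^ 2 / 6 * |g4 (c + σ) + g4 (c - σ)| ≤ σ ^ 2 / 6 * (2 * M) := by gcongr
      have : 0 ≤ M * σ ^ 2 := by positivity
      calc _ ≤ σ * (2 * M * σ ^ (0 + 1)) + σ ^ 2 / 6 * (2 * M) := add_le_add c1 c2
        _ ≤ _ := by ring_nf; linarith)
  have s1 := abs_le_mul_pow_succ (by positivity)
    (f := fun σ => g0 (c + σ) + g0 (c - σ) - 2 * g0 c - σ / 3 * (g1 (c + σ) - g1 (c - σ)) -
      σ ^ 2 / 6 * (g2 (c + σ) + g2 (c - σ)))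
    (fun σ => (((((plus h0 σ).add (minus h0 σ)).sub_const (2 * g0 c)).sub
      (((hid σ).div_const 3).mul ((plus h1 σ).sub (minus h1 σ)))).sub
      ((((hid σ).pow 2).div_const 6).mul ((plus h2 σ).add (minus h2 σ)))).congr_deriv
      (g' := 2 / 3 * (g1 (c + σ) - g1 (c - σ)) - 2 / 3 * σ * (g2 (c + σ) + g2 (c - σ)) -
        σ ^ 2 / 6 * (g3 (c + σ) - g3 (c - σ))) (by
        simp only [Pi.pow_apply, Pi.sub_apply, Pi.add_apply]; push_cast; ring))
    (by simp; ring) s2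
  have s0 := abs_le_mul_pow_succ (by positivity)
    (f := fun σ => G (c + σ) - G (c - σ) - 2 * σ * g0 c - σ ^ 2 / 6 * (g1 (c + σ) - g1 (c - σ)))
    (fun σ => ((((plus hG σ).sub (minus hG σ)).sub
      (((hid σ).const_mul 2).mul_const (g0 c))).sub
      ((((hid σ).pow 2).div_const 6).mul ((plus h1 σ).sub (minus h1 σ)))).congr_deriv
      (g' := g0 (c + σ) + g0 (c - σ) - 2 * g0 c - σ / 3 * (g1 (c + σ) - g1 (c - σ)) -
      σ ^ 2 / 6 * (g2 (c + σ) + g2 (c - σ))) (by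
        simp only [Pi.pow_apply, Pi.sub_apply]; push_cast; ring))
    (by simp) s1
  exact s0 e ⟨he, le_rfl⟩

theorem midpoint_interval {N : ℕ} (hN : 1 ≤ N) {j : ℕ} (hj : j < N) {x : ℝ}
    (hx : x ∈ Set.Icc (((j : ℝ) + 1 / 2) / N - 1 / (2 * N)) (((j : ℝ) + 1 / 2) / N + 1 / (2 * N))) :
    x ∈ Set.Icc (0 : ℝ) 1 := by
  have hN' : (0 : ℝ) < N := by exact_mod_cast hN
  have hj' : (j : ℝ) + 1 ≤ N := by exact_mod_cast hj
  have e1 : ((j : ℝ) + 1 / 2) / N - 1 / (2 * N) = j / N := by field_simp; ring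
  have e2 : ((j : ℝ) + 1 / 2) / N + 1 / (2 * N) = (j + 1) / N := by field_simp; ring
  rw [e1, e2] at hx
  exact ⟨le_trans (by positivity) hx.1, hx.2.trans ((div_le_one hN').2 hj')⟩

theorem sum_midpoint_telescope (N : ℕ) (hN : 1 ≤ N) (f : ℝ → ℝ) :
    ∑ j ∈ Finset.range N, (f (((j : ℝ) + 1 / 2) / N + 1 / (2 * N)) -
      f (((j : ℝ) + 1 / 2) / N - 1 / (2 * N))) = f 1 - f 0 := by
  have hN' : (N : ℝ) ≠ 0 := by positivity
  have := Finset.sum_range_sub (fun j : ℕ => f (j / N)) N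
  rw [div_self hN', Nat.cast_zero, zero_div] at this
  rw [← this]
  refine Finset.sum_congr rfl fun j _ => ?_
  congr 2 <;> (push_cast; field_simp; ring)

theorem sum_midpoint_first_order {G g0 g1 g2 : ℝ → ℝ} (hG : ∀ x, HasDerivAt G (g0 x) x)
    (h0 : ∀ x, HasDerivAt g0 (g1 x) x) (h1 : ∀ x, HasDerivAt g1 (g2 x) x) {M : ℝ} (hM : 0 ≤ M)
    (hb : ∀ x ∈ Set.Icc (0 : ℝ) 1, |g2 x| ≤ M) {N : ℕ} (hN : 1 ≤ N) :
    |1 / (N : ℝ) * ∑ j ∈ Finset.range N, g0 (((j : ℝ) + 1 / 2) / N) - (G 1 - G 0)| ≤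
      M / N ^ 2 := by
  have hN' : (0 : ℝ) < N := by exact_mod_cast hN
  rw [← sum_midpoint_telescope N hN, Finset.mul_sum, ← Finset.sum_sub_distrib]
  refine (Finset.abs_sum_le_sum_abs _ _).trans ?_
  have : ∀ j ∈ Finset.range N, |1 / (N : ℝ) * g0 (((j : ℝ) + 1 / 2) / N) -
      (G (((j : ℝ) + 1 / 2) / N + 1 / (2 * N)) - G (((j : ℝ) + 1 / 2) / N - 1 / (2 * N)))| ≤
      M / N ^ 3 := fun j hj => by
    have := midpoint_first_order hG h0 h1 hM (e := 1 / (2 * N)) (c := ((j : ℝ) + 1 / 2) / N)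
      (by positivity) (fun x hx => hb x (midpoint_interval hN (Finset.mem_range.1 hj) hx))
    rw [abs_sub_comm, show (1 : ℝ) / N = 2 * (1 / (2 * N)) by field_simp]
    refine this.trans ?_
    rw [show 2 * M * (1 / (2 * (N : ℝ))) ^ 3 = (1 / 4) * (M / N ^ 3) by field_simp; ring]
    have : 0 ≤ M / (N : ℝ) ^ 3 := by positivity
    linarith
  refine (Finset.sum_le_sum this).trans_eq ?_
  rw [Finset.sum_const, Finset.card_range, nsmul_eq_mul]
  field_simp

theorem sum_midpoint_second_order {G g0 g1 g2 g3 g4 : ℝ → ℝ} (hG : ∀ x, HasDerivAt G (g0 x) x)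
    (h0 : ∀ x, HasDerivAt g0 (g1 x) x) (h1 : ∀ x, HasDerivAt g1 (g2 x) x)
    (h2 : ∀ x, HasDerivAt g2 (g3 x) x) (h3 : ∀ x, HasDerivAt g3 (g4 x) x) {M : ℝ} (hM : 0 ≤ M)
    (hb : ∀ x ∈ Set.Icc (0 : ℝ) 1, |g4 x| ≤ M) {N : ℕ} (hN : 1 ≤ N) :
    |1 / (N : ℝ) * ∑ j ∈ Finset.range N, g0 (((j : ℝ) + 1 / 2) / N) -
      (G 1 - G 0 - 1 / 24 * (g1 1 - g1 0) / N ^ 2)| ≤ M / N ^ 4 := by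
  have hN' : (0 : ℝ) < N := by exact_mod_cast hN
  rw [← sum_midpoint_telescope N hN, ← sum_midpoint_telescope N hN, Finset.mul_sum, Finset.mul_sum,
    Finset.sum_div, ← Finset.sum_sub_distrib, ← Finset.sum_sub_distrib]
  refine (Finset.abs_sum_le_sum_abs _ _).trans ?_
  have : ∀ j ∈ Finset.range N, |1 / (N : ℝ) * g0 (((j : ℝ) + 1 / 2) / N) -
      (G (((j : ℝ) + 1 / 2) / N + 1 / (2 * N)) - G (((j : ℝ) + 1 / 2) / N - 1 / (2 * N)) -
      1 / 24 * (g1 (((j : ℝ) + 1 / 2) / N + 1 / (2 * N)) -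
        g1 (((j : ℝ) + 1 / 2) / N - 1 / (2 * N))) / N ^ 2)| ≤ M / N ^ 5 := fun j hj => by
    have := midpoint_second_order hG h0 h1 h2 h3 hM (e := 1 / (2 * N)) (c := ((j : ℝ) + 1 / 2) / N)
      (by positivity) (fun x hx => hb x (midpoint_interval hN (Finset.mem_range.1 hj) hx))
    rw [abs_sub_comm]
    rw [show 3 * M * (1 / (2 * (N : ℝ))) ^ 5 = (3 / 32) * (M / N ^ 5) by field_simp; norm_num] at this
    have h : 0 ≤ M / (N : ℝ) ^ 5 := by positivity
    refine (le_of_eq ?_).trans (this.trans (by linarith))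
    congr 1
    field_simp
    ring
  refine (Finset.sum_le_sum this).trans_eq ?_
  rw [Finset.sum_const, Finset.card_range, nsmul_eq_mul]
  field_simp

/-! ### Sums over the index of the orthogonal polynomial -/

theorem UnifBounded.of_comp {ι : Type*} {S : Set ℝ} (hS : IsCompact S) {W : ℝ[X]}
    (hW : ∀ s ∈ S, W.eval s ∈ S) (k : ℕ) : UnifBounded S k k (fun (_ : ι) F => F.comp W) := by
  suffices ∀ k : ℕ, ∃ A, 0 ≤ A ∧ ∀ F C, 0 ≤ C → PolyBound S k C F →
      PolyBound S k (A * C) (F.comp W) by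
    obtain ⟨A, hA, hA'⟩ := this k
    exact ⟨A, hA, fun _ => hA'⟩
  intro k
  induction k with
  | zero =>
    refine ⟨1, zero_le_one, fun F C hC hF i hi s hs => ?_⟩
    obtain rfl : i = 0 := by omega
    rw [one_mul, Function.iterate_zero, _root_.id, eval_comp]
    exact hF.eval (hW s hs)
  | succ k ih =>
    obtain ⟨A, hA, hA'⟩ := ih
    obtain ⟨B, hB, hB'⟩ := UnifBounded.mul_left (ι := Unit) hS k (derivative W)
    refine ⟨A + B * A, by positivity, fun F C hC hF => PolyBound.succ_iff.2 ⟨?_, ?_⟩⟩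
    · refine (hA' F C hC (hF.mono (by omega) le_rfl)).mono (Nat.zero_le _)
        (mul_le_mul_of_nonneg_right ?_ hC)
      have : 0 ≤ B * A := by positivity
      linarith
    · rw [derivative_comp]
      refine (hB' () _ (A * C) (by positivity) (hA' _ C hC (PolyBound.succ_iff.1 hF).2)).mono
        le_rfl ?_
      have : 0 ≤ A * C := by positivity
      rw [add_mul, mul_assoc]; linarith

/-- The derivative along `τ ↦ exp (-lam τ)`. -/
noncomputable def expDeriv (lam : ℝ) (P : ℝ[X]) : ℝ[X] := (-lam) • (X * derivative P)

theorem hasDerivAt_eval_exp (lam : ℝ) (P : ℝ[X]) (τ : ℝ) :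
    HasDerivAt (fun τ => P.eval (Real.exp (-lam * τ)))
      ((expDeriv lam P).eval (Real.exp (-lam * τ))) τ := by
  have h : HasDerivAt (fun τ => Real.exp (-lam * τ)) (Real.exp (-lam * τ) * (-lam)) τ := by
    simpa using ((hasDerivAt_id τ).const_mul (-lam)).exp
  refine ((P.hasDerivAt _).comp τ h).congr_deriv ?_
  simp [expDeriv]; ring

theorem unifBounded_expDeriv {ι : Type*} {S : Set ℝ} (hS : IsCompact S) (lam : ℝ) (k : ℕ) :
    UnifBounded S k (k + 1) (fun (_ : ι) => expDeriv lam) :=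
  ((UnifBounded.mul_left (ι := ι) hS k X).comp (UnifBounded.of_derivative k)).smul
    (c := fun _ => -lam) (B := |lam|) (fun _ => (abs_neg lam).le)

/-- The variable `4 y (1 - y)` as a polynomial in `y`. -/
noncomputable def varPoly : ℝ[X] := C 4 * (X * (1 - X))

theorem eval_varPoly (y : ℝ) : varPoly.eval y = 4 * (y * (1 - y)) := by simp [varPoly]

/-- The leading order of the mean as a polynomial in `y`. -/
noncomputable def meanPoly (F : ℝ[X]) : ℝ[X] := (mulCoeff sinMean F).comp varPoly

theorem eval_meanPoly (F : ℝ[X]) (y : ℝ) :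
    (meanPoly F).eval y = arcsineMean (4 * (y * (1 - y))) F := by
  simp [meanPoly, eval_comp, eval_varPoly, arcsineMean, leval]

/-- The correction to the mean as a polynomial in `y`. -/
noncomputable def correctionPoly (F : ℝ[X]) : ℝ[X] :=
  let B := mulCoeff sinMean F
  (1 / 6 : ℝ) • (mulCoeff (fun n => 1 * n + 0) (mulCoeff (fun n => 1 * n + -1) B)).comp varPoly +
    (1 / 2 : ℝ) • (X * (derivative B).comp varPoly) -
    (2 / 3 : ℝ) • (X * (X * (derivative ((2 : ℝ) • mulCoeff (fun n => (1 * n + 0) ^ 2) B +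
      B)).comp varPoly)) +
    (2 / 3 : ℝ) • (X * (X * (derivative (derivative (mulCoeff (fun n => 2 * n + -1)
      B))).comp varPoly))

theorem eval_correctionPoly (F : ℝ[X]) (y : ℝ) :
    (correctionPoly F).eval y = meanCorrection y F := by
  induction F using Polynomial.induction_on' with
  | add F G hF hG =>
    rw [map_add, ← hF, ← hG]
    simp only [correctionPoly, map_add, add_comp, smul_add, mul_add, eval_add, eval_sub]
    ring
  | monomial n a =>
    rw [meanCorrection_monomial]
    simp only [correctionPoly, mulCoeff_monomial, derivative_add, derivative_smul, eval_smul,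
      derivative_monomial, eval_comp, eval_varPoly, eval_mul, eval_X, eval_add, eval_sub,
      eval_monomial, smul_eq_mul]
    rw [show n - 1 - 1 = n - 2 by omega]
    ring

theorem varPoly_mem {y : ℝ} (hy : y ∈ Set.Icc (0 : ℝ) 1) : varPoly.eval y ∈ Set.Icc (0 : ℝ) 1 := by
  rw [eval_varPoly]
  have h1 := hy.1
  have h2 := hy.2
  have h3 : 0 ≤ 1 - y := by linarith
  exact ⟨by positivity, by nlinarith [sq_nonneg (1 - 2 * y)]⟩

theorem unifBounded_meanPoly {ι : Type*} (k : ℕ) :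
    UnifBounded (Set.Icc 0 1) k k (fun (_ : ι) => meanPoly) :=
  (UnifBounded.of_comp isCompact_Icc (fun _ => varPoly_mem) k).comp
    (unifBounded_sinMean (convex_Icc 0 1) ⟨le_rfl, zero_le_one⟩ k)

theorem unifBounded_correctionPoly {ι : Type*} (k : ℕ) :
    UnifBounded (Set.Icc 0 1) k (k + 3) (fun (_ : ι) => correctionPoly) := by
  have hK : IsCompact (Set.Icc (0 : ℝ) 1) := isCompact_Icc
  have B := unifBounded_sinMean (ι := ι) (convex_Icc (0 : ℝ) 1) ⟨le_rfl, zero_le_one⟩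
  have co := UnifBounded.of_comp (ι := ι) hK (fun _ => varPoly_mem)
  have lin := fun c d : ℝ => UnifBounded.of_mulCoeff_linear (ι := ι) hK c d
  have sq := UnifBounded.of_mulCoeff_linear_pow (ι := ι) hK 1 0 (k + 1) 2
  have mX := UnifBounded.mul_left (ι := ι) hK k X
  have dd := UnifBounded.of_derivative (ι := ι) (S := Set.Icc (0 : ℝ) 1)
  have t1 := (((co k).comp ((lin 1 0 k).comp ((lin 1 (-1) (k + 1)).comp (B (k + 2))))).smul
    (c := fun _ => 1 / 6) (B := 1 / 6) (by norm_num)).mono le_rfl (show k + 2 ≤ k + 3 by omega)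
  have t2 := ((mX.comp ((co k).comp ((dd k).comp (B (k + 1))))).smul
    (c := fun _ => 1 / 2) (B := 1 / 2) (by norm_num)).mono le_rfl (show k + 1 ≤ k + 3 by omega)
  have i3 := ((sq.comp (B (k + 3))).smul (c := fun _ => 2) (B := 2) (by norm_num)).add
    ((B (k + 1)).mono le_rfl (show k + 1 ≤ k + 3 by omega))
  have t3 := (mX.comp (mX.comp ((co k).comp ((dd k).comp i3)))).smul
    (c := fun _ => 2 / 3) (B := 2 / 3) (by norm_num)
  have t4 := (mX.comp (mX.comp ((co k).comp ((dd k).comp ((dd (k + 1)).comp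
    ((lin 2 (-1) (k + 2)).comp (B (k + 3)))))))).smul
    (c := fun _ => 2 / 3) (B := 2 / 3) (by norm_num)
  exact ((t1.add t2).sub t3).add t4

/-- The limit of the mean of `F(x²)` against the density. -/
noncomputable def limitMean (lam : ℝ) (F : ℝ[X]) : ℝ :=
  ∫ τ in (0 : ℝ)..1, (meanPoly F).eval (Real.exp (-lam * τ))

/-- The coefficient of `N⁻²` in the mean of `F(x²)` against the density. -/
noncomputable def limitCorrection (lam : ℝ) (F : ℝ[X]) : ℝ :=
  lam ^ 2 * (∫ τ in (0 : ℝ)..1, (correctionPoly F).eval (Real.exp (-lam * τ))) -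
    1 / 24 * ((expDeriv lam (meanPoly F)).eval (Real.exp (-lam)) -
      (expDeriv lam (meanPoly F)).eval 1)

theorem hasDerivAt_integral_eval_exp (lam : ℝ) (P : ℝ[X]) (x : ℝ) :
    HasDerivAt (fun x => ∫ τ in (0 : ℝ)..x, P.eval (Real.exp (-lam * τ)))
      (P.eval (Real.exp (-lam * x))) x := by
  have hc : Continuous fun τ => P.eval (Real.exp (-lam * τ)) := by fun_prop
  exact intervalIntegral.integral_hasDerivAt_right (hc.intervalIntegrable _ _)
    (hc.stronglyMeasurableAtFilter _ _) hc.continuousAt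

/-- With τ = (j+1/2)/N one has y = e^{-λτ}, so the half-integer shift turns the sum over j into a
midpoint rule. The arcsine mean is summed to second order; the correction already carries (λ/N)², so
first order suffices for it. -/
theorem sum_hermiteExp_expansion {lam : ℝ} (hlam : 0 < lam) : ∃ R, 1 ≤ R ∧ ∃ A, 0 ≤ A ∧
    ∀ N : ℕ, 1 ≤ N → ∀ F C, 0 ≤ C → PolyBound (Set.Icc 0 R) 12 C F →
      |1 / (N : ℝ) * ∑ j ∈ Finset.range N, hermiteExp (Real.exp (-(lam / N))) j F -
        (limitMean lam F + limitCorrection lam F / N ^ 2)| ≤ A * C / N ^ 4 := by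
  obtain ⟨R, hR, A, hA, key⟩ := hermiteExp_expansion hlam.le
  have hK : IsCompact (Set.Icc (0 : ℝ) 1) := isCompact_Icc
  have De := unifBounded_expDeriv (ι := Unit) hK lam
  obtain ⟨A1, hA1, b1⟩ := (De 0).comp ((De 1).comp ((De 2).comp ((De 3).comp
    (unifBounded_meanPoly (ι := Unit) 4))))
  obtain ⟨A2, hA2, b2⟩ := (De 0).comp ((De 1).comp (unifBounded_correctionPoly (ι := Unit) 2))
  refine ⟨R, hR, A * lam ^ 4 + A1 + lam ^ 2 * A2, by positivity, fun N hN F C hC hF => ?_⟩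
  have hN' : (0 : ℝ) < N := by exact_mod_cast hN
  have hF1 : PolyBound (Set.Icc 0 1) 12 C F := hF.subset (Set.Icc_subset_Icc_right hR)
  have mem : ∀ x ∈ Set.Icc (0 : ℝ) 1, Real.exp (-lam * x) ∈ Set.Icc (0 : ℝ) 1 := fun x hx => by
    refine ⟨(Real.exp_pos _).le, Real.exp_le_one_iff.2 ?_⟩
    have := mul_nonneg hlam.le hx.1
    linarith
  set P := meanPoly F
  set Q := correctionPoly F
  have m1 := sum_midpoint_second_order (hasDerivAt_integral_eval_exp lam P)
    (hasDerivAt_eval_exp lam P) (hasDerivAt_eval_exp lam _) (hasDerivAt_eval_exp lam _)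
    (hasDerivAt_eval_exp lam _) (M := A1 * C) (by positivity)
    (fun x hx => (b1 () F C hC (hF1.mono (by norm_num) le_rfl)).eval (mem x hx)) hN
  have m2 := sum_midpoint_first_order (hasDerivAt_integral_eval_exp lam Q)
    (hasDerivAt_eval_exp lam Q) (hasDerivAt_eval_exp lam _) (M := A2 * C) (by positivity)
    (fun x hx => (b2 () F C hC (hF1.mono (by norm_num) le_rfl)).eval (mem x hx)) hN
  rw [intervalIntegral.integral_same, sub_zero] at m1 m2
  have m0 : |1 / (N : ℝ) * ∑ j ∈ Finset.range N, (hermiteExp (Real.exp (-(lam / N))) j F -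
      (P.eval (Real.exp (-lam * ((j + 1 / 2) / N))) +
        (lam / N) ^ 2 * Q.eval (Real.exp (-lam * ((j + 1 / 2) / N)))))| ≤
      A * C * (lam / N) ^ 4 := by
    rw [abs_mul, abs_of_pos (by positivity)]
    have : ∀ j ∈ Finset.range N, |hermiteExp (Real.exp (-(lam / N))) j F -
      (P.eval (Real.exp (-lam * ((j + 1 / 2) / N))) +
        (lam / N) ^ 2 * Q.eval (Real.exp (-lam * ((j + 1 / 2) / N))))| ≤
        A * C * (lam / N) ^ 4 := fun j _ => by
      rw [eval_meanPoly, eval_correctionPoly]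
      refine key (lam / N) (by positivity) (div_le_self hlam.le (by exact_mod_cast hN)) j _ ?_ F C
        hC hF
      congr 1; field_simp
    have := (Finset.abs_sum_le_sum_abs _ _).trans (Finset.sum_le_sum this)
    rw [Finset.sum_const, Finset.card_range, nsmul_eq_mul] at this
    rw [one_div, inv_mul_le_iff₀ hN']
    exact this
  rw [Finset.sum_sub_distrib, Finset.sum_add_distrib, ← Finset.mul_sum] at m0
  set S0 := ∑ j ∈ Finset.range N, hermiteExp (Real.exp (-(lam / N))) j F
  set S1 := ∑ j ∈ Finset.range N, P.eval (Real.exp (-lam * ((j + 1 / 2) / N)))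
  set S2 := ∑ j ∈ Finset.range N, Q.eval (Real.exp (-lam * ((j + 1 / 2) / N)))
  have m2' : |(lam / N) ^ 2 * (1 / N * S2 - ∫ τ in (0 : ℝ)..1, Q.eval (Real.exp (-lam * τ)))| ≤
      (lam / N) ^ 2 * (A2 * C / N ^ 2) := by
    rw [abs_mul, abs_of_nonneg (by positivity)]
    gcongr
  simp only [mul_one, mul_zero, Real.exp_zero] at m1
  rw [limitMean, limitCorrection]
  calc _ = |1 / N * (S0 - (S1 + (lam / N) ^ 2 * S2)) + (1 / N * S1 -
        ((∫ τ in (0 : ℝ)..1, P.eval (Real.exp (-lam * τ))) -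
          1 / 24 * ((expDeriv lam P).eval (Real.exp (-lam)) - (expDeriv lam P).eval 1) / N ^ 2)) +
        (lam / N) ^ 2 * (1 / N * S2 - ∫ τ in (0 : ℝ)..1, Q.eval (Real.exp (-lam * τ)))| := by
        congr 1; ring
    _ ≤ _ := abs_add_three _ _ _
    _ ≤ A * C * (lam / N) ^ 4 + A1 * C / N ^ 4 + (lam / N) ^ 2 * (A2 * C / N ^ 2) :=
        add_le_add (add_le_add m0 m1) m2'
    _ = _ := by ring

end DiscreteQGUE

namespace DiscreteQGUE

open MeasureTheory Set

/-! ### The region of integration -/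

/-- The pairs `(x, t)` with `t < 1 - exp (-lam)` and `x ^ 2 < 4 t (1 - t)`. -/
def arcRegion (lam : ℝ) : Set (ℝ × ℝ) :=
  {p | p.2 < 1 - Real.exp (-lam) ∧ p.1 ^ 2 < 4 * p.2 * (1 - p.2)}

theorem measurableSet_arcRegion (lam : ℝ) : MeasurableSet (arcRegion lam) :=
  (measurableSet_lt measurable_snd measurable_const).inter
    (measurableSet_lt (f := fun p : ℝ × ℝ => p.1 ^ 2) (g := fun p => 4 * p.2 * (1 - p.2))
      (by fun_prop) (by fun_prop))

/-- Both sides say |2t - 1| < √(1 - x²), apart from t < 1 - e^{-λ}. Here the region is sliced at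
fixed x, in `mem_arcRegion_iff` at fixed t; Fubini exchanges the two. -/
theorem mem_tRange_iff (lam x t : ℝ) : t ∈ tRange lam x ↔ (x, t) ∈ arcRegion lam := by
  have h : (1 / 2 - xStar x < t ∧ t < 1 / 2 + xStar x) ↔ x ^ 2 < 4 * t * (1 - t) := by
    have : (1 / 2 - xStar x < t ∧ t < 1 / 2 + xStar x) ↔ |2 * t - 1| < √(1 - x ^ 2) := by
      rw [abs_lt, xStar]
      constructor <;> rintro ⟨h1, h2⟩ <;> constructor <;> linarith
    rw [this, Real.lt_sqrt (abs_nonneg _), sq_abs]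
    constructor <;> intro h <;> linarith
  simp only [tRange, arcRegion, mem_Ioo, lt_min_iff, mem_ofPred_eq, ← h]
  tauto

/-- The half-width `2 √(t (1 - t))` of the section of the region. -/
noncomputable def arcWidth (t : ℝ) : ℝ := 2 * √(t * (1 - t))

theorem arcWidth_sq {t : ℝ} (h0 : 0 ≤ t) (h1 : t ≤ 1) : arcWidth t ^ 2 = 4 * t * (1 - t) := by
  have : 0 ≤ t * (1 - t) := mul_nonneg h0 (by linarith)
  rw [arcWidth, mul_pow, Real.sq_sqrt this]; ring

theorem arcWidth_pos {t : ℝ} (h0 : 0 < t) (h1 : t < 1) : 0 < arcWidth t := by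
  have : 0 < t * (1 - t) := mul_pos h0 (by linarith)
  unfold arcWidth; positivity

theorem arcWidth_le_one {t : ℝ} (h0 : 0 ≤ t) (h1 : t ≤ 1) : arcWidth t ≤ 1 := by
  have := arcWidth_sq h0 h1
  have h : 0 ≤ arcWidth t := by unfold arcWidth; positivity
  nlinarith [sq_nonneg (2 * t - 1)]

theorem mem_arcRegion_iff {lam : ℝ} (x t : ℝ) : (x, t) ∈ arcRegion lam ↔
    t ∈ Ioo 0 (1 - Real.exp (-lam)) ∧ x ∈ Ioo (-arcWidth t) (arcWidth t) := by
  have he := Real.exp_pos (-lam)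
  constructor
  · rintro ⟨h1, h2⟩
    simp only at h1 h2
    have ht : 0 < t := by nlinarith [sq_nonneg x]
    refine ⟨⟨ht, h1⟩, ?_⟩
    rw [← arcWidth_sq ht.le (by linarith)] at h2
    exact abs_lt.1 (abs_lt_of_sq_lt_sq h2 (by unfold arcWidth; positivity))
  · rintro ⟨h1, h2⟩
    refine ⟨h1.2, ?_⟩
    rw [← arcWidth_sq h1.1.le (by linarith [h1.2])]
    exact sq_lt_sq' h2.1 h2.2

theorem arcRegion_subset (lam : ℝ) : arcRegion lam ⊆ Ioo (-1) 1 ×ˢ Ioo 0 1 := by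
  rintro ⟨x, t⟩ h
  rw [mem_arcRegion_iff] at h
  have ht : t ∈ Ioo (0 : ℝ) 1 := ⟨h.1.1, h.1.2.trans (by linarith [Real.exp_pos (-lam)])⟩
  have := arcWidth_le_one ht.1.le ht.2.le
  exact ⟨⟨by linarith [h.2.1], by linarith [h.2.2]⟩, ht⟩

section
variable {E : Type*} [NormedAddCommGroup E] [NormedSpace ℝ E]

omit [NormedSpace ℝ E] in
theorem indicator_arcRegion_left (lam : ℝ) (h : ℝ × ℝ → E) (x t : ℝ) :
    (arcRegion lam).indicator h (x, t) = (tRange lam x).indicator (fun t => h (x, t)) t := by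
  by_cases ht : t ∈ tRange lam x
  · rw [indicator_of_mem ht, indicator_of_mem ((mem_tRange_iff lam x t).1 ht)]
  · rw [indicator_of_notMem ht, indicator_of_notMem (mt (mem_tRange_iff lam x t).2 ht)]

theorem integral_indicator_arcRegion_left (lam : ℝ) (h : ℝ × ℝ → E) (x : ℝ) :
    ∫ t, (arcRegion lam).indicator h (x, t) = ∫ t in tRange lam x, h (x, t) := by
  simp_rw [indicator_arcRegion_left]
  exact integral_indicator measurableSet_Ioo

theorem integral_indicator_arcRegion_right (lam : ℝ) (h : ℝ × ℝ → E) (t : ℝ) :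
    ∫ x, (arcRegion lam).indicator h (x, t) = (Ioo 0 (1 - Real.exp (-lam))).indicator
      (fun t => ∫ x in Ioo (-arcWidth t) (arcWidth t), h (x, t)) t := by
  by_cases ht : t ∈ Ioo 0 (1 - Real.exp (-lam))
  · rw [indicator_of_mem ht, ← integral_indicator measurableSet_Ioo]
    congr 1; ext x
    simp only [indicator, mem_arcRegion_iff, ht, true_and]
  · rw [indicator_of_notMem ht]
    simp only [indicator, mem_arcRegion_iff, ht, false_and, if_false, integral_zero]

theorem integral_arcRegion_left {lam : ℝ} {h : ℝ × ℝ → E} (hh : IntegrableOn h (arcRegion lam)) :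
    Integrable (fun x => ∫ t in tRange lam x, h (x, t)) := by
  rw [← integrable_indicator_iff (measurableSet_arcRegion lam), Measure.volume_eq_prod] at hh
  have := hh.integral_prod_left
  simpa only [integral_indicator_arcRegion_left] using this

theorem integral_arcRegion_swap {lam : ℝ} {h : ℝ × ℝ → E} (hh : IntegrableOn h (arcRegion lam)) :
    ∫ x, ∫ t in tRange lam x, h (x, t) =
      ∫ t in Ioo 0 (1 - Real.exp (-lam)), ∫ x in Ioo (-arcWidth t) (arcWidth t), h (x, t) := by
  rw [← integrable_indicator_iff (measurableSet_arcRegion lam), Measure.volume_eq_prod] at hh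
  have := integral_integral_swap (f := fun x t => (arcRegion lam).indicator h (x, t)) hh
  simp only [integral_indicator_arcRegion_left, integral_indicator_arcRegion_right] at this
  rw [this, integral_indicator measurableSet_Ioo]

theorem tRange_eq_empty {lam x : ℝ} (hx : x ∉ Ioo (-1 : ℝ) 1) : tRange lam x = ∅ := by
  ext t
  simp only [mem_tRange_iff, mem_empty_iff_false, iff_false]
  exact fun h => hx (arcRegion_subset lam h).1

theorem setIntegral_integral_tRange (lam : ℝ) (h : ℝ → ℝ → E) :
    ∫ x in Ioo (-1 : ℝ) 1, ∫ t in tRange lam x, h x t = ∫ x, ∫ t in tRange lam x, h x t := by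
  refine setIntegral_eq_integral_of_forall_compl_eq_zero fun x hx => ?_
  rw [tRange_eq_empty hx]; simp

theorem integral_Ioo_scale {a : ℝ} (ha : 0 < a) (k : ℝ → E) :
    ∫ x in Ioo (-a) a, k x = a • ∫ r in (-1 : ℝ)..1, k (a * r) := by
  rw [intervalIntegral.integral_comp_mul_left _ ha.ne', smul_inv_smul₀ ha.ne', mul_neg, mul_one,
    intervalIntegral.integral_of_le (by linarith), integral_Ioc_eq_integral_Ioo]

end

/-! ### Integrals against powers of `1 - r ^ 2` -/

/-- The Euler operator `(x f)'`. -/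
noncomputable def eulerOp (f : ℝ → ℝ) (x : ℝ) : ℝ := f x + x * deriv f x

theorem contDiff_eulerOp {f : ℝ → ℝ} (hf : ContDiff ℝ ∞ f) : ContDiff ℝ ∞ (eulerOp f) := by
  have : ContDiff ℝ ∞ (deriv f) := (contDiff_infty_iff_deriv.1 hf).2
  exact hf.add (contDiff_id.mul this)

/-- The integral of `f (a r)` against `(1 - r ^ 2) ^ s`. -/
noncomputable def gegenbauer (f : ℝ → ℝ) (a : ℝ) (s : ℂ) : ℂ :=
  ∫ r in (-1 : ℝ)..1, (f (a * r) : ℂ) * ((1 - r ^ 2 : ℝ) : ℂ) ^ s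

theorem continuous_cpow_one_sub_sq {s : ℂ} (hs : 0 < s.re) :
    Continuous fun r : ℝ => ((1 - r ^ 2 : ℝ) : ℂ) ^ s :=
  (Complex.continuous_ofReal_cpow_const hs).comp (by fun_prop)

/-- The derivative of r f(ar)(1-r²)^{s+1} integrates to zero, and r² = 1 - (1-r²) removes the extra
power. One unit of the exponent is gained at the price of the Euler operator, which commutes with
the scaling by a, and of a pole at s = -1. -/
theorem gegenbauer_recurrence {f : ℝ → ℝ} (hf : ContDiff ℝ ∞ f) (a : ℝ) {s : ℂ} (hs : 0 < s.re) :
    gegenbauer f a s = gegenbauer f a (s + 1) +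
      1 / (2 * (s + 1)) * gegenbauer (eulerOp f) a (s + 1) := by
  have hs1 : 0 < (s + 1).re := by simp; linarith
  have hne : s + 1 ≠ 0 := fun h => by rw [h] at hs1; simp at hs1
  have hc := hf.continuous
  have hd := (contDiff_eulerOp hf).continuous
  have c0 := continuous_cpow_one_sub_sq hs
  have c1 := continuous_cpow_one_sub_sq hs1
  have key : ∫ r in (-1 : ℝ)..1, ((eulerOp f (a * r) : ℂ) * ((1 - r ^ 2 : ℝ) : ℂ) ^ (s + 1) -
      2 * (s + 1) * ((r ^ 2 : ℝ) * (f (a * r) : ℂ) * ((1 - r ^ 2 : ℝ) : ℂ) ^ s)) = 0 := by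
    have := intervalIntegral.integral_eq_sub_of_hasDerivAt_of_le (a := -1) (b := 1) (by norm_num)
      (f := fun r : ℝ => ((r * f (a * r) : ℝ) : ℂ) * ((1 - r ^ 2 : ℝ) : ℂ) ^ (s + 1))
      (f' := fun r : ℝ => (eulerOp f (a * r) : ℂ) * ((1 - r ^ 2 : ℝ) : ℂ) ^ (s + 1) -
      2 * (s + 1) * ((r ^ 2 : ℝ) * (f (a * r) : ℂ) * ((1 - r ^ 2 : ℝ) : ℂ) ^ s))
      (by fun_prop) (fun r hr => ?_) (Continuous.intervalIntegrable (by fun_prop) _ _)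
    · rw [this]; simp [Complex.zero_cpow hne]
    · have hp : (1 - r ^ 2 : ℝ) ≠ 0 := by nlinarith [hr.1, hr.2]
      have d1 : HasDerivAt (fun r => r * f (a * r)) (eulerOp f (a * r)) r := by
        have h1 : HasDerivAt (fun r => f (a * r)) (deriv f (a * r) * a) r := by
          have := (hf.differentiable (by simp) (a * r)).hasDerivAt
          exact this.comp r (by simpa using (hasDerivAt_id r).const_mul a)
        refine ((hasDerivAt_id' r).mul h1).congr_deriv ?_
        rw [eulerOp]; ring
      have d2 : HasDerivAt (fun r : ℝ => ((1 - r ^ 2 : ℝ) : ℂ) ^ (s + 1))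
          ((s + 1) * ((1 - r ^ 2 : ℝ) : ℂ) ^ s * (-2 * r : ℝ)) r := by
        have h1 := hasDerivAt_ofReal_cpow_const hp hne
        have h2 : HasDerivAt (fun r : ℝ => 1 - r ^ 2) (-2 * r) r := by
          refine (((hasDerivAt_id' r).pow 2).const_sub 1).congr_deriv ?_
          simp
        have h3 := h1.scomp r h2
        refine h3.congr_deriv ?_
        rw [Complex.real_smul, add_sub_cancel_right]; ring
      refine (d1.ofReal_comp.mul d2).congr_deriv ?_
      push_cast; ring
  have e : ∀ r : ℝ, (eulerOp f (a * r) : ℂ) * ((1 - r ^ 2 : ℝ) : ℂ) ^ (s + 1) -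
      2 * (s + 1) * ((r ^ 2 : ℝ) * (f (a * r) : ℂ) * ((1 - r ^ 2 : ℝ) : ℂ) ^ s) =
      (eulerOp f (a * r) : ℂ) * ((1 - r ^ 2 : ℝ) : ℂ) ^ (s + 1) -
      2 * (s + 1) * ((f (a * r) : ℂ) * ((1 - r ^ 2 : ℝ) : ℂ) ^ s -
        (f (a * r) : ℂ) * ((1 - r ^ 2 : ℝ) : ℂ) ^ (s + 1)) := by
    intro r
    have : ((1 - r ^ 2 : ℝ) : ℂ) ^ (s + 1) =
        ((1 - r ^ 2 : ℝ) : ℂ) ^ s * ((1 - r ^ 2 : ℝ) : ℂ) := by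
      by_cases h : ((1 - r ^ 2 : ℝ) : ℂ) = 0
      · rw [h, Complex.zero_cpow hne, mul_zero]
      · rw [Complex.cpow_add _ _ h, Complex.cpow_one]
    rw [this]; push_cast; ring
  simp_rw [e] at key
  rw [intervalIntegral.integral_sub, intervalIntegral.integral_const_mul,
    intervalIntegral.integral_sub] at key
  · change gegenbauer _ a _ - 2 * (s + 1) * (gegenbauer f a s - gegenbauer f a (s + 1)) = 0 at key
    field_simp
    linear_combination -key
  all_goals exact Continuous.intervalIntegrable (by fun_prop) _ _

end DiscreteQGUE

namespace DiscreteQGUE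

open MeasureTheory Set

/-! ### Holomorphy in the exponent -/

theorem norm_ofReal_cpow_le_one {u : ℝ} (h0 : 0 < u) (h1 : u ≤ 1) {z : ℂ} (hz : 0 ≤ z.re) :
    ‖(u : ℂ) ^ z‖ ≤ 1 := by
  rw [Complex.norm_cpow_eq_rpow_re_of_pos h0]
  exact Real.rpow_le_one h0.le h1 hz

theorem integrable_mul_cpow {Ω : Type*} [MeasurableSpace Ω] {μ : Measure Ω} {m u : Ω → ℝ}
    (hm : Integrable m μ) (hu : Measurable u) (h : ∀ᵐ p ∂μ, u p ∈ Ioc (0 : ℝ) 1) {z : ℂ}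
    (hz : 0 ≤ z.re) : Integrable (fun p => (m p : ℂ) * (u p : ℂ) ^ z) μ := by
  refine hm.norm.mono' ?_ ?_
  · exact hm.ofReal.aestronglyMeasurable.mul
      ((Complex.measurable_ofReal.comp hu).pow_const z).aestronglyMeasurable
  · filter_upwards [h] with p hp
    rw [norm_mul, Complex.norm_real]
    exact mul_le_of_le_one_right (norm_nonneg _) (norm_ofReal_cpow_le_one hp.1 hp.2 hz)

/-- For a base u in (0, 1] and Re z > δ the derivative satisfies |u^z log u| ≤ u^δ |log u| ≤ 1/δ, so
a multiple of |m| dominates it. -/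
theorem differentiableOn_integral_cpow {Ω : Type*} [MeasurableSpace Ω] {μ : Measure Ω} {m u : Ω → ℝ}
    (hm : Integrable m μ) (hu : Measurable u) (h : ∀ᵐ p ∂μ, u p ∈ Ioc (0 : ℝ) 1) :
    DifferentiableOn ℂ (fun z => ∫ p, (m p : ℂ) * (u p : ℂ) ^ z ∂μ) {z : ℂ | 0 < z.re} := by
  intro z₀ hz₀
  set δ := z₀.re / 2 with hδ
  have hδ0 : 0 < δ := half_pos hz₀
  have hS : {z : ℂ | δ < z.re} ∈ nhds z₀ :=
    (isOpen_lt continuous_const Complex.continuous_re).mem_nhds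
      (show δ < z₀.re by rw [hδ]; have : 0 < z₀.re := hz₀; linarith)
  have hmeas : ∀ z : ℂ, AEStronglyMeasurable (fun p => (m p : ℂ) * (u p : ℂ) ^ z) μ := fun z =>
    hm.ofReal.aestronglyMeasurable.mul
      ((Complex.measurable_ofReal.comp hu).pow_const z).aestronglyMeasurable
  have := (hasDerivAt_integral_of_dominated_loc_of_deriv_le (𝕜 := ℂ) (μ := μ) hS
    (F := fun z p => (m p : ℂ) * (u p : ℂ) ^ z)
    (F' := fun z p => (m p : ℂ) * ((u p : ℂ) ^ z * Complex.log (u p)))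
    (bound := fun p => ‖m p‖ * (1 / δ)) (Filter.Eventually.of_forall hmeas)
    (integrable_mul_cpow hm hu h (le_of_lt hz₀))
    (hm.ofReal.aestronglyMeasurable.mul
      (((Complex.measurable_ofReal.comp hu).pow_const z₀).mul
        (Complex.measurable_log.comp (Complex.measurable_ofReal.comp hu))).aestronglyMeasurable)
    ?_ (hm.norm.mul_const _) ?_).2
  · exact this.differentiableAt.differentiableWithinAt
  · filter_upwards [h] with p hp z hz
    rw [norm_mul, norm_mul, Complex.norm_real, Complex.norm_cpow_eq_rpow_re_of_pos hp.1,
      ← Complex.ofReal_log hp.1.le, Complex.norm_real]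
    gcongr
    have h1 := (Real.abs_log_mul_self_rpow_lt (u p) δ hp.1 hp.2 hδ0).le
    rw [abs_mul, abs_of_pos (Real.rpow_pos_of_pos hp.1 _), mul_comm] at h1
    refine le_trans ?_ h1
    rw [Real.norm_eq_abs]
    exact mul_le_mul_of_nonneg_right (Real.rpow_le_rpow_of_exponent_ge hp.1 hp.2 (le_of_lt hz))
      (abs_nonneg _)
  · filter_upwards [h] with p hp z _
    exact (Complex.hasStrictDerivAt_const_cpow
      (Or.inl (Complex.ofReal_ne_zero.2 hp.1.ne'))).hasDerivAt.const_mul _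

theorem gegenbauer_eq_setIntegral (g : ℝ → ℝ) (a : ℝ) (z : ℂ) :
    gegenbauer g a z = ∫ r in Ioo (-1 : ℝ) 1, (g (a * r) : ℂ) * ((1 - r ^ 2 : ℝ) : ℂ) ^ z := by
  rw [gegenbauer, intervalIntegral.integral_of_le (by norm_num), integral_Ioc_eq_integral_Ioo]

theorem one_sub_sq_mem {r : ℝ} (hr : r ∈ Ioo (-1 : ℝ) 1) : 1 - r ^ 2 ∈ Ioc (0 : ℝ) 1 :=
  ⟨by nlinarith [hr.1, hr.2], by nlinarith [sq_nonneg r]⟩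

theorem integrableOn_Ioo_of_continuous {g : ℝ → ℝ} (hg : Continuous g) (a b : ℝ) :
    IntegrableOn g (Ioo a b) :=
  (hg.continuousOn.integrableOn_Icc).mono_set Ioo_subset_Icc_self

theorem differentiableOn_gegenbauer {g : ℝ → ℝ} (hg : Continuous g) (a : ℝ) :
    DifferentiableOn ℂ (gegenbauer g a) {z : ℂ | 0 < z.re} := by
  have := differentiableOn_integral_cpow (μ := volume.restrict (Ioo (-1 : ℝ) 1))
    (m := fun r => g (a * r)) (u := fun r => 1 - r ^ 2)
    (integrableOn_Ioo_of_continuous (by fun_prop) _ _) (by fun_prop)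
    ((ae_restrict_iff' measurableSet_Ioo).2 (Filter.Eventually.of_forall fun r => one_sub_sq_mem))
  exact this.congr fun z _ => gegenbauer_eq_setIntegral g a z

/-- The integral of `f (a r)` against `√(1 - r ^ 2)`. -/
noncomputable def semicircle (f : ℝ → ℝ) (a : ℝ) : ℝ :=
  ∫ r in (-1 : ℝ)..1, f (a * r) * √(1 - r ^ 2)

theorem ofReal_cpow_half {u : ℝ} (hu : 0 ≤ u) : (u : ℂ) ^ (1 / 2 : ℂ) = (√u : ℝ) := by
  rw [Real.sqrt_eq_rpow, Complex.ofReal_cpow hu]; norm_num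

theorem gegenbauer_half (f : ℝ → ℝ) (a : ℝ) : gegenbauer f a (1 / 2) = semicircle f a := by
  rw [gegenbauer, semicircle, ← intervalIntegral.integral_ofReal]
  refine intervalIntegral.integral_congr fun r hr => ?_
  rw [uIcc_of_le (by norm_num)] at hr
  rw [ofReal_cpow_half (by nlinarith [hr.1, hr.2]), Complex.ofReal_mul]

/-! ### The integral over the region -/

/-- The integral over `t` of `gegenbauer`, with the weight that makes it converge. -/
noncomputable def bulkIntegral (lam : ℝ) (g : ℝ → ℝ) (z : ℂ) : ℂ :=
  ∫ p in Ioo 0 (1 - Real.exp (-lam)) ×ˢ Ioo (-1 : ℝ) 1,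
    ((p.1 / arcWidth p.1 ^ 3 * g (arcWidth p.1 * p.2) : ℝ) : ℂ) *
      ((arcWidth p.1 ^ 2 * (1 - p.2 ^ 2) : ℝ) : ℂ) ^ z

theorem continuous_arcWidth : Continuous arcWidth := by unfold arcWidth; fun_prop

/-- As 1 - t > e^{-λ}, the width a is at least of order √t, and the weight t a⁻³ has only the
integrable singularity t^{-1/2}. This weight is what remains of t a³ (a²)^s once (a²)^{s+3} is split
off. -/
theorem div_arcWidth_cube_le {lam t : ℝ} (ht : t ∈ Ioo 0 (1 - Real.exp (-lam))) :
    t / arcWidth t ^ 3 ≤ 1 / (8 * √(Real.exp (-lam)) ^ 3) * t ^ (-(1 / 2) : ℝ) := by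
  have he := Real.exp_pos (-lam)
  have h0 := ht.1
  have hs : √t * √(Real.exp (-lam)) ≤ √(t * (1 - t)) := by
    rw [← Real.sqrt_mul h0.le]
    exact Real.sqrt_le_sqrt (mul_le_mul_of_nonneg_left (by linarith [ht.2]) h0.le)
  have hp : 0 < √t * √(Real.exp (-lam)) := by positivity
  rw [Real.rpow_neg h0.le, ← Real.sqrt_eq_rpow]
  have e : 1 / (8 * √(Real.exp (-lam)) ^ 3) * (√t)⁻¹ =
      t / (2 * (√t * √(Real.exp (-lam)))) ^ 3 := by
    have : √t ^ 2 = t := Real.sq_sqrt h0.le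
    have hst : √t ≠ 0 := by positivity
    field_simp
    rw [this]; ring
  rw [e, arcWidth]
  gcongr

theorem integrableOn_bulk_weight {lam : ℝ} (hlam : 0 < lam) {g : ℝ → ℝ} (hg : Continuous g) :
    IntegrableOn (fun p : ℝ × ℝ => p.1 / arcWidth p.1 ^ 3 * g (arcWidth p.1 * p.2))
      (Ioo 0 (1 - Real.exp (-lam)) ×ˢ Ioo (-1 : ℝ) 1) := by
  obtain ⟨C, hC⟩ := isCompact_Icc.exists_bound_of_continuousOn (s := Icc (-1 : ℝ) 1)
    hg.continuousOn
  have he1 : 0 ≤ 1 - Real.exp (-lam) := by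
    have : Real.exp (-lam) < 1 := by simpa using hlam
    linarith
  have i1 : Integrable (fun t : ℝ => 1 / (8 * √(Real.exp (-lam)) ^ 3) * t ^ (-(1 / 2) : ℝ))
      (volume.restrict (Ioo 0 (1 - Real.exp (-lam)))) := by
    have := (intervalIntegral.intervalIntegrable_rpow' (a := 0) (b := 1 - Real.exp (-lam))
      (r := -(1 / 2)) (by norm_num)).const_mul (1 / (8 * √(Real.exp (-lam)) ^ 3))
    rw [intervalIntegrable_iff_integrableOn_Ioc_of_le he1] at this
    exact this.mono_set Ioo_subset_Ioc_self
  have i2 : Integrable (fun _ : ℝ => |C|) (volume.restrict (Ioo (-1 : ℝ) 1)) :=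
    integrableOn_Ioo_of_continuous continuous_const _ _
  have i3 := i1.mul_prod i2
  rw [Measure.prod_restrict] at i3
  have hm : Measurable arcWidth := continuous_arcWidth.measurable
  have hgm := hg.measurable
  refine Integrable.mono' i3 (Measurable.aestronglyMeasurable (by fun_prop)) ?_
  refine (ae_restrict_iff' (measurableSet_Ioo.prod measurableSet_Ioo)).2
    (Filter.Eventually.of_forall fun p hp => ?_)
  have h1 : p.1 ≤ 1 := by linarith [hp.1.2, Real.exp_pos (-lam)]
  have ha := arcWidth_pos hp.1.1 (by linarith [hp.1.2, Real.exp_pos (-lam)])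
  have ha1 := arcWidth_le_one hp.1.1.le h1
  rw [norm_mul, Real.norm_eq_abs, abs_of_nonneg (by have := hp.1.1; positivity)]
  refine mul_le_mul (div_arcWidth_cube_le hp.1) ((hC _ ?_).trans (le_abs_self C)) (norm_nonneg _)
    (by have := hp.1.1; positivity)
  have := hp.2.1; have := hp.2.2
  constructor <;> nlinarith

theorem bulk_base_mem {lam : ℝ} {p : ℝ × ℝ}
    (hp : p ∈ Ioo 0 (1 - Real.exp (-lam)) ×ˢ Ioo (-1 : ℝ) 1) :
    arcWidth p.1 ^ 2 * (1 - p.2 ^ 2) ∈ Ioc (0 : ℝ) 1 := by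
  have h1 : p.1 < 1 := by linarith [hp.1.2, Real.exp_pos (-lam)]
  have ha := arcWidth_pos hp.1.1 h1
  have ha1 := arcWidth_le_one hp.1.1.le h1.le
  have h2 := one_sub_sq_mem hp.2
  exact ⟨mul_pos (by positivity) h2.1, mul_le_one₀ (pow_le_one₀ ha.le ha1) h2.1.le h2.2⟩

theorem bulk_base_mem_ae (lam : ℝ) : ∀ᵐ p : ℝ × ℝ ∂(volume.restrict
    (Ioo 0 (1 - Real.exp (-lam)) ×ˢ Ioo (-1 : ℝ) 1)),
    arcWidth p.1 ^ 2 * (1 - p.2 ^ 2) ∈ Ioc (0 : ℝ) 1 :=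
  (ae_restrict_iff' (measurableSet_Ioo.prod measurableSet_Ioo)).2
    (Filter.Eventually.of_forall fun _ => bulk_base_mem)

theorem measurable_bulk_base :
    Measurable fun p : ℝ × ℝ => arcWidth p.1 ^ 2 * (1 - p.2 ^ 2) := by
  have hm : Measurable arcWidth := continuous_arcWidth.measurable
  fun_prop

theorem differentiableOn_bulkIntegral {lam : ℝ} (hlam : 0 < lam) {g : ℝ → ℝ} (hg : Continuous g) :
    DifferentiableOn ℂ (bulkIntegral lam g) {z : ℂ | 0 < z.re} :=
  differentiableOn_integral_cpow (integrableOn_bulk_weight hlam hg) measurable_bulk_base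
    (bulk_base_mem_ae lam)

theorem bulkIntegral_eq {lam : ℝ} (hlam : 0 < lam) {g : ℝ → ℝ} (hg : Continuous g) {z : ℂ}
    (hz : 0 ≤ z.re) : bulkIntegral lam g z = ∫ t in Ioo 0 (1 - Real.exp (-lam)),
      ((t / arcWidth t ^ 3 : ℝ) : ℂ) * ((arcWidth t ^ 2 : ℝ) : ℂ) ^ z *
        gegenbauer g (arcWidth t) z := by
  have hi := integrable_mul_cpow (integrableOn_bulk_weight hlam hg) measurable_bulk_base
    (bulk_base_mem_ae lam) hz
  rw [bulkIntegral, Measure.volume_eq_prod, setIntegral_prod _ hi]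
  refine setIntegral_congr_fun measurableSet_Ioo fun t ht => ?_
  rw [gegenbauer_eq_setIntegral, ← integral_const_mul]
  refine setIntegral_congr_fun measurableSet_Ioo fun r hr => ?_
  rw [Complex.ofReal_mul (arcWidth t ^ 2), Complex.mul_cpow_ofReal_nonneg (by positivity)
    (one_sub_sq_mem hr).1.le, Complex.ofReal_mul]
  ring

theorem integrableOn_bulk {lam : ℝ} (hlam : 0 < lam) {g : ℝ → ℝ} (hg : Continuous g) {z : ℂ}
    (hz : 0 ≤ z.re) : IntegrableOn (fun t =>
      ((t / arcWidth t ^ 3 : ℝ) : ℂ) * ((arcWidth t ^ 2 : ℝ) : ℂ) ^ z *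
        gegenbauer g (arcWidth t) z) (Ioo 0 (1 - Real.exp (-lam))) := by
  have hi := integrable_mul_cpow (integrableOn_bulk_weight hlam hg) measurable_bulk_base
    (bulk_base_mem_ae lam) hz
  rw [Measure.volume_eq_prod, ← Measure.prod_restrict] at hi
  refine (integrable_congr ?_).1 hi.integral_prod_left
  refine (ae_restrict_iff' measurableSet_Ioo).2 (Filter.Eventually.of_forall fun t ht => ?_)
  simp only
  rw [gegenbauer_eq_setIntegral, ← integral_const_mul]
  refine setIntegral_congr_fun measurableSet_Ioo fun r hr => ?_
  rw [Complex.ofReal_mul (arcWidth t ^ 2), Complex.mul_cpow_ofReal_nonneg (by positivity)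
    (one_sub_sq_mem hr).1.le, Complex.ofReal_mul]
  ring

/-- The value of `bulkIntegral` at the exponent `1 / 2`. -/
noncomputable def bulkSemicircle (lam : ℝ) (g : ℝ → ℝ) : ℝ :=
  ∫ t in Ioo 0 (1 - Real.exp (-lam)), 1 / (4 * (1 - t)) * semicircle g (arcWidth t)

theorem bulkIntegral_half {lam : ℝ} (hlam : 0 < lam) {g : ℝ → ℝ} (hg : Continuous g) :
    bulkIntegral lam g (1 / 2) = bulkSemicircle lam g := by
  rw [bulkIntegral_eq hlam hg (by norm_num), bulkSemicircle, ← integral_complex_ofReal]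
  refine setIntegral_congr_fun measurableSet_Ioo fun t ht => ?_
  have h1 : t < 1 := by linarith [ht.2, Real.exp_pos (-lam)]
  have ha := arcWidth_pos ht.1 h1
  have h2 : 1 - t ≠ 0 := by linarith
  have h3 := ht.1.ne'
  rw [gegenbauer_half, ofReal_cpow_half (by positivity), Real.sqrt_sq ha.le, ← Complex.ofReal_mul,
    ← Complex.ofReal_mul]
  congr 2
  have : t / arcWidth t ^ 3 * arcWidth t = t / arcWidth t ^ 2 := by field_simp
  rw [this, arcWidth_sq ht.1.le h1.le]
  field_simp

end DiscreteQGUE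

namespace DiscreteQGUE

open MeasureTheory Set

/-! ### The pairing in the region of convergence -/

theorem edge_eq_arcWidth (lam : ℝ) : edge lam = arcWidth (1 - Real.exp (-lam)) := by
  rw [edge, arcWidth, sub_sub_cancel]

theorem edge_pos {lam : ℝ} (hlam : 0 < lam) : 0 < edge lam := by
  have he := Real.exp_pos (-lam)
  have he1 : Real.exp (-lam) < 1 := by simpa using hlam
  rw [edge_eq_arcWidth]
  exact arcWidth_pos (by linarith) (by linarith)

theorem edge_le_one {lam : ℝ} (hlam : 0 < lam) : edge lam ≤ 1 := by
  have he := Real.exp_pos (-lam)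
  have he1 : Real.exp (-lam) < 1 := by simpa using hlam
  rw [edge_eq_arcWidth]
  exact arcWidth_le_one (by linarith) (by linarith)

theorem continuous_sub_sq_cpow (c : ℝ) {s : ℂ} (hs : 0 < s.re) :
    Continuous fun x : ℝ => ((c - x ^ 2 : ℝ) : ℂ) ^ s :=
  (Complex.continuous_ofReal_cpow_const hs).comp (by fun_prop)

/-- The quadratic factor is written as A - (a² - x²), so that only the exponents s and s + 1 occur.
At the edge A is b² - 2e^{-λ} with b the edge; in the bulk A is 3a²/2, because 2t(1-t) = a²/2. -/
theorem integral_Ioo_sub_sq_cpow {f : ℝ → ℝ} (hf : Continuous f) {a : ℝ} (ha : 0 < a) (A : ℝ) {s : ℂ}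
    (hs : 0 < s.re) : ∫ x in Ioo (-a) a, (f x : ℂ) * ((A - (a ^ 2 - x ^ 2) : ℝ) : ℂ) *
      ((a ^ 2 - x ^ 2 : ℝ) : ℂ) ^ s = a * ((a ^ 2 : ℝ) : ℂ) ^ s *
      (A * gegenbauer f a s + (-(a ^ 2) : ℝ) * gegenbauer f a (s + 1)) := by
  have hs1 : 0 < (s + 1).re := by simp; linarith
  have hne : s + 1 ≠ 0 := fun h => by rw [h] at hs1; simp at hs1
  have c0 := continuous_cpow_one_sub_sq hs
  have c1 := continuous_cpow_one_sub_sq hs1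
  rw [integral_Ioo_scale ha, gegenbauer, gegenbauer, ← intervalIntegral.integral_const_mul,
    ← intervalIntegral.integral_const_mul, ← intervalIntegral.integral_add, Complex.real_smul,
    mul_assoc, ← intervalIntegral.integral_const_mul (((a ^ 2 : ℝ) : ℂ) ^ s)]
  · congr 1
    refine intervalIntegral.integral_congr fun r hr => ?_
    rw [uIcc_of_le (by norm_num)] at hr
    have hu : 0 ≤ 1 - r ^ 2 := by nlinarith [hr.1, hr.2]
    have e : ((1 - r ^ 2 : ℝ) : ℂ) ^ (s + 1) =
        ((1 - r ^ 2 : ℝ) : ℂ) ^ s * ((1 - r ^ 2 : ℝ) : ℂ) := by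
      by_cases h : ((1 - r ^ 2 : ℝ) : ℂ) = 0
      · rw [h, Complex.zero_cpow hne, mul_zero]
      · rw [Complex.cpow_add _ _ h, Complex.cpow_one]
    have e2 : a ^ 2 - (a * r) ^ 2 = a ^ 2 * (1 - r ^ 2) := by ring
    simp only [e2]
    rw [e, Complex.ofReal_mul (a ^ 2), Complex.mul_cpow_ofReal_nonneg (by positivity) hu]
    push_cast; ring
  all_goals exact Continuous.intervalIntegrable (by fun_prop) _ _

/-- The coefficients that express `A J(s) + B J(s + 1)` by integrals with exponent `s + 3`. -/
noncomputable def regCoeff (A B s : ℂ) : ℕ → ℂ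
  | 0 => A + B
  | 1 => A * (1 / (2 * (s + 1)) + 1 / (2 * (s + 2)) + 1 / (2 * (s + 3))) +
      B * (1 / (2 * (s + 2)) + 1 / (2 * (s + 3)))
  | 2 => A * (1 / (2 * (s + 1)) * (1 / (2 * (s + 2))) + 1 / (2 * (s + 1)) * (1 / (2 * (s + 3))) +
      1 / (2 * (s + 2)) * (1 / (2 * (s + 3)))) + B * (1 / (2 * (s + 2)) * (1 / (2 * (s + 3))))
  | _ => A * (1 / (2 * (s + 1)) * (1 / (2 * (s + 2))) * (1 / (2 * (s + 3))))

theorem contDiff_iterate_eulerOp {f : ℝ → ℝ} (hf : ContDiff ℝ ∞ f) (i : ℕ) :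
    ContDiff ℝ ∞ (eulerOp^[i] f) := by
  induction i with
  | zero => exact hf
  | succ i ih => rw [Function.iterate_succ_apply']; exact contDiff_eulerOp ih

/-- Three raisings of the first integral and two of the second. Formally this is
A(1+c₁E)(1+c₂E)(1+c₃E) + B(1+c₂E)(1+c₃E) with E the Euler operator and c_k = 1/(2(s+k)); `regCoeff`
collects the coefficients of E^i. -/
theorem gegenbauer_raise {f : ℝ → ℝ} (hf : ContDiff ℝ ∞ f) (a : ℝ) (A B : ℂ) {s : ℂ} (hs : 0 < s.re) :
    A * gegenbauer f a s + B * gegenbauer f a (s + 1) =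
      ∑ i ∈ Finset.range 4, regCoeff A B s i * gegenbauer (eulerOp^[i] f) a (s + 3) := by
  have f1 := contDiff_eulerOp hf
  have f2 := contDiff_eulerOp f1
  have s1 : 0 < (s + 1).re := by simp; linarith
  have s2 : 0 < (s + 2).re := by simp; linarith
  have e2 : s + 1 + 1 = s + 2 := by ring
  have e3 : s + 2 + 1 = s + 3 := by ring
  have r := fun {f : ℝ → ℝ} (hf : ContDiff ℝ ∞ f) => gegenbauer_recurrence hf a s1
  have t := fun {f : ℝ → ℝ} (hf : ContDiff ℝ ∞ f) => gegenbauer_recurrence hf a s2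
  rw [e2] at r
  rw [e3] at t
  rw [gegenbauer_recurrence hf a hs, r hf, r f1, t hf, t f1, t f2]
  simp only [Finset.sum_range_succ, Finset.sum_range_zero, regCoeff, Function.iterate_succ,
    Function.iterate_zero, Function.comp_apply, id]
  ring

/-- The meromorphic continuation of the pairing. -/
noncomputable def regPairing (lam : ℝ) (f : ℝ → ℝ) (s : ℂ) : ℂ :=
  -((1 / Real.pi * lam * (Real.exp (-lam) * (1 - Real.exp (-lam)) / 2) : ℝ) : ℂ) *
      (edge lam * ((edge lam ^ 2 : ℝ) : ℂ) ^ s * ∑ i ∈ Finset.range 4,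
        regCoeff ((edge lam ^ 2 - 2 * Real.exp (-lam) : ℝ) : ℂ) ((-(edge lam ^ 2) : ℝ) : ℂ) s i *
          gegenbauer (eulerOp^[i] f) (edge lam) (s + 3)) -
    ((1 / Real.pi * (lam / 3) : ℝ) : ℂ) * ∑ i ∈ Finset.range 4,
      regCoeff (3 / 2) (-1) s i * bulkIntegral lam (eulerOp^[i] f) (s + 3)

theorem continuous_innerIntegrand {s : ℂ} (hs : 0 < s.re) :
    Continuous fun p : ℝ × ℝ => innerIntegrand s p.1 p.2 := by
  have : Continuous fun p : ℝ × ℝ => ((4 * p.2 * (1 - p.2) - p.1 ^ 2 : ℝ) : ℂ) ^ s :=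
    (Complex.continuous_ofReal_cpow_const hs).comp (by fun_prop)
  unfold innerIntegrand
  fun_prop

theorem integrableOn_arcRegion_innerIntegrand (lam : ℝ) {f : ℝ → ℝ} (hf : Continuous f) {s : ℂ}
    (hs : 0 < s.re) : IntegrableOn (fun p : ℝ × ℝ => (f p.1 : ℂ) * innerIntegrand s p.1 p.2)
      (arcRegion lam) := by
  have hc : Continuous fun p : ℝ × ℝ => (f p.1 : ℂ) * innerIntegrand s p.1 p.2 := by
    have := continuous_innerIntegrand hs
    fun_prop
  have := hc.continuousOn.integrableOn_compact (μ := volume)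
    ((isCompact_Icc (a := (-1 : ℝ)) (b := 1)).prod (isCompact_Icc (a := (0 : ℝ)) (b := 1)))
  exact this.mono_set ((arcRegion_subset lam).trans
    (prod_mono Ioo_subset_Icc_self Ioo_subset_Icc_self))

theorem integrableOn_innerIntegrand (lam x : ℝ) {s : ℂ} (hs : 0 < s.re) :
    IntegrableOn (innerIntegrand s x) (tRange lam x) := by
  have hc : Continuous (innerIntegrand s x) :=
    (continuous_innerIntegrand hs).comp (Continuous.prodMk continuous_const continuous_id)
  exact (hc.continuousOn.integrableOn_Icc).mono_set Ioo_subset_Icc_self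

theorem mul_rhoOne_eq (lam : ℝ) (f : ℝ → ℝ) (s : ℂ) (x : ℝ) : (f x : ℂ) * rhoOne lam s x =
    -((1 / Real.pi * lam * (Real.exp (-lam) * (1 - Real.exp (-lam)) / 2) : ℝ) : ℂ) *
      (Ioo (-edge lam) (edge lam)).indicator (fun x => (f x : ℂ) *
        ((edge lam ^ 2 - 2 * Real.exp (-lam) - (edge lam ^ 2 - x ^ 2) : ℝ) : ℂ) *
          ((edge lam ^ 2 - x ^ 2 : ℝ) : ℂ) ^ s) x -
    ((1 / Real.pi * (lam / 3) : ℝ) : ℂ) *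
      ∫ t in tRange lam x, (f x : ℂ) * innerIntegrand s x t := by
  rw [integral_const_mul, rhoOne]
  by_cases hx : x ∈ Ioo (-edge lam) (edge lam)
  · rw [indicator_of_mem hx, symIndicator, indicator_of_mem hx]
    push_cast; ring
  · rw [indicator_of_notMem hx, symIndicator, indicator_of_notMem hx]
    push_cast; ring

section
variable {lam : ℝ} {f : ℝ → ℝ} (hf : Continuous f) {s : ℂ} (hs : 0 < s.re)
include hf hs

theorem integrableOn_edge_term : IntegrableOn ((Ioo (-edge lam) (edge lam)).indicator (fun x =>
    (f x : ℂ) * ((edge lam ^ 2 - 2 * Real.exp (-lam) - (edge lam ^ 2 - x ^ 2) : ℝ) : ℂ) *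
      ((edge lam ^ 2 - x ^ 2 : ℝ) : ℂ) ^ s)) (Ioo (-1) 1) := by
  have hc : Continuous fun x : ℝ => (f x : ℂ) *
      ((edge lam ^ 2 - 2 * Real.exp (-lam) - (edge lam ^ 2 - x ^ 2) : ℝ) : ℂ) *
      ((edge lam ^ 2 - x ^ 2 : ℝ) : ℂ) ^ s := by
    have := continuous_sub_sq_cpow (edge lam ^ 2) hs
    fun_prop
  exact ((hc.continuousOn.integrableOn_Icc).mono_set Ioo_subset_Icc_self).indicator
    measurableSet_Ioo

theorem rhoOnePairingConverges : RhoOnePairingConverges lam f s := by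
  refine ⟨fun x _ => integrableOn_innerIntegrand lam x hs, ?_⟩
  simp_rw [mul_rhoOne_eq]
  exact ((integrableOn_edge_term hf hs).const_mul _).sub
    ((integral_arcRegion_left
      (integrableOn_arcRegion_innerIntegrand lam hf hs)).integrableOn.const_mul _)

end

/-- Fubini puts the integral over x inside the one over t, and scaling by the edge or by the width
at t leaves integrals over (-1, 1), to which `gegenbauer_raise` applies. The raised integrals keep
their meaning for Re s > -3. -/
theorem rhoOnePairing_eq_regPairing {lam : ℝ} (hlam : 0 < lam) {f : ℝ → ℝ} (hf : ContDiff ℝ ∞ f)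
    {s : ℂ} (hs : 0 < s.re) : regPairing lam f s = rhoOnePairing lam f s := by
  have hc := hf.continuous
  have hs3 : 0 ≤ (s + 3).re := by simp; linarith
  have hi := integrableOn_arcRegion_innerIntegrand lam hc hs
  rw [rhoOnePairing]
  simp_rw [mul_rhoOne_eq]
  rw [integral_sub ((integrableOn_edge_term hc hs).const_mul _)
    ((integral_arcRegion_left hi).integrableOn.const_mul _), integral_const_mul,
    integral_const_mul, setIntegral_integral_tRange lam fun x t => (f x : ℂ) * innerIntegrand s x t,
    integral_arcRegion_swap hi, setIntegral_indicator measurableSet_Ioo,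
    inter_eq_right.2 (Ioo_subset_Ioo (neg_le_neg (edge_le_one hlam)) (edge_le_one hlam)),
    integral_Ioo_sub_sq_cpow hc (edge_pos hlam) _ hs, gegenbauer_raise hf _ _ _ hs, regPairing]
  congr 2
  have hb := fun i => bulkIntegral_eq hlam (contDiff_iterate_eulerOp hf i).continuous hs3
  have hbi := fun i => integrableOn_bulk hlam (contDiff_iterate_eulerOp hf i).continuous hs3
  simp_rw [hb, ← integral_const_mul]
  rw [← integral_finsetSum _ fun i _ => (hbi i).const_mul _]
  refine setIntegral_congr_fun measurableSet_Ioo fun t ht => ?_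
  have h1 : t < 1 := by linarith [ht.2, Real.exp_pos (-lam)]
  have ha := arcWidth_pos ht.1 h1
  have hsq := arcWidth_sq ht.1.le h1.le
  have e : ∀ x, (f x : ℂ) * innerIntegrand s x t = (t : ℂ) * ((f x : ℂ) *
      ((3 / 2 * arcWidth t ^ 2 - (arcWidth t ^ 2 - x ^ 2) : ℝ) : ℂ) *
      ((arcWidth t ^ 2 - x ^ 2 : ℝ) : ℂ) ^ s) := fun x => by
    rw [innerIntegrand, hsq]; push_cast; ring
  simp only [e]
  rw [integral_const_mul, integral_Ioo_sub_sq_cpow hc ha _ hs]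
  have g := gegenbauer_raise hf (arcWidth t) (3 / 2) (-1) hs
  have p : ((arcWidth t ^ 2 : ℝ) : ℂ) ^ (s + 3) =
      ((arcWidth t ^ 2 : ℝ) : ℂ) ^ s * ((arcWidth t ^ 2 : ℝ) : ℂ) ^ 3 := by
    rw [Complex.cpow_add _ _ (Complex.ofReal_ne_zero.2 (by positivity))]
    rw [Complex.cpow_ofNat]
  have hane : (arcWidth t : ℂ) ≠ 0 := Complex.ofReal_ne_zero.2 ha.ne'
  have : ∀ i, regCoeff (3 / 2) (-1) s i * (((t / arcWidth t ^ 3 : ℝ) : ℂ) *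
      ((arcWidth t ^ 2 : ℝ) : ℂ) ^ (s + 3) * gegenbauer (eulerOp^[i] f) (arcWidth t) (s + 3)) =
      (t * arcWidth t ^ 3 * ((arcWidth t ^ 2 : ℝ) : ℂ) ^ s) *
      (regCoeff (3 / 2) (-1) s i * gegenbauer (eulerOp^[i] f) (arcWidth t) (s + 3)) := fun i => by
    rw [p]; push_cast; field_simp
  simp_rw [this]
  rw [← Finset.mul_sum, ← g]
  push_cast; ring

theorem meromorphicAt_regCoeff (A B : ℂ) (i : ℕ) (s : ℂ) :
    MeromorphicAt (fun s => regCoeff A B s i) s := by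
  rcases i with _ | _ | _ | i <;> (simp only [regCoeff]; fun_prop)

theorem analyticAt_regCoeff (A B : ℂ) (i : ℕ) {s : ℂ} (h1 : s + 1 ≠ 0) (h2 : s + 2 ≠ 0)
    (h3 : s + 3 ≠ 0) : AnalyticAt ℂ (fun s => regCoeff A B s i) s := by
  have k1 : 2 * (s + 1) ≠ 0 := mul_ne_zero two_ne_zero h1
  have k2 : 2 * (s + 2) ≠ 0 := mul_ne_zero two_ne_zero h2
  have k3 : 2 * (s + 3) ≠ 0 := mul_ne_zero two_ne_zero h3
  rcases i with _ | _ | _ | i <;>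
    (simp only [regCoeff]; fun_prop (disch := assumption))

theorem analyticAt_comp_add_three {g : ℂ → ℂ} (hg : DifferentiableOn ℂ g {z | 0 < z.re}) {s : ℂ}
    (hs : -3 < s.re) : AnalyticAt ℂ (fun s => g (s + 3)) s := by
  have h1 : AnalyticAt ℂ g (s + 3) := hg.analyticAt
    ((isOpen_lt continuous_const Complex.continuous_re).mem_nhds (by
      change 0 < (s + 3).re
      simp; linarith))
  exact h1.comp (f := fun s => s + 3) (by fun_prop)

theorem analyticAt_ofReal_cpow {c : ℝ} (hc : c ≠ 0) (s : ℂ) :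
    AnalyticAt ℂ (fun s => (c : ℂ) ^ s) s := by
  have : Differentiable ℂ fun s : ℂ => (c : ℂ) ^ s := fun z =>
    (Complex.hasStrictDerivAt_const_cpow (Or.inl (Complex.ofReal_ne_zero.2 hc))).hasDerivAt.differentiableAt
  exact this.analyticAt s

/-- The regularised value of the pairing. -/
noncomputable def regValue (lam : ℝ) (f : ℝ → ℝ) : ℝ :=
  -(1 / Real.pi * lam * (Real.exp (-lam) * (1 - Real.exp (-lam)) / 2)) *
      (1 / edge lam ^ 4 * (-(2 * Real.exp (-lam)) * semicircle f (edge lam) -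
        (edge lam ^ 2 - 2 * Real.exp (-lam)) / 3 * semicircle (eulerOp^[1] f) (edge lam) +
        2 * Real.exp (-lam) * semicircle (eulerOp^[2] f) (edge lam) +
        (edge lam ^ 2 - 2 * Real.exp (-lam)) / 3 * semicircle (eulerOp^[3] f) (edge lam))) -
    1 / Real.pi * (lam / 3) * (1 / 2 * (bulkSemicircle lam f - bulkSemicircle lam (eulerOp^[1] f) -
      bulkSemicircle lam (eulerOp^[2] f) + bulkSemicircle lam (eulerOp^[3] f)))

theorem regPairing_eq_regValue {lam : ℝ} (hlam : 0 < lam) {f : ℝ → ℝ} (hf : ContDiff ℝ ∞ f) :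
    regPairing lam f (-5 / 2) = regValue lam f := by
  have hc := fun i => (contDiff_iterate_eulerOp hf i).continuous
  have hb := edge_pos hlam
  have e : (-5 / 2 : ℂ) + 3 = 1 / 2 := by norm_num
  have p : (edge lam : ℂ) * ((edge lam ^ 2 : ℝ) : ℂ) ^ (-5 / 2 : ℂ) =
      ((1 / edge lam ^ 4 : ℝ) : ℂ) := by
    have h : ((edge lam ^ 2 : ℝ) : ℂ) ^ (-5 / 2 : ℂ) =
        (((edge lam ^ 2) ^ (-5 / 2 : ℝ) : ℝ) : ℂ) := by
      rw [Complex.ofReal_cpow (by positivity)]; norm_num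
    rw [h, ← Complex.ofReal_mul]
    congr 1
    rw [← Real.rpow_natCast (edge lam) 2, ← Real.rpow_mul hb.le,
      show (((2 : ℕ) : ℝ) * (-5 / 2)) = -((5 : ℕ) : ℝ) by norm_num, Real.rpow_neg hb.le,
      Real.rpow_natCast]
    field_simp
  rw [regPairing, p]
  simp only [e, bulkIntegral_half hlam (hc _), gegenbauer_half, Finset.sum_range_succ,
    Finset.sum_range_zero, regCoeff, regValue, Function.iterate_zero, id]
  -- At s = -5/2 the factors 1/(2(s+k)) for k = 1, 2, 3 are -1/3, -1 and 1.
  have k1 : (1 : ℂ) / (2 * (-5 / 2 + 1)) = -1 / 3 := by norm_num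
  have k2 : (1 : ℂ) / (2 * (-5 / 2 + 2)) = -1 := by norm_num
  rw [k1, k2, show (1 : ℂ) / (2 * (1 / 2)) = 1 by norm_num]
  push_cast
  ring

theorem isRegularisedValue_regValue {lam : ℝ} (hlam : 0 < lam) {f : ℝ → ℝ} (hf : ContDiff ℝ ∞ f) :
    IsRegularisedValue (rhoOnePairing lam f) (-5 / 2) (regValue lam f) := by
  have hre : ((-5 / 2 : ℂ)).re = -5 / 2 := by norm_num
  have hg := fun i => differentiableOn_gegenbauer (contDiff_iterate_eulerOp hf i).continuous
    (edge lam)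
  have hb := fun i => differentiableOn_bulkIntegral hlam (contDiff_iterate_eulerOp hf i).continuous
  have hp : ∀ s : ℂ, AnalyticAt ℂ (fun s => ((edge lam ^ 2 : ℝ) : ℂ) ^ s) s := fun s =>
    analyticAt_ofReal_cpow (pow_ne_zero 2 (edge_pos hlam).ne') s
  -- After three raisings the integrals are holomorphic for Re s > -3; in that half-plane the
  -- coefficients can have poles only at -1 and -2, away from -5/2.
  refine ⟨-3, by rw [hre]; norm_num, regPairing lam f, fun s hs => ?_,
    fun s hs _ => rhoOnePairing_eq_regPairing hlam hf hs, ?_, regPairing_eq_regValue hlam hf⟩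
  · have g := fun i => (analyticAt_comp_add_three (hg i) hs).meromorphicAt
    have b := fun i => (analyticAt_comp_add_three (hb i) hs).meromorphicAt
    have p := (hp s).meromorphicAt
    have c := fun A B i => meromorphicAt_regCoeff A B i s
    unfold regPairing
    simp only [Finset.sum_range_succ, Finset.sum_range_zero]
    fun_prop
  · have hs : -3 < ((-5 / 2 : ℂ)).re := by rw [hre]; norm_num
    have g := fun i => analyticAt_comp_add_three (hg i) hs
    have b := fun i => analyticAt_comp_add_three (hb i) hs
    have p := hp (-5 / 2)
    have c := fun A B i => analyticAt_regCoeff A B i (s := -5 / 2) (by norm_num) (by norm_num)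
      (by norm_num)
    unfold regPairing
    simp only [Finset.sum_range_succ, Finset.sum_range_zero]
    fun_prop

end DiscreteQGUE

namespace DiscreteQGUE

open MeasureTheory Set

/-! ### Linearity and boundedness of the regularised value -/

theorem continuous_semicircle {f : ℝ → ℝ} (hf : Continuous f) : Continuous (semicircle f) := by
  unfold semicircle
  exact intervalIntegral.continuous_parametric_intervalIntegral_of_continuous' (by fun_prop) _ _

theorem integrableOn_bulkSemicircle (lam : ℝ) {f : ℝ → ℝ} (hf : Continuous f) :
    IntegrableOn (fun t => 1 / (4 * (1 - t)) * semicircle f (arcWidth t))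
      (Ioo 0 (1 - Real.exp (-lam))) := by
  have hs := (continuous_semicircle hf).comp continuous_arcWidth
  have : ContinuousOn (fun t => 1 / (4 * (1 - t)) * semicircle f (arcWidth t))
      (Icc 0 (1 - Real.exp (-lam))) := by
    refine ContinuousOn.mul (continuousOn_const.div (by fun_prop) fun t ht => ?_) hs.continuousOn
    have : 0 < 1 - t := by linarith [ht.2, Real.exp_pos (-lam)]
    positivity
  exact this.integrableOn_Icc.mono_set Ioo_subset_Icc_self

theorem semicircle_add {f g : ℝ → ℝ} (hf : Continuous f) (hg : Continuous g) (a : ℝ) :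
    semicircle (fun x => f x + g x) a = semicircle f a + semicircle g a := by
  unfold semicircle
  rw [← intervalIntegral.integral_add]
  · simp only [add_mul]
  all_goals exact Continuous.intervalIntegrable (by fun_prop) _ _

theorem semicircle_mul (c : ℝ) (f : ℝ → ℝ) (a : ℝ) :
    semicircle (fun x => c * f x) a = c * semicircle f a := by
  unfold semicircle
  rw [← intervalIntegral.integral_const_mul]
  simp only [mul_assoc]

theorem bulkSemicircle_add (lam : ℝ) {f g : ℝ → ℝ} (hf : Continuous f) (hg : Continuous g) :
    bulkSemicircle lam (fun x => f x + g x) = bulkSemicircle lam f + bulkSemicircle lam g := by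
  unfold bulkSemicircle
  rw [← integral_add (integrableOn_bulkSemicircle lam hf) (integrableOn_bulkSemicircle lam hg)]
  simp only [semicircle_add hf hg, mul_add]

theorem bulkSemicircle_mul (lam c : ℝ) (f : ℝ → ℝ) :
    bulkSemicircle lam (fun x => c * f x) = c * bulkSemicircle lam f := by
  unfold bulkSemicircle
  rw [← integral_const_mul]
  congr 1; ext t
  rw [semicircle_mul]; ring

theorem eulerOp_add {f g : ℝ → ℝ} (hf : ContDiff ℝ ∞ f) (hg : ContDiff ℝ ∞ g) :
    eulerOp (fun x => f x + g x) = fun x => eulerOp f x + eulerOp g x := by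
  ext x
  simp only [eulerOp]
  rw [deriv_fun_add (hf.differentiable (by simp) x) (hg.differentiable (by simp) x)]
  ring

theorem eulerOp_mul (c : ℝ) {f : ℝ → ℝ} (hf : ContDiff ℝ ∞ f) :
    eulerOp (fun x => c * f x) = fun x => c * eulerOp f x := by
  ext x
  simp only [eulerOp]
  rw [deriv_const_mul _ (hf.differentiable (by simp) x)]
  ring

theorem iterate_eulerOp_add {f g : ℝ → ℝ} (hf : ContDiff ℝ ∞ f) (hg : ContDiff ℝ ∞ g) (i : ℕ) :
    eulerOp^[i] (fun x => f x + g x) = fun x => eulerOp^[i] f x + eulerOp^[i] g x := by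
  induction i with
  | zero => rfl
  | succ i ih =>
    rw [Function.iterate_succ_apply', ih, eulerOp_add (contDiff_iterate_eulerOp hf i)
      (contDiff_iterate_eulerOp hg i), Function.iterate_succ_apply', Function.iterate_succ_apply']

theorem iterate_eulerOp_mul (c : ℝ) {f : ℝ → ℝ} (hf : ContDiff ℝ ∞ f) (i : ℕ) :
    eulerOp^[i] (fun x => c * f x) = fun x => c * eulerOp^[i] f x := by
  induction i with
  | zero => rfl
  | succ i ih =>
    rw [Function.iterate_succ_apply', ih, eulerOp_mul c (contDiff_iterate_eulerOp hf i),
      Function.iterate_succ_apply']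

theorem regValue_add (lam : ℝ) {f g : ℝ → ℝ} (hf : ContDiff ℝ ∞ f) (hg : ContDiff ℝ ∞ g) :
    regValue lam (fun x => f x + g x) = regValue lam f + regValue lam g := by
  have cf := fun i => (contDiff_iterate_eulerOp hf i).continuous
  have cg := fun i => (contDiff_iterate_eulerOp hg i).continuous
  simp only [regValue, iterate_eulerOp_add hf hg, semicircle_add (cf _) (cg _),
    bulkSemicircle_add lam (cf _) (cg _), semicircle_add hf.continuous hg.continuous,
    bulkSemicircle_add lam hf.continuous hg.continuous]
  ring

theorem regValue_mul (lam c : ℝ) {f : ℝ → ℝ} (hf : ContDiff ℝ ∞ f) :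
    regValue lam (fun x => c * f x) = c * regValue lam f := by
  simp only [regValue, iterate_eulerOp_mul c hf, semicircle_mul, bulkSemicircle_mul]
  ring

theorem abs_semicircle_le {f : ℝ → ℝ} {δ : ℝ} (hf : ∀ x ∈ Icc (-1 : ℝ) 1, |f x| ≤ δ) {a : ℝ}
    (h0 : 0 ≤ a) (h1 : a ≤ 1) : |semicircle f a| ≤ 2 * δ := by
  have := intervalIntegral.norm_integral_le_of_norm_le_const (a := -1) (b := 1) (C := δ)
    (f := fun r => f (a * r) * √(1 - r ^ 2)) fun r hr => by
      rw [uIoc_of_le (by norm_num)] at hr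
      have hm : a * r ∈ Icc (-1 : ℝ) 1 := by
        have := hr.1; have := hr.2
        constructor <;> nlinarith
      rw [norm_mul, Real.norm_eq_abs, Real.norm_eq_abs, abs_of_nonneg (Real.sqrt_nonneg _)]
      have h2 : √(1 - r ^ 2) ≤ 1 := Real.sqrt_le_one.2 (by nlinarith [sq_nonneg r])
      exact (mul_le_of_le_one_right (abs_nonneg _) h2).trans (hf _ hm)
  refine this.trans_eq ?_
  norm_num; ring

theorem abs_bulkSemicircle_le (lam : ℝ) (hlam : 0 < lam) : ∃ A, 0 ≤ A ∧ ∀ (f : ℝ → ℝ) δ,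
    (∀ x ∈ Icc (-1 : ℝ) 1, |f x| ≤ δ) → |bulkSemicircle lam f| ≤ A * δ := by
  have he := Real.exp_pos (-lam)
  have he1 : Real.exp (-lam) < 1 := by simpa using hlam
  refine ⟨1 / (4 * Real.exp (-lam)) * 2 * (1 - Real.exp (-lam)),
    mul_nonneg (by positivity) (by linarith), fun f δ hf => ?_⟩
  have hδ : 0 ≤ δ := (abs_nonneg _).trans (hf 0 (by norm_num))
  have := norm_setIntegral_le_of_norm_le_const (μ := volume) (s := Ioo 0 (1 - Real.exp (-lam)))
    (f := fun t => 1 / (4 * (1 - t)) * semicircle f (arcWidth t))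
    (C := 1 / (4 * Real.exp (-lam)) * (2 * δ)) (by simp) fun t ht => by
      have h1 : Real.exp (-lam) ≤ 1 - t := by linarith [ht.2]
      have h2 : 0 < 1 - t := by linarith
      rw [norm_mul, Real.norm_eq_abs, Real.norm_eq_abs, abs_of_nonneg (by positivity)]
      have := abs_semicircle_le hf (arcWidth_pos ht.1 (by linarith)).le
        (arcWidth_le_one ht.1.le (by linarith))
      gcongr
  refine this.trans_eq ?_
  rw [Real.volume_real_Ioo_of_le (by linarith)]
  ring

/-- Only the iterates of the Euler operator up to the third enter, so the regularised value is a
distribution of order at most three. -/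
theorem abs_regValue_le {lam : ℝ} (hlam : 0 < lam) : ∃ A, 0 ≤ A ∧ ∀ (f : ℝ → ℝ) δ,
    (∀ i ≤ 3, ∀ x ∈ Icc (-1 : ℝ) 1, |eulerOp^[i] f x| ≤ δ) → |regValue lam f| ≤ A * δ := by
  obtain ⟨A, hA, hA'⟩ := abs_bulkSemicircle_le lam hlam
  set c1 := -(1 / Real.pi * lam * (Real.exp (-lam) * (1 - Real.exp (-lam)) / 2))
  set c2 := 1 / edge lam ^ 4
  set c3 := 2 * Real.exp (-lam)
  set c4 := (edge lam ^ 2 - 2 * Real.exp (-lam)) / 3 with hc4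
  set c5 := 1 / Real.pi * (lam / 3)
  refine ⟨|c1| * (|c2| * (|c3| * 2 + |c4| * 2 + |c3| * 2 + |c4| * 2)) +
    |c5| * (1 / 2 * (A + A + A + A)), by positivity, fun f δ hf => ?_⟩
  have s := fun i (hi : i ≤ 3) => abs_semicircle_le (hf i hi) (edge_pos hlam).le (edge_le_one hlam)
  have b := fun i (hi : i ≤ 3) => hA' _ δ (hf i hi)
  have s0 := s 0 (by norm_num); have s1 := s 1 (by norm_num); have s2 := s 2 (by norm_num)
  have s3 := s 3 le_rfl
  have b0 := b 0 (by norm_num); have b1 := b 1 (by norm_num); have b2 := b 2 (by norm_num)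
  have b3 := b 3 le_rfl
  simp only [Function.iterate_zero, id] at s0 b0
  have t1 : ∀ x0 x1 x2 x3 : ℝ, |x0| ≤ 2 * δ → |x1| ≤ 2 * δ → |x2| ≤ 2 * δ → |x3| ≤ 2 * δ →
      |-c3 * x0 - c4 * x1 + c3 * x2 + c4 * x3| ≤
        |c3| * (2 * δ) + |c4| * (2 * δ) + |c3| * (2 * δ) + |c4| * (2 * δ) := by
    intro x0 x1 x2 x3 h0 h1 h2 h3
    refine (abs_add_le _ _).trans (add_le_add ((abs_add_le _ _).trans (add_le_add
      ((abs_sub _ _).trans (add_le_add ?_ ?_)) ?_)) ?_) <;> rw [abs_mul] <;> try rw [abs_neg]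
    all_goals gcongr
  have t2 : ∀ x0 x1 x2 x3 : ℝ, |x0| ≤ A * δ → |x1| ≤ A * δ → |x2| ≤ A * δ → |x3| ≤ A * δ →
      |1 / 2 * (x0 - x1 - x2 + x3)| ≤ 1 / 2 * (A * δ + A * δ + A * δ + A * δ) := by
    intro x0 x1 x2 x3 h0 h1 h2 h3
    rw [abs_mul, abs_of_pos (by norm_num : (0 : ℝ) < 1 / 2)]
    gcongr
    exact (abs_add_le _ _).trans (add_le_add ((abs_sub _ _).trans (add_le_add
      ((abs_sub _ _).trans (add_le_add h0 h1)) h2)) h3)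
  have u1 := t1 _ _ _ _ s0 s1 s2 s3
  have u2 := t2 _ _ _ _ b0 b1 b2 b3
  rw [regValue]
  refine (abs_sub _ _).trans ?_
  rw [abs_mul, abs_mul c2, abs_mul c5]
  calc _ ≤ |c1| * (|c2| * (|c3| * (2 * δ) + |c4| * (2 * δ) + |c3| * (2 * δ) + |c4| * (2 * δ))) +
        |c5| * (1 / 2 * (A * δ + A * δ + A * δ + A * δ)) := by gcongr
    _ = _ := by ring

/-! ### Values on monomials -/

theorem integral_cos_pow_even (n : ℕ) :
    ∫ θ in (0 : ℝ)..Real.pi, Real.cos θ ^ (2 * n) = Real.pi * sinMean n := by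
  induction n with
  | zero => simp [sinMean]
  | succ n ih =>
    rw [show 2 * (n + 1) = 2 * n + 2 by ring, integral_cos_pow, ih, sinMean_succ]
    simp only [Real.sin_pi, Real.sin_zero]
    push_cast
    ring

theorem integral_cos_pow_odd (n : ℕ) :
    ∫ θ in (0 : ℝ)..Real.pi, Real.cos θ ^ (2 * n + 1) = 0 := by
  induction n with
  | zero => simp
  | succ n ih =>
    rw [show 2 * (n + 1) + 1 = 2 * n + 1 + 2 by ring, integral_cos_pow, ih]
    simp

theorem integral_mul_sqrt_one_sub_sq {g : ℝ → ℝ} (hg : Continuous g) :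
    ∫ r in (-1 : ℝ)..1, g r * √(1 - r ^ 2) =
      ∫ θ in (0 : ℝ)..Real.pi, g (Real.cos θ) * (1 - Real.cos θ ^ 2) := by
  have := intervalIntegral.integral_comp_mul_deriv (a := 0) (b := Real.pi) (f := Real.cos)
    (f' := fun θ => -Real.sin θ) (g := fun r => g r * √(1 - r ^ 2))
    (fun θ _ => Real.hasDerivAt_cos θ) (by fun_prop) (by fun_prop)
  rw [Real.cos_zero, Real.cos_pi, intervalIntegral.integral_symm (-1) 1] at this
  rw [← neg_neg (∫ r in (-1 : ℝ)..1, g r * √(1 - r ^ 2)), ← this, ← intervalIntegral.integral_neg]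
  refine intervalIntegral.integral_congr fun θ hθ => ?_
  rw [uIcc_of_le Real.pi_nonneg] at hθ
  have hs := Real.sin_nonneg_of_mem_Icc hθ
  have e : 1 - Real.cos θ ^ 2 = Real.sin θ ^ 2 := by rw [Real.sin_sq]
  simp only [Function.comp_apply]
  rw [e, Real.sqrt_sq hs]; ring

/-- With r = cos θ the moment is π times the difference of two consecutive even cosine means. -/
theorem semicircle_pow_even (n : ℕ) (a : ℝ) : semicircle (fun x => x ^ (2 * n)) a =
    (a ^ 2) ^ n * (Real.pi * sinMean n / (2 * n + 2)) := by
  have e : semicircle (fun x => x ^ (2 * n)) a =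
      (a ^ 2) ^ n * ∫ r in (-1 : ℝ)..1, r ^ (2 * n) * √(1 - r ^ 2) := by
    rw [semicircle, ← intervalIntegral.integral_const_mul]
    congr 1; ext r
    rw [mul_pow, pow_mul a]; ring
  rw [e, integral_mul_sqrt_one_sub_sq (by fun_prop)]
  congr 1
  simp_rw [mul_sub, mul_one, ← pow_add]
  rw [intervalIntegral.integral_sub, integral_cos_pow_even,
    show 2 * n + 2 = 2 * (n + 1) by ring, integral_cos_pow_even, sinMean_succ]
  · field_simp; ring
  all_goals exact Continuous.intervalIntegrable (by fun_prop) _ _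

theorem semicircle_pow_odd (n : ℕ) (a : ℝ) : semicircle (fun x => x ^ (2 * n + 1)) a = 0 := by
  have e : semicircle (fun x => x ^ (2 * n + 1)) a =
      a ^ (2 * n + 1) * ∫ r in (-1 : ℝ)..1, r ^ (2 * n + 1) * √(1 - r ^ 2) := by
    rw [semicircle, ← intervalIntegral.integral_const_mul]
    congr 1; ext r
    rw [mul_pow]; ring
  rw [e, integral_mul_sqrt_one_sub_sq (by fun_prop)]
  simp_rw [mul_sub, mul_one, ← pow_add]
  rw [intervalIntegral.integral_sub, integral_cos_pow_odd,
    show 2 * n + 1 + 2 = 2 * (n + 1) + 1 by ring, integral_cos_pow_odd]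
  · simp
  all_goals exact Continuous.intervalIntegrable (by fun_prop) _ _

/-- Monomials are eigenfunctions of the Euler operator, which makes the regularised value explicit
on them. -/
theorem iterate_eulerOp_pow (m i : ℕ) :
    eulerOp^[i] (fun x => x ^ m) = fun x => ((m : ℝ) + 1) ^ i * x ^ m := by
  induction i with
  | zero => simp
  | succ i ih =>
    rw [Function.iterate_succ_apply', ih, eulerOp_mul _ (by fun_prop)]
    ext x
    rcases m with _ | m
    · simp [eulerOp]
    · simp only [eulerOp, deriv_pow_field]
      rw [Nat.add_sub_cancel, pow_succ ((_ : ℝ) + 1) i, pow_succ x m]; ring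

theorem regValue_pow_odd (lam : ℝ) (n : ℕ) : regValue lam (fun x => x ^ (2 * n + 1)) = 0 := by
  simp only [regValue, iterate_eulerOp_pow, semicircle_mul, bulkSemicircle_mul, semicircle_pow_odd]
  simp [bulkSemicircle, semicircle_pow_odd]

/-- The substitution t = 1 - e^{-λτ}, dt = λ(1-t) dτ, connects the t-integrals of the limit
densities with the τ-integrals of the midpoint rule. -/
theorem integral_comp_one_sub_exp {lam : ℝ} (n : ℕ) :
    ∫ t in (0 : ℝ)..(1 - Real.exp (-lam)), 1 / (1 - t) * (4 * t * (1 - t)) ^ n =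
      lam * ∫ τ in (0 : ℝ)..1, (4 * (Real.exp (-lam * τ) * (1 - Real.exp (-lam * τ)))) ^ n := by
  have d : ∀ τ : ℝ, HasDerivAt (fun τ => 1 - Real.exp (-lam * τ)) (lam * Real.exp (-lam * τ)) τ :=
    fun τ => by
      have : HasDerivAt (fun τ => Real.exp (-lam * τ)) (Real.exp (-lam * τ) * (-lam)) τ := by
        simpa using ((hasDerivAt_id τ).const_mul (-lam)).exp
      exact (this.const_sub 1).congr_deriv (by ring)
  have s := intervalIntegral.integral_comp_mul_deriv' (a := 0) (b := 1)
    (f := fun τ => 1 - Real.exp (-lam * τ)) (f' := fun τ => lam * Real.exp (-lam * τ))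
    (g := fun t => 1 / (1 - t) * (4 * t * (1 - t)) ^ n) (fun τ _ => d τ) (by fun_prop) (by
      refine ContinuousOn.mul (continuousOn_const.div (by fun_prop) ?_) (by fun_prop)
      rintro _ ⟨τ, -, rfl⟩
      have := Real.exp_pos (-lam * τ)
      simp)
  simp only [mul_zero, Real.exp_zero, sub_self, mul_one, Function.comp_def] at s
  rw [← s, ← intervalIntegral.integral_const_mul]
  refine intervalIntegral.integral_congr fun τ _ => ?_
  have := Real.exp_pos (-lam * τ)
  rw [sub_sub_cancel, show 4 * (1 - Real.exp (-lam * τ)) * Real.exp (-lam * τ) =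
    4 * (Real.exp (-lam * τ) * (1 - Real.exp (-lam * τ))) by ring]
  field_simp

theorem bulkSemicircle_pow_even {lam : ℝ} (hlam : 0 < lam) (n : ℕ) :
    bulkSemicircle lam (fun x => x ^ (2 * n)) = lam / 4 * (Real.pi * sinMean n / (2 * n + 2)) *
      ∫ τ in (0 : ℝ)..1, (4 * (Real.exp (-lam * τ) * (1 - Real.exp (-lam * τ)))) ^ n := by
  have he := Real.exp_pos (-lam)
  have he1 : Real.exp (-lam) < 1 := by simpa using hlam
  rw [bulkSemicircle, ← integral_Ioc_eq_integral_Ioo, ← intervalIntegral.integral_of_le (by linarith)]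
  have e : ∫ t in (0 : ℝ)..(1 - Real.exp (-lam)), 1 / (4 * (1 - t)) *
      semicircle (fun x => x ^ (2 * n)) (arcWidth t) =
      (1 / 4 * (Real.pi * sinMean n / (2 * n + 2))) *
        ∫ t in (0 : ℝ)..(1 - Real.exp (-lam)), 1 / (1 - t) * (4 * t * (1 - t)) ^ n := by
    rw [← intervalIntegral.integral_const_mul]
    refine intervalIntegral.integral_congr fun t ht => ?_
    rw [uIcc_of_le (by linarith)] at ht
    have h1 : 1 - t ≠ 0 := by linarith [ht.2]
    rw [semicircle_pow_even, arcWidth_sq ht.1 (by linarith [ht.2])]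
    field_simp
  rw [e, integral_comp_one_sub_exp]
  ring

end DiscreteQGUE

/-! ### The coefficient of N⁻² and the regularised value agree on monomials. -/

namespace DiscreteQGUE

open MeasureTheory Set Polynomial

theorem sq_edge {lam : ℝ} (hlam : 0 < lam) :
    edge lam ^ 2 = 4 * (Real.exp (-lam) * (1 - Real.exp (-lam))) := by
  have he := Real.exp_pos (-lam)
  have he1 : Real.exp (-lam) < 1 := by simpa using hlam
  rw [edge_eq_arcWidth, arcWidth_sq (by linarith) (by linarith)]; ring

/-- The prefactor contains e^{-λ}(1-e^{-λ}) = b²/4, with b the edge, and together with b⁻⁴ it lowers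
b^{2(n+1)} to b^{2n}. The constant monomial, which gives 0, is left to `regValue_eval`. -/
theorem regValue_pow_even {lam : ℝ} (hlam : 0 < lam) (n : ℕ) :
    regValue lam (fun x => x ^ (2 * (n + 1))) =
      -(lam / 12) * sinMean (n + 1) * (n + 1) *
        ((2 * n + 3) * (4 * (Real.exp (-lam) * (1 - Real.exp (-lam)))) ^ (n + 1) -
          4 * n * Real.exp (-lam) * (4 * (Real.exp (-lam) * (1 - Real.exp (-lam)))) ^ n) -
      lam ^ 2 / 6 * sinMean (n + 1) * (n + 1) ^ 2 *
        ∫ τ in (0 : ℝ)..1, (4 * (Real.exp (-lam * τ) * (1 - Real.exp (-lam * τ)))) ^ (n + 1) := by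
  have he := Real.exp_pos (-lam)
  have he1 : Real.exp (-lam) < 1 := by simpa using hlam
  have hv : Real.exp (-lam) * (1 - Real.exp (-lam)) ≠ 0 := by
    have : 0 < 1 - Real.exp (-lam) := by linarith
    positivity
  have e4 : edge lam ^ 4 = (edge lam ^ 2) ^ 2 := by ring
  simp only [regValue, iterate_eulerOp_pow, semicircle_mul, bulkSemicircle_mul,
    semicircle_pow_even, bulkSemicircle_pow_even hlam, e4, sq_edge hlam]
  set I := ∫ τ in (0 : ℝ)..1, (4 * (Real.exp (-lam * τ) * (1 - Real.exp (-lam * τ)))) ^ (n + 1)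
  set y := Real.exp (-lam)
  push_cast
  rw [pow_succ (4 * (y * (1 - y))) n]
  have h1 : 1 - y ≠ 0 := by linarith
  have hn : (2 * ((n : ℝ) + 1) + 2) ≠ 0 := by positivity
  field_simp
  ring

theorem hasDerivAt_varPow (n : ℕ) (y : ℝ) : HasDerivAt (fun y : ℝ => (4 * (y * (1 - y))) ^ (n + 1))
    ((n + 1) * (4 * (y * (1 - y))) ^ n * (4 * (1 - 2 * y))) y := by
  have h : HasDerivAt (fun y : ℝ => 4 * (y * (1 - y))) (4 * (1 - 2 * y)) y := by
    refine (((hasDerivAt_id' y).mul ((hasDerivAt_id' y).const_sub 1)).const_mul 4).congr_deriv ?_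
    ring
  refine (h.pow (n + 1)).congr_deriv ?_
  push_cast; simp

theorem eval_expDeriv_meanPoly_monomial (lam : ℝ) (n : ℕ) (y : ℝ) :
    (expDeriv lam (meanPoly (monomial (n + 1) 1))).eval y =
      -lam * (y * (sinMean (n + 1) * (n + 1) * (4 * (y * (1 - y))) ^ n * (4 * (1 - 2 * y)))) := by
  have h : (derivative (meanPoly (monomial (n + 1) 1))).eval y =
      sinMean (n + 1) * ((n + 1) * (4 * (y * (1 - y))) ^ n * (4 * (1 - 2 * y))) := by
    have h1 := (meanPoly (monomial (n + 1) 1)).hasDerivAt y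
    have h2 := (hasDerivAt_varPow n y).const_mul (sinMean (n + 1))
    refine h1.unique (h2.congr_of_eventuallyEq (Filter.Eventually.of_forall fun z => ?_))
    simp only [eval_meanPoly, arcsineMean_monomial, mul_one]
  simp only [expDeriv, eval_smul, eval_mul, eval_X, h, smul_eq_mul]
  ring

/-- In the variable y = e^{-λτ} one has dτ = -dy/(λy). The function g is a primitive, with respect
to dy/y, of the correction plus (n+1)²/6 times the arcsine moment. So the integral of the correction
is the bulk term of the regularised value plus boundary terms, and these merge with the endpoint
term of the midpoint rule. -/
theorem limitCorrection_monomial (lam : ℝ) (n : ℕ) :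
    limitCorrection lam (monomial (n + 1) 1) =
      -(lam / 12) * sinMean (n + 1) * (n + 1) *
        ((2 * n + 3) * (4 * (Real.exp (-lam) * (1 - Real.exp (-lam)))) ^ (n + 1) -
          4 * n * Real.exp (-lam) * (4 * (Real.exp (-lam) * (1 - Real.exp (-lam)))) ^ n) -
      lam ^ 2 / 6 * sinMean (n + 1) * (n + 1) ^ 2 *
        ∫ τ in (0 : ℝ)..1, (4 * (Real.exp (-lam * τ) * (1 - Real.exp (-lam * τ)))) ^ (n + 1) := by
  set β := sinMean (n + 1) with hβ
  let g : ℝ → ℝ := fun y => β * (n + 1) / 6 * (y * (1 - 2 * y)) * (4 * (y * (1 - y))) ^ n +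
    β * (n + 1) / 12 * ((2 * n + 3) * (4 * (y * (1 - y))) ^ (n + 1) -
      4 * n * (y * (4 * (y * (1 - y))) ^ n))
  let g' : ℝ → ℝ := fun y => (correctionPoly (monomial (n + 1) 1)).eval y +
    (n + 1) ^ 2 / 6 * β * (4 * (y * (1 - y))) ^ (n + 1)
  have hg : ∀ y, y ≠ 0 → HasDerivAt g (g' y / y) y := by
    intro y hy
    have i := hasDerivAt_id' y
    have q : HasDerivAt (fun y : ℝ => y * (1 - 2 * y)) (1 - 4 * y) y := by
      refine (i.mul ((i.const_mul 2).const_sub 1)).congr_deriv ?_; ring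
    simp only [g, g', eval_correctionPoly, meanCorrection_monomial, ← hβ]
    rcases n with _ | n
    · have w := hasDerivAt_varPow 0 y
      simp only [Nat.cast_zero, zero_add, pow_zero, mul_one, pow_one, mul_zero, zero_mul, sub_zero] at w ⊢
      refine ((q.const_mul _).add ((w.const_mul _).const_mul _)).congr_deriv ?_
      field_simp
      simp
      ring
    · have w0 := hasDerivAt_varPow n y
      have w1 := hasDerivAt_varPow (n + 1) y
      refine (((q.const_mul _).mul w0).add (((w1.const_mul _).sub
        ((i.mul w0).const_mul _)).const_mul _)).congr_deriv ?_
      rw [show n + 1 + 1 - 1 = n + 1 from rfl, show n + 1 + 1 - 2 = n from rfl]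
      push_cast
      field_simp
      ring
  have hτ : ∀ τ ∈ uIcc (0 : ℝ) 1, HasDerivAt (fun τ => g (Real.exp (-lam * τ)))
      (-lam * g' (Real.exp (-lam * τ))) τ := by
    intro τ _
    have h : HasDerivAt (fun τ => Real.exp (-lam * τ)) (Real.exp (-lam * τ) * (-lam)) τ := by
      simpa using ((hasDerivAt_id τ).const_mul (-lam)).exp
    refine ((hg (Real.exp (-lam * τ)) (Real.exp_pos _).ne').comp τ h).congr_deriv ?_
    field_simp
  have ftc := intervalIntegral.integral_eq_sub_of_hasDerivAt hτ
    (Continuous.intervalIntegrable (by fun_prop) _ _)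
  rw [intervalIntegral.integral_const_mul] at ftc
  simp only [g'] at ftc
  rw [intervalIntegral.integral_add (Continuous.intervalIntegrable (by fun_prop) _ _)
    (Continuous.intervalIntegrable (by fun_prop) _ _), intervalIntegral.integral_const_mul] at ftc
  simp only [g, mul_one, mul_zero, Real.exp_zero] at ftc
  rw [limitCorrection, eval_expDeriv_meanPoly_monomial, eval_expDeriv_meanPoly_monomial]
  -- At y = 1 the variable v is 0; the factor n takes care of 0 ^ 0 = 1.
  have z : (n : ℝ) * (4 * (1 * (1 - 1))) ^ n = 0 := by
    rcases n with _ | n <;> simp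
  linear_combination (-lam) * ftc - (lam / 3) * β * (n + 1) * z

end DiscreteQGUE

namespace DiscreteQGUE

open MeasureTheory Set

/-! ### The leading density as an integral of arcsine laws -/

/-- The density of the arcsine law at `t`, with the weight of `t`. -/
noncomputable def arcKernel (lam : ℝ) (p : ℝ × ℝ) : ℝ :=
  1 / (lam * Real.pi * (1 - p.2)) * (√(4 * p.2 * (1 - p.2) - p.1 ^ 2))⁻¹

theorem measurable_arcKernel (lam : ℝ) : Measurable (arcKernel lam) := by
  unfold arcKernel; fun_prop

/-- The function is the nonnegative derivative of arcsin(x/a), which is continuous up to the end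
points, so no estimate of the singularities is needed. -/
theorem integrableOn_inv_sqrt {a : ℝ} (ha : 0 < a) :
    IntegrableOn (fun x => (√(a ^ 2 - x ^ 2))⁻¹) (Ioo (-a) a) := by
  refine (intervalIntegral.integrableOn_deriv_of_nonneg (a := -a) (b := a)
    (g := fun x => Real.arcsin (x / a)) (Continuous.continuousOn
      (Real.continuous_arcsin.comp (by fun_prop))) (fun x hx => ?_)
    (fun x _ => inv_nonneg.2 (Real.sqrt_nonneg _))).mono_set Ioo_subset_Ioc_self
  have h1 : -1 < x / a := by rw [lt_div_iff₀ ha]; linarith [hx.1]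
  have h2 : x / a < 1 := by rw [div_lt_one ha]; exact hx.2
  have h := (Real.hasDerivAt_arcsin h1.ne' h2.ne).comp x ((hasDerivAt_id' x).div_const a)
  refine h.congr_deriv ?_
  have e : a ^ 2 - x ^ 2 = a ^ 2 * (1 - (x / a) ^ 2) := by field_simp
  rw [e, Real.sqrt_mul (by positivity), Real.sqrt_sq ha.le, mul_inv]
  ring

theorem integral_mul_inv_sqrt {a : ℝ} (ha : 0 < a) (f : ℝ → ℝ) :
    ∫ x in Ioo (-a) a, f x * (√(a ^ 2 - x ^ 2))⁻¹ =
      ∫ θ in (0 : ℝ)..Real.pi, f (a * Real.cos θ) := by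
  rw [← Polynomial.Chebyshev.integral_measureT_eq_integral_cos (f := fun x => f (a * x)),
    Polynomial.Chebyshev.integral_measureT, integral_Ioo_scale ha, smul_eq_mul,
    ← intervalIntegral.integral_const_mul]
  congr 1; ext r
  rw [show a ^ 2 - (a * r) ^ 2 = a ^ 2 * (1 - r ^ 2) by ring, Real.sqrt_mul (by positivity),
    Real.sqrt_sq ha.le, mul_inv, Real.sqrt_inv]
  field_simp

section
variable {lam : ℝ} (hlam : 0 < lam)
include hlam

omit hlam in
theorem integral_mul_arcKernel (f : ℝ → ℝ) {t : ℝ} (ht : t ∈ Ioo 0 (1 - Real.exp (-lam))) :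
    ∫ x in Ioo (-arcWidth t) (arcWidth t), f x * arcKernel lam (x, t) =
      1 / (lam * Real.pi * (1 - t)) *
        ∫ θ in (0 : ℝ)..Real.pi, f (arcWidth t * Real.cos θ) := by
  have h1 : t < 1 := by linarith [ht.2, Real.exp_pos (-lam)]
  rw [← integral_mul_inv_sqrt (arcWidth_pos ht.1 h1), ← integral_const_mul]
  congr 1; ext x
  rw [arcKernel, arcWidth_sq ht.1.le h1.le]
  ring

theorem arcKernel_nonneg {p : ℝ × ℝ} (hp : p ∈ arcRegion lam) : 0 ≤ arcKernel lam p := by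
  have := (arcRegion_subset lam hp).2.2
  have h : 0 < 1 - p.2 := by linarith
  unfold arcKernel; positivity

/-- Tonelli: the kernel is nonnegative and its slice at t has mass 1/(λ(1-t)), which is bounded
since t < 1 - e^{-λ}. -/
theorem integrableOn_arcKernel : IntegrableOn (arcKernel lam) (arcRegion lam) := by
  have he := Real.exp_pos (-lam)
  have he1 : Real.exp (-lam) < 1 := by simpa using hlam
  rw [← integrable_indicator_iff (measurableSet_arcRegion lam), Measure.volume_eq_prod,
    integrable_prod_iff' ((measurable_arcKernel lam).indicator
      (measurableSet_arcRegion lam)).aestronglyMeasurable]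
  refine ⟨Filter.Eventually.of_forall fun t => ?_, ?_⟩
  · by_cases ht : t ∈ Ioo 0 (1 - Real.exp (-lam))
    · have h1 : t < 1 := by linarith [ht.2]
      have hi := (integrableOn_inv_sqrt (arcWidth_pos ht.1 h1)).const_mul
        (1 / (lam * Real.pi * (1 - t)))
      rw [arcWidth_sq ht.1.le h1.le] at hi
      have := IntegrableOn.integrable_indicator hi measurableSet_Ioo
      refine this.congr (Filter.Eventually.of_forall fun x => ?_)
      simp only [indicator, mem_arcRegion_iff, ht, true_and, arcKernel]
    · simp only [indicator, mem_arcRegion_iff, ht, false_and, if_false]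
      exact integrable_zero _ _ _
  · simp_rw [norm_indicator_eq_indicator_norm]
    have e : (fun t => ∫ x, (arcRegion lam).indicator (fun p => ‖arcKernel lam p‖) (x, t)) =
        (Ioo 0 (1 - Real.exp (-lam))).indicator (fun t => 1 / (lam * (1 - t))) := by
      ext t
      rw [integral_indicator_arcRegion_right]
      by_cases ht : t ∈ Ioo 0 (1 - Real.exp (-lam))
      · have h1 : 1 - t ≠ 0 := by linarith [ht.2]
        rw [indicator_of_mem ht, indicator_of_mem ht]
        have := integral_mul_arcKernel (fun _ => 1) ht
        simp only [one_mul, intervalIntegral.integral_const, sub_zero, smul_eq_mul, mul_one] at this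
        rw [setIntegral_congr_fun measurableSet_Ioo fun x hx => ?_, this]
        · field_simp
        · exact Real.norm_of_nonneg (arcKernel_nonneg hlam ((mem_arcRegion_iff x t).2 ⟨ht, hx⟩))
      · rw [indicator_of_notMem ht, indicator_of_notMem ht]
    rw [e, integrable_indicator_iff measurableSet_Ioo]
    have : ContinuousOn (fun t => 1 / (lam * (1 - t))) (Icc 0 (1 - Real.exp (-lam))) := by
      refine continuousOn_const.div (by fun_prop) fun t ht => ?_
      have : 0 < 1 - t := by linarith [ht.2]
      positivity
    exact this.integrableOn_Icc.mono_set Ioo_subset_Icc_self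

theorem integrableOn_mul_arcKernel {f : ℝ → ℝ} (hf : Continuous f) :
    IntegrableOn (fun p : ℝ × ℝ => f p.1 * arcKernel lam p) (arcRegion lam) := by
  obtain ⟨C, hC⟩ := isCompact_Icc.exists_bound_of_continuousOn (s := Icc (-1 : ℝ) 1)
    hf.continuousOn
  have hfm := hf.measurable
  have hk := measurable_arcKernel lam
  refine Integrable.mono' ((integrableOn_arcKernel hlam).const_mul C)
    (Measurable.aestronglyMeasurable (by fun_prop)) ?_
  refine (ae_restrict_iff' (measurableSet_arcRegion lam)).2 (Filter.Eventually.of_forall fun p hp => ?_)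
  rw [norm_mul, Real.norm_of_nonneg (arcKernel_nonneg hlam hp)]
  exact mul_le_mul_of_nonneg_right (hC _ (Ioo_subset_Icc_self (arcRegion_subset lam hp).1))
    (arcKernel_nonneg hlam hp)

/-- The integral of the kernel over an interval of `t`. -/
theorem integral_arcKernel {x u : ℝ} (hx0 : x ≠ 0) (hx : |x| < 1) (h1 : 1 / 2 - xStar x < u)
    (h2 : u ≤ 1 / 2 + xStar x) : ∫ t in Ioo (1 / 2 - xStar x) u, arcKernel lam (x, t) =
      1 / (lam * Real.pi * |x|) *
        (Real.arcsin ((2 * u - 1 - (1 - x ^ 2)) / (√(1 - x ^ 2) * (2 * (1 - u)))) + Real.pi / 2) := by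
  set w := 1 - x ^ 2 with hw
  set r := √w with hr
  have hxp : 0 < |x| := abs_pos.2 hx0
  have hx2 : x ^ 2 < 1 := by rw [← sq_abs]; nlinarith
  have hx2' : 0 < x ^ 2 := by positivity
  have hw0 : 0 < w := by linarith
  have hr0 : 0 < r := Real.sqrt_pos.2 hw0
  have hr2 : r ^ 2 = w := Real.sq_sqrt hw0.le
  have hr1 : r < 1 := by nlinarith
  have hxs : xStar x = 1 / 2 * r := rfl
  rw [hxs] at h1 h2 ⊢
  have hU : ∀ t, t ≤ 1 / 2 + 1 / 2 * r → 0 < 1 - t := fun t ht => by linarith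
  -- The integrand is 1/((1-t)√(quadratic)), so its primitive is the arcsine of a Möbius function of
  -- t; that function equals -1 at the lower end of the range.
  have hcont : ContinuousOn (fun t => 1 / (lam * Real.pi * |x|) *
      Real.arcsin ((2 * t - 1 - w) / (r * (2 * (1 - t))))) (Icc (1 / 2 - 1 / 2 * r) u) := by
    refine continuousOn_const.mul (Real.continuous_arcsin.comp_continuousOn
      (ContinuousOn.div (by fun_prop) (by fun_prop) fun t ht => ?_))
    have := hU t (ht.2.trans h2)
    positivity
  have hder : ∀ t ∈ Ioo (1 / 2 - 1 / 2 * r) u, HasDerivAt (fun t => 1 / (lam * Real.pi * |x|) *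
      Real.arcsin ((2 * t - 1 - w) / (r * (2 * (1 - t))))) (arcKernel lam (x, t)) t := by
    intro t ht
    have h1t := hU t (ht.2.le.trans h2)
    have hD : 0 < 4 * t * (1 - t) - x ^ 2 := by
      have a1 : -r < 2 * t - 1 := by linarith [ht.1]
      have a2 : 2 * t - 1 < r := by linarith [ht.2]
      have := sq_lt_sq' a1 a2
      nlinarith
    set S := √(4 * t * (1 - t) - x ^ 2) with hS
    have hS0 : 0 < S := Real.sqrt_pos.2 hD
    have hS2 : S ^ 2 = 4 * t * (1 - t) - x ^ 2 := Real.sq_sqrt hD.le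
    have hsq : 1 - ((2 * t - 1 - w) / (r * (2 * (1 - t)))) ^ 2 =
        (|x| * S / (r * (2 * (1 - t)))) ^ 2 := by
      rw [div_pow, div_pow, mul_pow (|x|), mul_pow r, hr2, sq_abs, hS2,
        show x ^ 2 = 1 - w by linarith]
      field_simp
      ring
    have hlt : ((2 * t - 1 - w) / (r * (2 * (1 - t)))) ^ 2 < 1 := by
      have : 0 < (|x| * S / (r * (2 * (1 - t)))) ^ 2 := by positivity
      linarith
    have hab := abs_lt.1 ((sq_lt_one_iff_abs_lt_one _).1 hlt)
    have hq : HasDerivAt (fun t => (2 * t - 1 - w) / (r * (2 * (1 - t))))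
        (x ^ 2 / (2 * r * (1 - t) ^ 2)) t := by
      have i := hasDerivAt_id' t
      refine ((((i.const_mul 2).sub_const 1).sub_const w).div
        (((i.const_sub 1).const_mul 2).const_mul r) (by positivity)).congr_deriv ?_
      rw [hw]
      field_simp
      ring
    refine (((Real.hasDerivAt_arcsin hab.1.ne' hab.2.ne).comp t hq).const_mul _).congr_deriv ?_
    rw [hsq, Real.sqrt_sq (by positivity), arcKernel, ← hS, ← sq_abs x]
    field_simp
  have hint := intervalIntegral.integrableOn_deriv_of_nonneg hcont hder fun t ht => by
    have := hU t (ht.2.le.trans h2)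
    unfold arcKernel; positivity
  rw [← integral_Ioc_eq_integral_Ioo, ← intervalIntegral.integral_of_le h1.le,
    intervalIntegral.integral_eq_sub_of_hasDerivAt_of_le h1.le hcont hder
      ((intervalIntegrable_iff_integrableOn_Ioc_of_le h1.le).2 hint)]
  have hl : (2 * (1 / 2 - 1 / 2 * r) - 1 - w) / (r * (2 * (1 - (1 / 2 - 1 / 2 * r)))) = -1 := by
    have : 0 < 1 + r := by linarith
    rw [← hr2, show 2 * (1 - (1 / 2 - 1 / 2 * r)) = 1 + r by ring, div_eq_iff (by positivity)]
    ring
  rw [hl, Real.arcsin_neg_one]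
  ring

end

/-- Multiplication by the conjugate of the denominator gives (A² - x² + S²) + 2ixS, of modulus c.
Its argument is the arccosine of the normalised real part, with the sign of x; dividing by x makes
the expression even. -/
theorem arg_edge_quotient {A x S c : ℝ} (hx : x ≠ 0) (hS : 0 < S) (hc : 0 < c)
    (h : (A ^ 2 - x ^ 2 + S ^ 2) ^ 2 + (2 * x * S) ^ 2 = c ^ 2) :
    1 / x * Complex.arg (((A - x : ℝ) + Complex.I * (S : ℝ)) / ((A + x : ℝ) + Complex.I * (S : ℝ))) =
      1 / |x| * (Real.pi / 2 - Real.arcsin ((A ^ 2 - x ^ 2 + S ^ 2) / c)) := by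
  set M := A ^ 2 - x ^ 2 + S ^ 2
  set D := (A + x) ^ 2 + S ^ 2 with hD
  have hD0 : 0 < D := by positivity
  have hDc : ((A + x : ℝ) + Complex.I * (S : ℝ) : ℂ) ≠ 0 := fun h => by
    have := congrArg Complex.im h
    simp at this; exact hS.ne' this
  have hm1 : -1 ≤ M / c := by
    rw [le_div_iff₀ hc]; nlinarith [sq_nonneg (2 * x * S), sq_nonneg (M + c)]
  have hm2 : M / c ≤ 1 := by
    rw [div_le_one hc]; nlinarith [sq_nonneg (2 * x * S)]
  set φ := Real.arccos (M / c) with hφ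
  have hcos : Real.cos φ = M / c := Real.cos_arccos hm1 hm2
  have hsin : Real.sin φ = 2 * |x| * S / c := by
    rw [hφ, Real.sin_arccos]
    have e : 1 - (M / c) ^ 2 = (2 * |x| * S / c) ^ 2 := by
      rw [div_pow, div_pow, mul_pow, mul_pow, sq_abs]
      field_simp
      linear_combination -h
    rw [e, Real.sqrt_sq (by positivity)]
  have h0 : 0 ≤ φ := Real.arccos_nonneg _
  -- Strictness matters for x < 0, because -π is not a principal argument.
  have hπ : φ < Real.pi := by
    refine lt_of_le_of_ne (Real.arccos_le_pi _) fun hc' => ?_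
    have : Real.sin φ = 0 := by rw [hc', Real.sin_pi]
    rw [hsin] at this
    have h3 : 0 < 2 * |x| * S / c := by have := abs_pos.2 hx; positivity
    linarith
  have arg : Complex.arg (((A - x : ℝ) + Complex.I * (S : ℝ)) / ((A + x : ℝ) + Complex.I * (S : ℝ))) =
      x / |x| * φ := by
    have hxa := abs_pos.2 hx
    have e : (((A - x : ℝ) + Complex.I * (S : ℝ)) / ((A + x : ℝ) + Complex.I * (S : ℝ)) : ℂ) =
        ((c / D : ℝ) : ℂ) * (Complex.cos ((x / |x| * φ : ℝ) : ℂ) +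
          Complex.sin ((x / |x| * φ : ℝ) : ℂ) * Complex.I) := by
      have hcs : Real.cos (x / |x| * φ) = M / c ∧ Real.sin (x / |x| * φ) = 2 * x * S / c := by
        rcases lt_or_gt_of_ne hx with hn | hp
        · rw [abs_of_neg hn] at hsin ⊢
          rw [show x / -x * φ = -φ by field_simp, Real.cos_neg, Real.sin_neg, hcos, hsin]
          exact ⟨rfl, by ring⟩
        · rw [abs_of_pos hp] at hsin ⊢
          rw [show x / x * φ = φ by field_simp, hcos, hsin]
          exact ⟨rfl, rfl⟩
      rw [← Complex.ofReal_cos, ← Complex.ofReal_sin, hcs.1, hcs.2, div_eq_iff hDc]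
      apply Complex.ext
      · simp
        field_simp
        rw [hD]; ring
      · simp
        field_simp
        rw [hD]; ring
    rw [e, Complex.arg_mul_cos_add_sin_mul_I (by positivity)]
    rcases lt_or_gt_of_ne hx with hn | hp
    · rw [abs_of_neg hn, show x / -x * φ = -φ by field_simp]
      exact ⟨by linarith, by linarith⟩
    · rw [abs_of_pos hp, show x / x * φ = φ by field_simp]
      exact ⟨by linarith, hπ.le⟩
  rw [arg, hφ, Real.arccos]
  field_simp

/-- For |x| below the edge, the t-range ends at 1 - e^{-λ} and the primitive there gives the
argument. For |x| between the edge and 1, the point 1 - e^{-λ} is not strictly between the roots 1/2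
± x* of 4t(1-t) = x². If λ ≤ log 2 the range is empty; otherwise it is the whole interval between
the roots, and the arcsine runs from -π/2 to π/2. -/
theorem rhoZero_eq_integral {lam : ℝ} (hlam : 0 < lam) {x : ℝ} (hx0 : x ≠ 0) :
    rhoZero lam x = ∫ t in tRange lam x, arcKernel lam (x, t) := by
  have he := Real.exp_pos (-lam)
  have he1 : Real.exp (-lam) < 1 := by simpa using hlam
  have hb1 := edge_le_one hlam
  have hb0 := edge_pos hlam
  have hbs := sq_edge hlam
  rcases le_or_gt 1 |x| with hx | hx
  · have n1 : x ∉ Ioo (-1 : ℝ) 1 := fun h => absurd (abs_lt.2 h) (not_lt.2 hx)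
    have n2 : x ∉ Ioo (-edge lam) (edge lam) := fun h =>
      n1 ⟨by linarith [h.1], by linarith [h.2]⟩
    rw [tRange_eq_empty n1, rhoZero, symIndicator, symIndicator, indicator_of_notMem n1,
      indicator_of_notMem n2]
    simp
  have m1 : x ∈ Ioo (-1 : ℝ) 1 := abs_lt.1 hx
  have hx2 : x ^ 2 < 1 := by rw [← sq_abs]; nlinarith [abs_nonneg x]
  have hw0 : 0 < 1 - x ^ 2 := by linarith
  set y := Real.exp (-lam) with hy
  set r := √(1 - x ^ 2) with hr
  have hr0 : 0 < r := Real.sqrt_pos.2 hw0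
  have hr2 : r ^ 2 = 1 - x ^ 2 := Real.sq_sqrt hw0.le
  have hxs : xStar x = 1 / 2 * r := rfl
  have hlog : lam ≤ Real.log 2 ↔ 1 / 2 ≤ y := by
    rw [hy, ← neg_le_neg_iff, ← Real.log_inv, Real.log_le_iff_le_exp (by norm_num)]
    norm_num
  rw [tRange]
  by_cases hxb : x ∈ Ioo (-edge lam) (edge lam)
  · have hxe : x ^ 2 < edge lam ^ 2 := sq_lt_sq' hxb.1 hxb.2
    rw [hbs] at hxe
    have hτ : (1 - 2 * y) ^ 2 < r ^ 2 := by rw [hr2]; linarith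
    have hab := abs_lt.1 (abs_lt_of_sq_lt_sq hτ hr0.le)
    rw [min_eq_left (by rw [hxs]; linarith [hab.2]), integral_arcKernel hlam hx0 hx
      (by rw [hxs]; linarith [hab.1]) (by rw [hxs]; linarith [hab.2]), ← hr]
    set S := √(4 * (1 - y) * y - x ^ 2) with hS
    have hSp : 0 < 4 * (1 - y) * y - x ^ 2 := by linarith
    have hS0 : 0 < S := Real.sqrt_pos.2 hSp
    have hS2 : S ^ 2 = 4 * (1 - y) * y - x ^ 2 := Real.sq_sqrt hSp.le
    have harg := arg_edge_quotient (A := 2 * y) (c := 4 * y * r) hx0 hS0 (by positivity) (by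
      rw [mul_pow _ r, hr2, mul_pow (2 * x), hS2]; ring)
    rw [rhoZero, symIndicator, symIndicator, indicator_of_mem m1, indicator_of_mem hxb]
    rw [sub_self, mul_zero, ite_self, add_zero, mul_one, ← hy, ← hS]
    rw [show (2 * (1 - y) - 1 - (1 - x ^ 2)) / (r * (2 * (1 - (1 - y)))) =
      -(((2 * y) ^ 2 - x ^ 2 + S ^ 2) / (4 * y * r)) by
        rw [hS2, show 2 * (1 - (1 - y)) = 2 * y by ring]; field_simp; ring, Real.arcsin_neg]
    calc _ = 1 / (Real.pi * lam) * (1 / x * Complex.arg (((2 * y - x : ℝ) + Complex.I * (S : ℝ)) /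
          ((2 * y + x : ℝ) + Complex.I * (S : ℝ)))) := by field_simp
      _ = _ := by rw [harg]; field_simp; ring
  · have hxe : edge lam ^ 2 ≤ x ^ 2 := by
      by_contra! h
      exact hxb (abs_lt.1 (abs_lt_of_sq_lt_sq h hb0.le))
    rw [hbs] at hxe
    have hτ : r ^ 2 ≤ (1 - 2 * y) ^ 2 := by rw [hr2]; linarith
    rw [rhoZero, symIndicator, symIndicator, indicator_of_mem m1, indicator_of_notMem hxb,
      mul_zero, zero_add, sub_zero, mul_one]
    by_cases hh : lam ≤ Real.log 2
    · rw [if_pos hh]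
      have h2 := hlog.1 hh
      have : r ≤ 2 * y - 1 := by
        have : (1 - 2 * y) ^ 2 = (2 * y - 1) ^ 2 := by ring
        rw [this] at hτ
        exact le_of_sq_le_sq hτ (by linarith)
      rw [Ioo_eq_empty, setIntegral_empty]
      rw [hxs, not_lt]
      exact (min_le_left _ _).trans (by linarith)
    · rw [if_neg hh]
      have h2 : y < 1 / 2 := not_le.1 (mt hlog.2 hh)
      have : r ≤ 1 - 2 * y := le_of_sq_le_sq hτ (by linarith)
      rw [min_eq_right (by rw [hxs]; linarith), integral_arcKernel hlam hx0 hx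
        (by rw [hxs]; linarith) le_rfl, ← hr, hxs]
      have hr1 : r < 1 := by
        have : 0 < x ^ 2 := by positivity
        nlinarith
      have h1r : 1 - r ≠ 0 := by linarith
      have : (2 * (1 / 2 + 1 / 2 * r) - 1 - (1 - x ^ 2)) / (r * (2 * (1 - (1 / 2 + 1 / 2 * r)))) =
          1 := by
        rw [← hr2, show (2 * (1 - (1 / 2 + 1 / 2 * r))) = 1 - r by ring]
        field_simp
        ring
      rw [this, Real.arcsin_one]
      field_simp
      ring

end DiscreteQGUE

/-! ### Moments of the leading density and both coefficients on polynomials. -/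

namespace DiscreteQGUE

open MeasureTheory Set Polynomial

theorem ae_eq_rhoZero {lam : ℝ} (hlam : 0 < lam) (f : ℝ → ℝ) :
    (fun x => ∫ t in tRange lam x, f x * arcKernel lam (x, t)) =ᵐ[volume]
      fun x => f x * rhoZero lam x := by
  have : ∀ᵐ x : ℝ ∂volume, x ≠ 0 := by simp [ae_iff]
  filter_upwards [this] with x hx
  rw [integral_const_mul, rhoZero_eq_integral hlam hx]

theorem integrable_mul_rhoZero {lam : ℝ} (hlam : 0 < lam) {f : ℝ → ℝ} (hf : Continuous f) :
    Integrable (fun x => f x * rhoZero lam x) :=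
  (integrable_congr (ae_eq_rhoZero hlam f)).1
    (integral_arcRegion_left (integrableOn_mul_arcKernel hlam hf))

theorem integral_mul_rhoZero {lam : ℝ} (hlam : 0 < lam) {f : ℝ → ℝ} (hf : Continuous f) :
    ∫ x, f x * rhoZero lam x = ∫ t in Ioo 0 (1 - Real.exp (-lam)),
      1 / (lam * Real.pi * (1 - t)) *
        ∫ θ in (0 : ℝ)..Real.pi, f (arcWidth t * Real.cos θ) := by
  rw [← integral_congr_ae (ae_eq_rhoZero hlam f),
    integral_arcRegion_swap (integrableOn_mul_arcKernel hlam hf)]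
  exact setIntegral_congr_fun measurableSet_Ioo fun t ht => integral_mul_arcKernel f ht

theorem abs_integral_mul_rhoZero_le {lam : ℝ} (hlam : 0 < lam) : ∃ A, 0 ≤ A ∧ ∀ (f : ℝ → ℝ) δ,
    Continuous f → (∀ x ∈ Icc (-1 : ℝ) 1, |f x| ≤ δ) → |∫ x, f x * rhoZero lam x| ≤ A * δ := by
  have he := Real.exp_pos (-lam)
  have he1 : Real.exp (-lam) < 1 := by simpa using hlam
  refine ⟨1 / (lam * Real.exp (-lam)) * (1 - Real.exp (-lam)),
    mul_nonneg (by positivity) (by linarith), fun f δ hc hf => ?_⟩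
  have hδ : 0 ≤ δ := (abs_nonneg _).trans (hf 0 (by norm_num))
  rw [integral_mul_rhoZero hlam hc]
  have := norm_setIntegral_le_of_norm_le_const (μ := volume) (s := Ioo 0 (1 - Real.exp (-lam)))
    (f := fun t => 1 / (lam * Real.pi * (1 - t)) *
      ∫ θ in (0 : ℝ)..Real.pi, f (arcWidth t * Real.cos θ))
    (C := 1 / (lam * Real.pi * Real.exp (-lam)) * (δ * Real.pi)) (by simp) fun t ht => by
      have h1 : Real.exp (-lam) ≤ 1 - t := by linarith [ht.2]
      have h2 : 0 < 1 - t := by linarith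
      have ha := (arcWidth_pos ht.1 (by linarith)).le
      have ha1 := arcWidth_le_one ht.1.le (by linarith)
      rw [norm_mul, Real.norm_eq_abs, abs_of_nonneg (by positivity)]
      have := intervalIntegral.norm_integral_le_of_norm_le_const (a := 0) (b := Real.pi) (C := δ)
        (f := fun θ => f (arcWidth t * Real.cos θ)) fun θ _ => hf _ (by
          have h3 := Real.neg_one_le_cos θ
          have h4 := Real.cos_le_one θ
          constructor <;> nlinarith)
      rw [sub_zero, abs_of_pos Real.pi_pos] at this
      gcongr
  refine this.trans_eq ?_
  rw [Real.volume_real_Ioo_of_le (by linarith)]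
  field_simp
  ring

theorem integral_pow_even_mul_rhoZero {lam : ℝ} (hlam : 0 < lam) (n : ℕ) :
    ∫ x, x ^ (2 * n) * rhoZero lam x = sinMean n *
      ∫ τ in (0 : ℝ)..1, (4 * (Real.exp (-lam * τ) * (1 - Real.exp (-lam * τ)))) ^ n := by
  have he := Real.exp_pos (-lam)
  have he1 : Real.exp (-lam) < 1 := by simpa using hlam
  rw [integral_mul_rhoZero hlam (by fun_prop), ← integral_Ioc_eq_integral_Ioo,
    ← intervalIntegral.integral_of_le (by linarith)]
  have e : ∫ t in (0 : ℝ)..(1 - Real.exp (-lam)), 1 / (lam * Real.pi * (1 - t)) *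
      (∫ θ in (0 : ℝ)..Real.pi, (arcWidth t * Real.cos θ) ^ (2 * n)) =
      (sinMean n / lam) *
        ∫ t in (0 : ℝ)..(1 - Real.exp (-lam)), 1 / (1 - t) * (4 * t * (1 - t)) ^ n := by
    rw [← intervalIntegral.integral_const_mul]
    refine intervalIntegral.integral_congr fun t ht => ?_
    rw [uIcc_of_le (by linarith)] at ht
    have h1 : 1 - t ≠ 0 := by linarith [ht.2]
    simp_rw [mul_pow (arcWidth t)]
    rw [intervalIntegral.integral_const_mul, integral_cos_pow_even, pow_mul (arcWidth t),
      arcWidth_sq ht.1 (by linarith [ht.2])]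
    field_simp
  rw [e, integral_comp_one_sub_exp]
  field_simp

theorem integral_pow_odd_mul_rhoZero {lam : ℝ} (hlam : 0 < lam) (n : ℕ) :
    ∫ x, x ^ (2 * n + 1) * rhoZero lam x = 0 := by
  rw [integral_mul_rhoZero hlam (by fun_prop)]
  simp_rw [mul_pow, intervalIntegral.integral_const_mul, integral_cos_pow_odd]
  simp

/-! ### The even part of a polynomial -/

/-- The polynomial `F` such that `F(x²)` is the even part of `p(x)`. -/
noncomputable def evenPart : ℝ[X] →ₗ[ℝ] ℝ[X] :=
  Polynomial.lsum fun m => if Even m then Polynomial.monomial (m / 2) else 0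

theorem evenPart_monomial_even (n : ℕ) (a : ℝ) :
    evenPart (monomial (2 * n) a) = monomial n a := by
  simp [evenPart, Polynomial.lsum]

theorem evenPart_monomial_odd (n : ℕ) (a : ℝ) : evenPart (monomial (2 * n + 1) a) = 0 := by
  simp [evenPart, Polynomial.lsum]

theorem eval_evenPart (p : ℝ[X]) (x : ℝ) :
    (evenPart p).eval (x ^ 2) = (p.eval x + p.eval (-x)) / 2 := by
  induction p using Polynomial.induction_on' with
  | add p q hp hq => simp only [map_add, eval_add, hp, hq]; ring
  | monomial m a =>
    rcases Nat.even_or_odd' m with ⟨n, rfl | rfl⟩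
    · rw [evenPart_monomial_even, eval_monomial, eval_monomial, eval_monomial, pow_mul (-x), neg_sq,
        ← pow_mul]
      ring
    · rw [evenPart_monomial_odd, eval_zero, eval_monomial, eval_monomial, pow_succ (-x),
        pow_mul (-x), neg_sq, ← pow_mul]
      ring

/-- The chain rule d/ds = (2x)⁻¹ d/dx for s = x². The constant term of p', which `divX` drops,
belongs to the odd part of p. -/
theorem derivative_evenPart (p : ℝ[X]) :
    derivative (evenPart p) = evenPart ((1 / 2 : ℝ) • divX (derivative p)) := by
  induction p using Polynomial.induction_on' with
  | add p q hp hq => simp only [map_add, hp, hq, divX_add, smul_add]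
  | monomial m a =>
    rcases Nat.even_or_odd' m with ⟨n, rfl | rfl⟩
    · rw [evenPart_monomial_even]
      rcases n with _ | n
      · simp
      · rw [derivative_monomial, derivative_monomial,
          show 2 * (n + 1) - 1 = 2 * n + 1 by omega, divX_monomial_succ, smul_monomial,
          evenPart_monomial_even]
        congr 1
        push_cast; rw [smul_eq_mul]; ring
    · rw [evenPart_monomial_odd, derivative_zero, derivative_monomial, Nat.add_sub_cancel]
      rcases n with _ | n
      · simp
      · rw [show 2 * (n + 1) = (2 * n + 1) + 1 by ring, divX_monomial_succ, smul_monomial,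
          evenPart_monomial_odd]

/-- A derivative in s costs two in x: one for d/dx and one for the division by x. -/
theorem polyBound_evenPart (R : ℝ) (k : ℕ) : ∃ A, 0 ≤ A ∧ ∀ (p : ℝ[X]) C, 0 ≤ C →
    PolyBound (Icc (-√R) (√R)) (2 * k) C p → PolyBound (Icc 0 R) k (A * C) (evenPart p) := by
  have hK : Convex ℝ (Icc (-√R) (√R)) := convex_Icc _ _
  have z : (0 : ℝ) ∈ Icc (-√R) (√R) := ⟨by simp, Real.sqrt_nonneg R⟩
  have base : ∀ (p : ℝ[X]) C, PolyBound (Icc (-√R) (√R)) 0 C p →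
      PolyBound (Icc 0 R) 0 C (evenPart p) := by
    intro p C hp i hi s hs
    obtain rfl : i = 0 := by omega
    have h1 : √s ≤ √R := Real.sqrt_le_sqrt hs.2
    have h0 := Real.sqrt_nonneg s
    have e : (evenPart p).eval s = (p.eval (√s) + p.eval (-√s)) / 2 := by
      have := eval_evenPart p (√s)
      rwa [Real.sq_sqrt hs.1] at this
    have b1 := hp.eval (s := √s) ⟨by linarith, h1⟩
    have b2 := hp.eval (s := -√s) ⟨by linarith, by linarith⟩
    rw [Function.iterate_zero, id, e, abs_div, abs_two]
    have := abs_add_le (p.eval (√s)) (p.eval (-√s))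
    linarith
  induction k with
  | zero => exact ⟨1, zero_le_one, fun p C _ hp => by rw [one_mul]; exact base p C hp⟩
  | succ k ih =>
    obtain ⟨A, hA, hA'⟩ := ih
    obtain ⟨B, hB, hB'⟩ := (((UnifBounded.of_divX (ι := Unit) hK z (2 * k)).comp
      (UnifBounded.of_derivative (2 * k + 1))).smul (c := fun _ => 1 / 2) (B := 1 / 2)
        (by norm_num))
    refine ⟨1 + A * B, by positivity, fun p C hC hp => PolyBound.succ_iff.2 ⟨?_, ?_⟩⟩
    · refine (base p C (hp.mono (Nat.zero_le _) le_rfl)).mono le_rfl ?_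
      have : 0 ≤ A * B * C := by positivity
      linarith
    · rw [derivative_evenPart]
      refine (hA' _ (B * C) (by positivity) (hB' () p C hC (hp.mono (by omega) le_rfl))).mono
        le_rfl ?_
      linarith

theorem continuous_eval_exp (lam : ℝ) (P : ℝ[X]) :
    Continuous fun τ : ℝ => P.eval (Real.exp (-lam * τ)) := by fun_prop

theorem limitMean_add (lam : ℝ) (F G : ℝ[X]) :
    limitMean lam (F + G) = limitMean lam F + limitMean lam G := by
  simp only [limitMean, eval_meanPoly, map_add]
  simp only [← eval_meanPoly]
  exact intervalIntegral.integral_add ((continuous_eval_exp lam _).intervalIntegrable _ _)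
    ((continuous_eval_exp lam _).intervalIntegrable _ _)

theorem limitCorrection_add (lam : ℝ) (F G : ℝ[X]) :
    limitCorrection lam (F + G) = limitCorrection lam F + limitCorrection lam G := by
  have e : meanPoly (F + G) = meanPoly F + meanPoly G := by simp [meanPoly]
  simp only [limitCorrection, eval_correctionPoly, map_add, e, expDeriv, mul_add,
    smul_add, eval_add]
  simp only [← eval_correctionPoly]
  rw [intervalIntegral.integral_add ((continuous_eval_exp lam _).intervalIntegrable _ _)
    ((continuous_eval_exp lam _).intervalIntegrable _ _)]
  ring

theorem limitCorrection_smul (lam c : ℝ) (F : ℝ[X]) :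
    limitCorrection lam (c • F) = c * limitCorrection lam F := by
  have e : meanPoly (c • F) = c • meanPoly F := by simp [meanPoly]
  simp only [limitCorrection, eval_correctionPoly, map_smul, e, expDeriv,
    mul_smul_comm, eval_smul, smul_eq_mul, intervalIntegral.integral_const_mul]
  ring

theorem limitCorrection_C (lam a : ℝ) : limitCorrection lam (C a) = 0 := by
  have e : meanPoly (C a) = C a := by
    simp [meanPoly, mulCoeff_C, sinMean]
  simp [limitCorrection, eval_correctionPoly, meanCorrection_C, e, expDeriv]

theorem integral_eval_mul_rhoZero {lam : ℝ} (hlam : 0 < lam) (p : ℝ[X]) :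
    ∫ x, p.eval x * rhoZero lam x = limitMean lam (evenPart p) := by
  induction p using Polynomial.induction_on' with
  | add p q hp hq =>
    simp only [eval_add, add_mul]
    rw [integral_add (integrable_mul_rhoZero hlam p.continuous)
      (integrable_mul_rhoZero hlam q.continuous), hp, hq, map_add, limitMean_add]
  | monomial m a =>
    simp only [eval_monomial, mul_assoc]
    rw [integral_const_mul]
    rcases Nat.even_or_odd' m with ⟨n, rfl | rfl⟩
    · rw [integral_pow_even_mul_rhoZero hlam, evenPart_monomial_even, limitMean]
      simp only [eval_meanPoly, arcsineMean_monomial, intervalIntegral.integral_const_mul]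
      ring
    · rw [integral_pow_odd_mul_rhoZero hlam, evenPart_monomial_odd]
      simp [limitMean, meanPoly]

theorem contDiff_eval (p : ℝ[X]) : ContDiff ℝ ∞ fun x => p.eval x := by
  simpa [Polynomial.coe_aeval_eq_eval] using p.contDiff_aeval (𝕜 := ℝ) (R := ℝ) ∞

/-- The coefficient of N⁻² is the Hadamard-regularised pairing, here for polynomials; by linearity
monomials suffice, and odd ones vanish on both sides. -/
theorem regValue_eval {lam : ℝ} (hlam : 0 < lam) (p : ℝ[X]) :
    regValue lam (fun x => p.eval x) = limitCorrection lam (evenPart p) := by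
  induction p using Polynomial.induction_on' with
  | add p q hp hq =>
    simp only [eval_add]
    rw [regValue_add lam (contDiff_eval p) (contDiff_eval q), hp, hq, map_add, limitCorrection_add]
  | monomial m a =>
    simp only [eval_monomial]
    rw [regValue_mul lam a (by fun_prop)]
    rcases Nat.even_or_odd' m with ⟨n, rfl | rfl⟩
    · rw [evenPart_monomial_even]
      rcases n with _ | n
      · rw [monomial_zero_left, limitCorrection_C]
        have : regValue lam (fun x => x ^ (2 * 0)) = 0 := by
          simp only [regValue, iterate_eulerOp_pow, semicircle_mul, bulkSemicircle_mul]
          push_cast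
          ring
        rw [this, mul_zero]
      · rw [regValue_pow_even hlam, ← limitCorrection_monomial, ← limitCorrection_smul,
          smul_monomial, smul_eq_mul, mul_one]
    · rw [evenPart_monomial_odd, regValue_pow_odd, ← C_0, limitCorrection_C, mul_zero]

end DiscreteQGUE

/-! ### From polynomials to smooth test functions. -/

namespace DiscreteQGUE

open MeasureTheory Set Polynomial

theorem exists_derivative_eq (p : ℝ[X]) : ∃ P : ℝ[X], derivative P = p := by
  induction p using Polynomial.induction_on' with
  | add p q hp hq =>
    obtain ⟨P, rfl⟩ := hp
    obtain ⟨Q, rfl⟩ := hq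
    exact ⟨P + Q, derivative_add⟩
  | monomial n a =>
    refine ⟨monomial (n + 1) (a / (n + 1)), ?_⟩
    rw [derivative_monomial, Nat.add_sub_cancel]
    congr 1
    push_cast
    field_simp

theorem iteratedDeriv_eval (p : ℝ[X]) (i : ℕ) :
    iteratedDeriv i (fun x => p.eval x) = fun x => (derivative^[i] p).eval x := by
  induction i generalizing p with
  | zero => simp
  | succ i ih =>
    have : deriv (fun x => p.eval x) = fun x => (derivative p).eval x := by
      ext x; exact p.deriv
    rw [iteratedDeriv_succ', this, ih, Function.iterate_succ_apply]

/-- Polynomials are dense in the smooth functions, on compact intervals and for finitely many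
derivatives. -/
theorem exists_polynomial_near_iteratedDeriv {r : ℝ} (hr : 0 < r) (n : ℕ) :
    ∀ f : ℝ → ℝ, ContDiff ℝ ∞ f → ∀ δ : ℝ, 0 < δ → ∃ p : ℝ[X], ∀ i ≤ n, ∀ x ∈ Icc (-r) r,
      |iteratedDeriv i f x - (derivative^[i] p).eval x| ≤ δ := by
  induction n with
  | zero =>
    intro f hf δ hδ
    obtain ⟨p, hp⟩ := exists_polynomial_near_of_continuousOn (-r) r f hf.continuous.continuousOn δ hδ
    refine ⟨p, fun i hi x hx => ?_⟩
    obtain rfl : i = 0 := by omega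
    rw [abs_sub_comm]
    simpa using (hp x hx).le
  | succ n ih =>
    intro f hf δ hδ
    have hd : ContDiff ℝ ∞ (deriv f) := (contDiff_infty_iff_deriv.1 hf).2
    -- The derivative is approximated and integrated from 0, with the constant term adjusted to
    -- f(0); the error of the values is then at most rδ/(1+r) ≤ δ.
    obtain ⟨p', hp'⟩ := ih (deriv f) hd (δ / (1 + r)) (by positivity)
    obtain ⟨P, rfl⟩ := exists_derivative_eq p'
    have hle : δ / (1 + r) ≤ δ := div_le_self hδ.le (by linarith)
    refine ⟨P + C (f 0 - P.eval 0), fun i hi x hx => ?_⟩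
    rcases i with _ | i
    · have hfd : Differentiable ℝ f := hf.differentiable (by simp)
      have h := Convex.norm_image_sub_le_of_norm_deriv_le (f := fun x => f x - P.eval x)
        (C := δ / (1 + r)) (s := Icc (-r) r) (x := 0) (y := x)
        (fun y _ => (hfd y).sub P.differentiableAt)
        (fun y hy => by
          have e : deriv (fun x => f x - P.eval x) y = deriv f y - (derivative P).eval y := by
            rw [deriv_fun_sub (hfd y) P.differentiableAt, P.deriv]
          rw [e, Real.norm_eq_abs]
          simpa using hp' 0 (Nat.zero_le _) y hy)
        (convex_Icc _ _) ⟨by linarith, hr.le⟩ hx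
      have hx' : |x| ≤ r := abs_le.2 hx
      simp only [Real.norm_eq_abs, sub_zero] at h
      have e : iteratedDeriv 0 f x - (derivative^[0] (P + C (f 0 - P.eval 0))).eval x =
          f x - P.eval x - (f 0 - P.eval 0) := by
        simp only [iteratedDeriv_zero, Function.iterate_zero, id, eval_add, eval_C]; ring
      rw [e]
      refine h.trans ?_
      rw [div_mul_eq_mul_div, div_le_iff₀ (by linarith)]
      gcongr
      linarith
    · rw [iteratedDeriv_succ', Function.iterate_succ_apply, derivative_add, derivative_C, add_zero]
      exact (hp' i (by omega) x hx).trans hle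

theorem iteratedDeriv_eulerOp {f : ℝ → ℝ} (hf : ContDiff ℝ ∞ f) (j : ℕ) :
    iteratedDeriv j (eulerOp f) =
      fun x => (j + 1) * iteratedDeriv j f x + x * iteratedDeriv (j + 1) f x := by
  induction j with
  | zero => ext x; simp [eulerOp, iteratedDeriv_one]
  | succ j ih =>
    ext x
    have hd : ∀ m : ℕ, HasDerivAt (iteratedDeriv m f) (iteratedDeriv (m + 1) f x) x := fun m => by
      rw [iteratedDeriv_succ]
      exact ((hf.differentiable_iteratedDeriv m (by exact_mod_cast ENat.natCast_lt_top m)) x).hasDerivAt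
    rw [iteratedDeriv_succ, ih]
    have := ((hd j).const_mul ((j : ℝ) + 1)).add ((hasDerivAt_id x).mul (hd (j + 1)))
    refine (HasDerivAt.deriv this).trans ?_
    push_cast
    simp only [id]
    ring

/-- The j-th derivative of (xf)' is (j+1) f^{(j)} + x f^{(j+1)}. With j + 1 ≤ 3 and |x| ≤ 1 each
application costs one derivative and a factor 3 + 1. -/
theorem abs_iterate_eulerOp_le {C : ℝ} (i : ℕ) : ∀ n f, n + i ≤ 3 → ContDiff ℝ ∞ f →
    (∀ j ≤ n + i, ∀ x ∈ Icc (-1 : ℝ) 1, |iteratedDeriv j f x| ≤ C) →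
    ∀ j ≤ n, ∀ x ∈ Icc (-1 : ℝ) 1, |iteratedDeriv j (eulerOp^[i] f) x| ≤ 4 ^ i * C := by
  induction i with
  | zero => intro n f _ _ h j hj x hx; simpa using h j hj x hx
  | succ i ih =>
    intro n f hn hf h j hj x hx
    have h' := ih (n + 1) f (by omega) hf (fun j hj => h j (by omega))
    rw [Function.iterate_succ_apply', iteratedDeriv_eulerOp (contDiff_iterate_eulerOp hf i)]
    have b0 := h' j (by omega) x hx
    have b1 := h' (j + 1) (by omega) x hx
    have hj2 : (j : ℝ) + 1 ≤ 3 := by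
      have : j ≤ 2 := by omega
      have : (j : ℝ) ≤ 2 := by exact_mod_cast this
      linarith
    have hx1 : |x| ≤ 1 := abs_le.2 hx
    refine (abs_add_le _ _).trans ?_
    rw [abs_mul, abs_mul, abs_of_nonneg (by positivity : (0 : ℝ) ≤ (j : ℝ) + 1)]
    have c0 := mul_le_mul hj2 b0 (abs_nonneg _) (by norm_num)
    have c1 := mul_le_mul hx1 b1 (abs_nonneg _) zero_le_one
    rw [pow_succ]
    linarith

theorem abs_regValue_le_of_iteratedDeriv {lam : ℝ} (hlam : 0 < lam) : ∃ A, 0 ≤ A ∧ ∀ f δ, 0 ≤ δ →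
    ContDiff ℝ ∞ f → (∀ j ≤ 3, ∀ x ∈ Icc (-1 : ℝ) 1, |iteratedDeriv j f x| ≤ δ) →
    |regValue lam f| ≤ A * δ := by
  obtain ⟨A, hA, h⟩ := abs_regValue_le hlam
  refine ⟨A * 4 ^ 3, by positivity, fun f δ hδ hf hd => ?_⟩
  rw [mul_assoc]
  refine h f _ fun i hi x hx => ?_
  have := abs_iterate_eulerOp_le i 0 f (by omega) hf (fun j hj => hd j (by omega)) 0 le_rfl x hx
  rw [iteratedDeriv_zero] at this
  refine this.trans ?_
  gcongr
  norm_num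

theorem qHermite_neg_sq (n : ℕ) (x q : ℝ) : qHermite n (-x) q ^ 2 = qHermite n x q ^ 2 := by
  have : qHermite n (-x) q = (-1) ^ n * qHermite n x q := by
    unfold qHermite
    rw [Finset.mul_sum]
    refine Finset.sum_congr rfl fun k hk => ?_
    have hk' : 2 * k ≤ n := by have := Finset.mem_range.1 hk; omega
    have e : (-1 : ℝ) ^ n = (-1) ^ (n - 2 * k) := by
      conv_lhs => rw [← Nat.sub_add_cancel hk', pow_add, pow_mul]
      simp
    rw [neg_pow x, e]
    ring
  rw [this, mul_pow, ← pow_mul, mul_comm n 2, pow_mul]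
  simp

theorem weight_neg (q x : ℝ) : weight q (-x) = weight q x := by
  unfold weight
  rw [mul_neg, neg_neg, mul_comm (qPochInf (-(q * x)) q)]

theorem density_neg (q : ℝ) (N : ℕ) (x : ℝ) : density q N (-x) = density q N x := by
  simp only [density, weight_neg, qHermite_neg_sq]

/-- The Jackson series of `f` against the rescaled density, over the positive (`ε = 1`) or the
negative (`ε = -1`) half of its support. -/
theorem hasSum_jackson_scaledDensity {q ε : ℝ} (h0 : 0 < q) (h1 : q < 1) (hε : ε = 1 ∨ ε = -1)
    (N : ℕ) (f : ℝ → ℝ) (hf : SeqBdd fun k => f (ε * √q * q ^ k)) :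
    HasSum (fun k : ℕ => ε * √q * q ^ k * (f (ε * √q * q ^ k) * scaledDensity q N (ε * √q * q ^ k)))
      (1 / (1 - q) * (ε * ∑ j ∈ Finset.range N,
        latticeMean q j (fun k => f (ε * √q * q ^ k)) / 2)) := by
  have hs : 0 < √q := Real.sqrt_pos.2 h0
  have hden : ∀ k : ℕ, scaledDensity q N (ε * √q * q ^ k) = 1 / √q * density q N (q ^ k) := fun k => by
    have e : ε * √q * q ^ k / √q = ε * q ^ k := by field_simp
    rw [scaledDensity, e]
    rcases hε with rfl | rfl
    · rw [one_mul]
    · rw [neg_one_mul, density_neg]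
  have hj : ∀ j, HasSum (fun k : ℕ => q ^ k * latticeWeight q k *
      (qHermite j (q ^ k) q ^ 2 * f (ε * √q * q ^ k)) / (2 * hermiteMoment q j 0))
      (latticeMean q j (fun k => f (ε * √q * q ^ k)) / 2) := fun j => by
    have := (summable_lattice h0 h1 (seqBdd_hermite_sq_mul h0 h1 j hf)).hasSum.div_const
      (2 * hermiteMoment q j 0)
    rwa [← latticeSum, mul_comm (2 : ℝ), ← div_div, ← latticeMean, mul_comm _ (2 : ℝ)] at this
  have := ((hasSum_sum fun j (_ : j ∈ Finset.range N) => hj j).mul_left ε).mul_left (1 / (1 - q))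
  refine Eq.mp (congrArg (fun g => HasSum g _) (funext fun k => ?_)) this
  symm
  rw [hden, density, Finset.mul_sum, Finset.mul_sum, Finset.mul_sum, Finset.mul_sum, Finset.mul_sum,
    Finset.mul_sum]
  refine Finset.sum_congr rfl fun j _ => ?_
  have hm := hermiteMoment_norm h0 h1 j
  have hp := hermiteMoment_norm_pos h0 h1 j
  -- The norm of H_j over the whole lattice is twice the moment over its positive half.
  have e : qPoch q q j * q ^ (j * (j - 1) / 2) = 2 * hermiteMoment q j 0 := by rw [hm]; ring
  rw [e, latticeWeight]
  have : (1 - q) ≠ 0 := by linarith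
  field_simp

/-- The half-integrals have opposite orientation and lattice points of opposite sign, so they add
up. The density is even, hence only the even part of f survives, and the factor 1 - q cancels
against its normalisation. -/
theorem jacksonInterval_scaledDensity {q : ℝ} (h0 : 0 < q) (h1 : q < 1) (N : ℕ) (f : ℝ → ℝ)
    (hp : SeqBdd fun k => f (√q * q ^ k)) (hn : SeqBdd fun k => f (-√q * q ^ k)) :
    jacksonInterval q (-√q) (√q) (fun x => f x * scaledDensity q N x) =
      ∑ j ∈ Finset.range N,
        latticeMean q j (fun k => (f (√q * q ^ k) + f (-√q * q ^ k)) / 2) := by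
  have a := hasSum_jackson_scaledDensity h0 h1 (.inl rfl) N f (by simpa using hp)
  have b := hasSum_jackson_scaledDensity h0 h1 (.inr rfl) N f (by simpa using hn)
  simp only [one_mul, neg_one_mul] at a b
  have : (1 - q) ≠ 0 := by linarith
  rw [jacksonInterval, jackson, jackson, a.tsum_eq, b.tsum_eq, ← mul_assoc, ← mul_assoc,
    mul_one_div_cancel this, one_mul, one_mul, sub_neg_eq_add, ← Finset.sum_add_distrib]
  refine Finset.sum_congr rfl fun j _ => ?_
  rw [← add_div, ← latticeMean_add h0 h1 j hp hn, div_eq_inv_mul, ← latticeMean_mul]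
  congr 1
  ext k
  ring

theorem seqBdd_comp_lattice {q : ℝ} (h0 : 0 < q) (h1 : q < 1) {f : ℝ → ℝ} (hf : Continuous f)
    {a : ℝ} (ha : |a| ≤ 1) : SeqBdd fun k => f (a * q ^ k) := by
  obtain ⟨M, hM⟩ := (isCompact_Icc (a := (-1 : ℝ)) (b := 1)).exists_bound_of_continuousOn
    hf.continuousOn
  refine ⟨M, fun k => hM _ (abs_le.1 ?_)⟩
  rw [abs_mul, abs_of_pos (pow_pos h0 k)]
  exact mul_le_one₀ ha (pow_pos h0 k).le (pow_le_one₀ h0.le h1.le)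

theorem abs_sqrt_le_one {q : ℝ} (h1 : q < 1) : |√q| ≤ 1 := by
  rw [abs_of_nonneg (Real.sqrt_nonneg q)]
  exact Real.sqrt_le_one.2 h1.le

theorem jacksonInterval_eval {q : ℝ} (h0 : 0 < q) (h1 : q < 1) (N : ℕ) (p : ℝ[X]) :
    jacksonInterval q (-√q) (√q) (fun x => p.eval x * scaledDensity q N x) =
      ∑ j ∈ Finset.range N, hermiteExp q j (evenPart p) := by
  have ha := abs_sqrt_le_one h1
  rw [jacksonInterval_scaledDensity h0 h1 N _ (seqBdd_comp_lattice h0 h1 p.continuous ha)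
    (seqBdd_comp_lattice h0 h1 p.continuous (by rwa [abs_neg]))]
  refine Finset.sum_congr rfl fun j _ => ?_
  rw [hermiteExp_eq h0 h1]
  congr 1
  ext k
  rw [neg_mul, ← eval_evenPart, mul_pow, Real.sq_sqrt h0.le]

theorem abs_jacksonInterval_sub_le {q : ℝ} (h0 : 0 < q) (h1 : q < 1) (N : ℕ) {f g : ℝ → ℝ}
    (hf : Continuous f) (hg : Continuous g) {δ : ℝ} (h : ∀ x ∈ Icc (-1 : ℝ) 1, |f x - g x| ≤ δ) :
    |jacksonInterval q (-√q) (√q) (fun x => f x * scaledDensity q N x) -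
      jacksonInterval q (-√q) (√q) (fun x => g x * scaledDensity q N x)| ≤ N * δ := by
  have ha := abs_sqrt_le_one h1
  have ha' : |-√q| ≤ 1 := by rwa [abs_neg]
  have half : ∀ {a b : ℕ → ℝ}, SeqBdd a → SeqBdd b → SeqBdd fun k => (a k + b k) / 2 :=
    fun ha hb => by simpa only [div_eq_inv_mul] using (SeqBdd.const _).mul (ha.add hb)
  have fp := seqBdd_comp_lattice h0 h1 hf ha
  have fn := seqBdd_comp_lattice h0 h1 hf ha'
  have gp := seqBdd_comp_lattice h0 h1 hg ha
  have gn := seqBdd_comp_lattice h0 h1 hg ha'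
  have hm : ∀ {a : ℝ}, |a| ≤ 1 → ∀ k : ℕ, |f (a * q ^ k) - g (a * q ^ k)| ≤ δ := fun ha k => by
    refine h _ (abs_le.1 ?_)
    rw [abs_mul, abs_of_pos (pow_pos h0 k)]
    exact mul_le_one₀ ha (pow_pos h0 k).le (pow_le_one₀ h0.le h1.le)
  rw [jacksonInterval_scaledDensity h0 h1 N f fp fn, jacksonInterval_scaledDensity h0 h1 N g gp gn,
    ← Finset.sum_sub_distrib]
  refine (Finset.abs_sum_le_sum_abs _ _).trans ?_
  refine (Finset.sum_le_sum fun j _ => ?_).trans_eq (by rw [Finset.sum_const, Finset.card_range,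
    nsmul_eq_mul])
  rw [← latticeMean_sub h0 h1 j (half fp fn) (half gp gn)]
  refine abs_latticeMean_le h0 h1 j fun k => ?_
  have b1 := abs_le.1 (hm ha k)
  have b2 := abs_le.1 (hm ha' k)
  exact abs_le.2 ⟨by linarith [b1.1, b2.1], by linarith [b1.2, b2.2]⟩

/-- The expansion of the linear statistics, with an explicit error bound. -/
theorem abs_jackson_expansion_le {lam : ℝ} (hlam : 0 < lam) {f : ℝ → ℝ} (hf : ContDiff ℝ ∞ f) :
    ∃ B : ℝ, ∀ N : ℕ, 1 ≤ N →
      |1 / (N : ℝ) * jacksonInterval (qScaled lam N) (-√(qScaled lam N)) (√(qScaled lam N))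
          (fun x => f x * scaledDensity (qScaled lam N) N x) -
        ((∫ x, f x * rhoZero lam x) + regValue lam f / (N : ℝ) ^ 2)| ≤ B / N ^ 4 := by
  obtain ⟨R, hR, A, hA, hexp⟩ := sum_hermiteExp_expansion hlam
  obtain ⟨E, hE, heven⟩ := polyBound_evenPart R 12
  obtain ⟨A0, hA0, h0⟩ := abs_integral_mul_rhoZero_le hlam
  obtain ⟨A1, hA1, h1⟩ := abs_regValue_le_of_iteratedDeriv hlam
  have hR1 : 1 ≤ √R := Real.one_le_sqrt.2 hR
  -- The dilations in the error bounds leave [0, 1], so f has to be controlled on an interval that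
  -- may be larger than the one carrying the densities.
  have hsub : Icc (-1 : ℝ) 1 ⊆ Icc (-√R) (√R) := Icc_subset_Icc (by linarith) hR1
  obtain ⟨M, hM0, hM⟩ : ∃ M, 0 ≤ M ∧ ∀ i ≤ 2 * 12, ∀ x ∈ Icc (-√R) (√R),
      |iteratedDeriv i f x| ≤ M := by
    have hc : ∀ i : ℕ, ∃ M, ∀ x ∈ Icc (-√R) (√R), |iteratedDeriv i f x| ≤ M := fun i =>
      isCompact_Icc.exists_bound_of_continuousOn
        (hf.continuous_iteratedDeriv i (by exact_mod_cast le_top)).continuousOn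
    choose M hM using hc
    refine ⟨∑ i ∈ Finset.range 25, |M i|, by positivity, fun i hi x hx => ?_⟩
    exact ((hM i x hx).trans (le_abs_self _)).trans (Finset.single_le_sum (f := fun i => |M i|)
      (fun _ _ => abs_nonneg _) (Finset.mem_range.2 (by omega)))
  refine ⟨1 + A * (E * (M + 1)) + A0 + A1, fun N hN => ?_⟩
  have hN0 : (0 : ℝ) < N := by exact_mod_cast hN
  have hN1 : (1 : ℝ) ≤ N := by exact_mod_cast hN
  have hN4 : 1 / (N : ℝ) ^ 4 ≤ 1 := by
    rw [div_le_one (by positivity)]; exact one_le_pow₀ hN1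
  have hδ : 0 < 1 / (N : ℝ) ^ 4 := by positivity
  -- The polynomial depends on N. It is N⁻⁴-close to f together with 24 derivatives, which become 12
  -- in the variable x². The replacement therefore costs O(N⁻⁴), while the norm of p stays below M +
  -- 1, so the constant in its expansion is uniform in N.
  obtain ⟨p, hp⟩ := exists_polynomial_near_iteratedDeriv (lt_of_lt_of_le one_pos hR1) (2 * 12) f hf
    (1 / (N : ℝ) ^ 4) hδ
  have hbound : PolyBound (Icc (-√R) (√R)) (2 * 12) (M + 1) p := fun i hi x hx => by
    have a := abs_le.1 (hp i hi x hx)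
    have b := abs_le.1 (hM i hi x hx)
    exact abs_le.2 ⟨by linarith [a.1, a.2, b.1, b.2], by linarith [a.1, a.2, b.1, b.2]⟩
  have hclose : ∀ x ∈ Icc (-1 : ℝ) 1, |f x - p.eval x| ≤ 1 / (N : ℝ) ^ 4 := fun x hx => by
    simpa using hp 0 (by norm_num) x (hsub hx)
  have hpc := contDiff_eval p
  have hdiff : ContDiff ℝ ∞ fun x => f x - p.eval x := hf.sub hpc
  have hq0 : 0 < qScaled lam N := Real.exp_pos _
  have hq1 : qScaled lam N < 1 := by
    rw [qScaled, Real.exp_lt_one_iff, neg_div]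
    exact neg_neg_of_pos (by positivity)
  have e1 := hexp N hN (evenPart p) (E * (M + 1)) (by positivity) (heven p (M + 1) (by positivity) hbound)
  rw [← neg_div, ← qScaled, ← jacksonInterval_eval hq0 hq1, ← integral_eval_mul_rhoZero hlam,
    ← regValue_eval hlam] at e1
  have e2 := abs_jacksonInterval_sub_le hq0 hq1 N hf.continuous p.continuous hclose
  have e3 := h0 (fun x => f x - p.eval x) _ hdiff.continuous hclose
  simp only [sub_mul] at e3
  rw [integral_sub (integrable_mul_rhoZero hlam hf.continuous)
    (integrable_mul_rhoZero hlam p.continuous)] at e3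
  have e4 := h1 (fun x => f x - p.eval x) _ hδ.le hdiff fun j hj x hx => by
    rw [iteratedDeriv_fun_sub (hf.contDiffAt.of_le (by exact_mod_cast le_top))
      (hpc.contDiffAt.of_le (by exact_mod_cast le_top)), iteratedDeriv_eval]
    exact hp j (by omega) x (hsub hx)
  have hadd := regValue_add lam hdiff hpc
  simp only [sub_add_cancel] at hadd
  set J := jacksonInterval (qScaled lam N) (-√(qScaled lam N)) (√(qScaled lam N))
    (fun x => f x * scaledDensity (qScaled lam N) N x)
  set J' := jacksonInterval (qScaled lam N) (-√(qScaled lam N)) (√(qScaled lam N))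
    (fun x => p.eval x * scaledDensity (qScaled lam N) N x)
  set I := ∫ x, f x * rhoZero lam x
  set I' := ∫ x, p.eval x * rhoZero lam x
  set V := regValue lam fun x => f x - p.eval x
  set V' := regValue lam fun x => p.eval x
  have f2 : |1 / (N : ℝ) * (J - J')| ≤ 1 / (N : ℝ) ^ 4 := by
    rw [abs_mul, abs_of_pos (by positivity : (0 : ℝ) < 1 / N), one_div, inv_mul_le_iff₀ hN0]
    exact e2
  have f4 : |V / (N : ℝ) ^ 2| ≤ A1 * (1 / (N : ℝ) ^ 4) := by
    rw [abs_div, abs_of_pos (by positivity : (0 : ℝ) < (N : ℝ) ^ 2)]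
    exact (div_le_self (abs_nonneg _) (one_le_pow₀ hN1)).trans e4
  have e : 1 / (N : ℝ) * J - (I + regValue lam f / (N : ℝ) ^ 2) =
      1 / (N : ℝ) * (J - J') + (1 / (N : ℝ) * J' - (I' + V' / (N : ℝ) ^ 2)) - (I - I') -
        V / (N : ℝ) ^ 2 := by
    rw [hadd]; ring
  rw [e]
  refine (abs_sub _ _).trans ((add_le_add ((abs_sub _ _).trans (add_le_add
    ((abs_add_le _ _).trans (add_le_add f2 e1)) e3)) f4).trans_eq ?_)
  ring

end DiscreteQGUE

theorem theorem2p3 (lam : ℝ) (hlam : 0 < lam) (f : ℝ → ℝ) (hf : ContDiff ℝ ∞ f) :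
    (∀ N : ℕ, 1 ≤ N → ∀ a ∈ ({√(DiscreteQGUE.qScaled lam N), -√(DiscreteQGUE.qScaled lam N)} : Set ℝ),
      DiscreteQGUE.JacksonSummable (DiscreteQGUE.qScaled lam N) a
        (fun x => f x * DiscreteQGUE.scaledDensity (DiscreteQGUE.qScaled lam N) N x)) ∧
    MeasureTheory.Integrable (fun x => f x * DiscreteQGUE.rhoZero lam x) ∧
    (∀ s : ℂ, 0 < s.re → DiscreteQGUE.RhoOnePairingConverges lam f s) ∧
    ∃ v : ℝ,
      DiscreteQGUE.IsRegularisedValue (DiscreteQGUE.rhoOnePairing lam f) (-5 / 2) v ∧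
      (fun N : ℕ =>
          1 / (N : ℝ) *
              DiscreteQGUE.jacksonInterval (DiscreteQGUE.qScaled lam N)
                (-√(DiscreteQGUE.qScaled lam N)) (√(DiscreteQGUE.qScaled lam N))
                (fun x => f x * DiscreteQGUE.scaledDensity (DiscreteQGUE.qScaled lam N) N x) -
            ((∫ x, f x * DiscreteQGUE.rhoZero lam x) + v / (N : ℝ) ^ 2))
        =O[Filter.atTop] (fun N : ℕ => 1 / (N : ℝ) ^ 4) := by
  have hq : ∀ N : ℕ, 1 ≤ N → 0 < DiscreteQGUE.qScaled lam N ∧ DiscreteQGUE.qScaled lam N < 1 := by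
    intro N hN
    have : (0 : ℝ) < N := by exact_mod_cast hN
    refine ⟨Real.exp_pos _, ?_⟩
    rw [DiscreteQGUE.qScaled, Real.exp_lt_one_iff, neg_div]
    exact neg_neg_of_pos (by positivity)
  refine ⟨fun N hN a ha => ?_, DiscreteQGUE.integrable_mul_rhoZero hlam hf.continuous,
    fun s hs => DiscreteQGUE.rhoOnePairingConverges hf.continuous hs,
    DiscreteQGUE.regValue lam f, DiscreteQGUE.isRegularisedValue_regValue hlam hf, ?_⟩
  · obtain ⟨h0, h1⟩ := hq N hN
    have hb := DiscreteQGUE.abs_sqrt_le_one h1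
    rcases ha with rfl | rfl
    · have := DiscreteQGUE.hasSum_jackson_scaledDensity h0 h1 (.inl rfl) N f
        (DiscreteQGUE.seqBdd_comp_lattice h0 h1 hf.continuous (by rwa [one_mul]))
      simp only [one_mul] at this
      exact this.summable
    · have := DiscreteQGUE.hasSum_jackson_scaledDensity h0 h1 (.inr rfl) N f
        (DiscreteQGUE.seqBdd_comp_lattice h0 h1 hf.continuous (by rwa [neg_one_mul, abs_neg]))
      simp only [neg_one_mul] at this
      exact this.summable
  · obtain ⟨B, hB⟩ := DiscreteQGUE.abs_jackson_expansion_le hlam hf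
    refine Asymptotics.IsBigO.of_bound B ?_
    filter_upwards [Filter.eventually_ge_atTop 1] with N hN
    rw [Real.norm_eq_abs, Real.norm_of_nonneg (by positivity), mul_one_div]
    exact hB N hN
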